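/- **Model.** There are $n$ parties $p_1,\dots,p_n$, of which a set of $f\le t$ parties is Byzantine (controlled by one adversary), where $n>3t$; the others are honest. All parties see a global clock and know $\Delta>0$. Links are authenticated; the adversary sees all messages, chooses delivery times, and sends arbitrary messages on behalf of Byzantine parties, subject to ideal threshold signatures: it cannot produce an honest party's signature share that it has not seen, and a threshold signature on $m$ can be produced only from shares on $m$ of $n-t$ different parties. A run is *synchronous* if every message between honest parties is delivered within time $\Delta$ of being sent (a message due at the moment at which a waiting period ends is delivered before that period ends). Local computation takes no time, and honest parties whose waiting periods end at the same time act simultaneously. The size of a message in words is one plus the number of values and signatures that it contains. The *communication cost* of a run is the number of words sent in messages among honest parties. **Protocol.** Each party keeps VALUE (initially its input) and LOCK, KEY, COMMIT (initially $\bot$); it *decides* when it sets COMMIT. View $j=1,\dots,n$ has sequence number $j$ and leader $p_j$. Put $S_1=0$ and $S_j=7\Delta+9\Delta(j-2)$ for $j\ge2$; view $j$ occupies the time from $S_j$ to $S_{j+1}$. At time $S_1=0$ all parties start view $1$. For $j\ge 2$, at time $S_j$ all parties other than $p_j$ start view $j$; if $p_j$ has not decided, it sends a key request to all parties and starts view $j$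 at time $S_j+2\Delta$; if $p_j$ has decided, it does not take part in view $j$. A party answers the first key request of each party with its (KEY, VALUE). On receiving a key reply $(k,v)$ with $k\ne\bot$, a party sets (KEY, VALUE) to $(k,v)$ if KEY $=\bot$ or $k$ has a larger sequence number than KEY, and $k$ is valid for $v$, that is, it consists of the sequence number $s$ of a view that this party has already wedged and a threshold signature on (preKey, $s$, $p_s$, $v$). On starting view $j$ the leader fixes $v:=$ VALUE and sends $v$ and KEY to all parties. A party that has started and not yet wedged view $j$ answers this message by a signature share on (preKey, $j$, $p_j$, $v$) if the attached key is $\bot$ or valid for $v$, and moreover LOCK $=\bot$ or the key is not $\bot$ and has sequence number at least LOCK. With $n-t$ valid shares from different parties the leader forms a threshold signature $\nu_k$ and sends $(v,\nu_k)$ to all; a party that receives it and finds it valid stores it as keyProof and answers by a share on (key, $j$, $p_j$, $v$). From $n-t$ of these the leader forms $\nu_l$ and sends $(v,\nu_l)$ to all; parties store it as lockProof and answer by a share on (lock, $j$, $p_j$, $v$). From $n-t$ of these the leader forms $\nu_c$ and sends $(v,\nu_c)$ to all; parties store it as commitProof. A party share-signs at most once in each of the three rounds of a view, and the leader considers only the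 first share message of each party in each round. At time $S_{j+1}$ every party that started view $j$ wedges it (from then on it ignores the leader's messages of that view) and, if it has a keyProof $(v,\nu_k)$, sets VALUE $:=v$, KEY $:=(j,\nu_k)$; if it has a lockProof, sets LOCK $:=j$; if it has a commitProof $(v,\nu_c)$, sets COMMIT $:=(v,j,\nu_c)$ and thus decides $v$. **Statement.** In every synchronous run of this protocol with at most $t$ Byzantine parties, $n>3t$: 1. (Conditional progress.) Let $\tau_j=9\Delta(j-1)$, the time at which $p_j$ starts view $j$ if it takes part ($\tau_1=S_1$, $\tau_j=S_j+2\Delta$ for $j\ge2$). If $p_j$ is honest and has not decided before time $\tau_j$, then all honest parties have decided at time $\tau_j+7\Delta$. 2. (Termination.) All honest parties eventually decide. 3. (Cost.) If $n=O(t)$, then the communication cost is $O(ft+t)$ words, where $f$ is the actual number of Byzantine parties: for every $K$ there is a $C$ such that for all $n,t,f$ with $3t<n\le Kt$ and $f\le t$, for all $\Delta>0$, every domain of values, all inputs and every synchronous run with exactly $f$ Byzantine parties, the communication cost is at most $C(ft+t)$. The same bound holds for the number of all words that honest parties send, including those sent to Byzantine parties. -/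

import Mathlib

/-!
The adaptive synchronous Byzantine agreement protocol: messages and ideal threshold signatures,
the code of an honest party, and runs against a Byzantine adversary.

Parties are the elements of `Fin n`. The view led by party `l` has sequence number `l + 1`,
so views are numbered `1, …, n` and are executed in this order.
-/

namespace AdaptiveBA

/-! ### Signatures and messages -/

/-- The three share-collecting rounds of a leader-based view. -/
inductive Round where
  | preKey
  | key
  | lock

/-- The round that follows a given one, if any. -/
def Round.next : Round → Option Round
  | .preKey => some .key
  | .key => some .lock
  | .lock => none

/-- What is signed in a view: the name of the round, the sequence number, the leader, a value. -/
structure Stmt (n : ℕ) (V : Type*) where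
  round : Round
  sq : ℕ
  leader : Fin n
  value : V

/-- Ideal signatures: the share of a party on a statement, the threshold signature on a statement
(combined from `n - t` shares), and strings that are neither. A share `ρ` is a valid share of `q`
on `m` iff `ρ = share q m`; a threshold signature `ν` is valid for `m` iff `ν = thr m`. -/
inductive Sig (n : ℕ) (V : Type*) where
  | share (signer : Fin n) (m : Stmt n V)
  | thr (m : Stmt n V)
  | junk

/-- A key: the sequence number of the view in which it was obtained, and a proof. -/
structure Key (n : ℕ) (V : Type*) where
  sq : ℕ
  proof : Sig n V

/-- A value with a proof (the contents of keyProof, lockProof and commitProof). -/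
structure Cert (n : ℕ) (V : Type*) where
  val : V
  proof : Sig n V

/-- The contents of COMMIT. -/
structure Commit (n : ℕ) (V : Type*) where
  val : V
  sq : ℕ
  proof : Sig n V

/-- Messages.
`share r` is the reply of a party in round `r`: keyShare, lockShare, commitShare for
`r = preKey, key, lock`.
`cert r` is the leader's message that carries the threshold signature combined in round `r`:
the KeyStep, lockStep, commit message for `r = preKey, key, lock`. -/
inductive Msg (n : ℕ) (V : Type*) where
  | preKeyStep (sq : ℕ) (leader : Fin n) (value : V) (key : Option (Key n V))
  | share (r : Round) (sq : ℕ) (leader : Fin n) (ρ : Sig n V)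
  | cert (r : Round) (sq : ℕ) (leader : Fin n) (value : V) (ν : Sig n V)
  | keyRequest
  | keyReply (key : Option (Key n V)) (value : V)

/-- The signatures that a message contains. -/
def Msg.sigs {n : ℕ} {V : Type*} : Msg n V → List (Sig n V)
  | .preKeyStep _ _ _ none => []
  | .preKeyStep _ _ _ (some k) => [k.proof]
  | .share _ _ _ ρ => [ρ]
  | .cert _ _ _ _ ν => [ν]
  | .keyRequest => []
  | .keyReply none _ => []
  | .keyReply (some k) _ => [k.proof]

/-- The number of values that a message contains. -/
def Msg.values {n : ℕ} {V : Type*} : Msg n V → ℕ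
  | .preKeyStep _ _ _ _ => 1
  | .share _ _ _ _ => 0
  | .cert _ _ _ _ _ => 1
  | .keyRequest => 0
  | .keyReply _ _ => 1

/-- The size of a message in words: one word for the header, one for each value and one for each
signature in it. -/
def Msg.words {n : ℕ} {V : Type*} (m : Msg n V) : ℕ :=
  1 + m.values + m.sigs.length

/-! ### The local state of a party -/

/-- The local variables of one instance of a leader-based view. -/
structure LBV (n : ℕ) (V : Type*) where
  /-- startView was invoked -/
  started : Bool
  /-- wedgeView was not invoked yet -/
  active : Bool
  /-- `proof preKey`, `proof key`, `proof lock` are keyProof, lockProof, commitProof -/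
  proof : Round → Option (Cert n V)
  /-- the party has produced its share for the round; it does so at most once per round -/
  signed : Round → Bool
  /-- leader: the value that it proposes, its VALUE at the invocation of startView -/
  proposal : Option V
  /-- leader: the round for which it is waiting for shares -/
  waiting : Option Round
  /-- leader: the parties from which a share message for the round was received -/
  heard : Round → Finset (Fin n)
  /-- leader: the parties from which a valid share for the round was collected -/
  shares : Round → Finset (Fin n)

/-- The instance before startView. -/
def LBV.fresh (n : ℕ) (V : Type*) : LBV n V where
  started := false
  active := true
  proof := fun _ => none
  signed := fun _ => false
  proposal := none
  waiting := none
  heard := fun _ => ∅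
  shares := fun _ => ∅

/-- Where a party stands in the main procedure. -/
inductive PC (n : ℕ) where
  /-- about to propose -/
  | start
  /-- waiting in the view with leader `l`, to be wedged at the next timeout -/
  | view (l : Fin n)
  /-- leader `l` itself, waiting for replies to its keyRequest -/
  | query (l : Fin n)
  /-- leader `l` itself, which has decided and lets the time slot of its view pass -/
  | skip (l : Fin n)
  | finished

/-- The local state of a party; `none` stands for `⊥`. -/
structure LState (n : ℕ) (V : Type*) where
  LOCK : Option ℕ
  KEY : Option (Key n V)
  VALUE : V
  COMMIT : Option (Commit n V)
  LEADER : ℕ → Option (Fin n)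
  /-- the instances, indexed by sequence number and leader -/
  lbv : ℕ × Fin n → LBV n V
  /-- the parties whose keyRequest was answered -/
  replied : Finset (Fin n)
  pc : PC n
  /-- the time at which the current wait ends -/
  wake : Option ℝ

/-- The initial state of a party with input `v`; it proposes at time `0`. -/
def LState.initial {n : ℕ} {V : Type*} (v : V) : LState n V where
  LOCK := none
  KEY := none
  VALUE := v
  COMMIT := none
  LEADER := fun _ => none
  lbv := fun _ => LBV.fresh n V
  replied := ∅
  pc := .start
  wake := some 0

/-- A party decides when it sets COMMIT. -/
def LState.Decided {n : ℕ} {V : Type*} (s : LState n V) : Prop :=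
  s.COMMIT ≠ none

/-- Outgoing messages, each with its recipient. -/
abbrev Out (n : ℕ) (V : Type*) := List (Fin n × Msg n V)

/-- Send a message to all parties, the sender included. -/
def toAll {n : ℕ} {V : Type*} (m : Msg n V) : Out n V :=
  (List.finRange n).map fun q => (q, m)

/-- Replace the local variables of one instance. -/
def LState.setLBV {n : ℕ} {V : Type*} (s : LState n V) (sq : ℕ) (l : Fin n) (L : LBV n V) :
    LState n V :=
  { s with lbv := Function.update s.lbv (sq, l) L }

/-- `k` proves that `value` is safe: its proof is a valid threshold signature on
`(preKey, k.sq, LEADER[k.sq], value)`. -/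
def LState.ValidKey {n : ℕ} {V : Type*} (s : LState n V) (k : Key n V) (value : V) : Prop :=
  ∃ l, s.LEADER k.sq = some l ∧ k.proof = .thr ⟨.preKey, k.sq, l, value⟩

/-! ### The code of an honest party -/

/-- startView of the instance `(sq, l)` at party `i`. The leader sends its VALUE and KEY to all. -/
def startView {n : ℕ} {V : Type*} (i : Fin n) (sq : ℕ) (l : Fin n) (s : LState n V) :
    LState n V × Out n V :=
  let L := s.lbv (sq, l)
  if l = i then
    (s.setLBV sq l
        { L with started := true, proposal := some s.VALUE, waiting := some .preKey },
      toAll (.preKeyStep sq l s.VALUE s.KEY))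
  else
    (s.setLBV sq l { L with started := true }, [])

/-- wedgeView of the instance `(sq, l)`, followed by the update of the local state with the
returned proofs. -/
def wedgeAndUpdate {n : ℕ} {V : Type*} (sq : ℕ) (l : Fin n) (s : LState n V) : LState n V :=
  let L := s.lbv (sq, l)
  { s.setLBV sq l { L with active := false } with
    LEADER := Function.update s.LEADER sq (some l)
    KEY := match L.proof .preKey with
      | some c => some ⟨sq, c.proof⟩
      | none => s.KEY
    VALUE := match L.proof .preKey with
      | some c => c.val
      | none => s.VALUE
    LOCK := match L.proof .key with
      | some _ => some sq
      | none => s.LOCK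
    COMMIT := match L.proof .lock with
      | some c => some ⟨c.val, sq, c.proof⟩
      | none => s.COMMIT }

open scoped Classical in
/-- On `preKeyStep` from party `src`: answer with a share if the key is up to date and valid. -/
noncomputable def onPreKeyStep {n : ℕ} {V : Type*} (i src : Fin n) (s : LState n V)
    (sq : ℕ) (l : Fin n) (value : V) (key : Option (Key n V)) : LState n V × Out n V :=
  let L := s.lbv (sq, l)
  if src = l ∧ L.started = true ∧ L.active = true ∧ L.signed .preKey = false ∧
      (s.LOCK = none ∨ ∃ k x, key = some k ∧ s.LOCK = some x ∧ x ≤ k.sq) ∧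
      (∀ k, key = some k → s.ValidKey k value) then
    (s.setLBV sq l { L with signed := Function.update L.signed .preKey true },
      [(l, .share .preKey sq l (.share i ⟨.preKey, sq, l, value⟩))])
  else (s, [])

open scoped Classical in
/-- On the leader's message with a threshold signature of round `r`: store it, and answer with a
share for the next round (the commit message, `r = lock`, is not answered). -/
noncomputable def onCert {n : ℕ} {V : Type*} (i src : Fin n) (s : LState n V)
    (r : Round) (sq : ℕ) (l : Fin n) (value : V) (ν : Sig n V) : LState n V × Out n V :=
  let L := s.lbv (sq, l)
  if src = l ∧ L.started = true ∧ L.active = true ∧ ν = .thr ⟨r, sq, l, value⟩ then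
    let P := Function.update L.proof r (some ⟨value, ν⟩)
    match r.next with
    | some r' =>
      if L.signed r' = false then
        (s.setLBV sq l { L with proof := P, signed := Function.update L.signed r' true },
          [(l, .share r' sq l (.share i ⟨r', sq, l, value⟩))])
      else (s, [])
    | none => (s.setLBV sq l { L with proof := P }, [])
  else (s, [])

open scoped Classical in
/-- On a share message of round `r` from party `src`, for the first time: the leader collects the
share if it is valid; when it is waiting for round `r` and has `n - t` shares, it combines them
into a threshold signature, sends it to all with its value, and turns to the next round. -/
noncomputable def onShare {n : ℕ} {V : Type*} (t : ℕ) (i src : Fin n) (s : LState n V)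
    (r : Round) (sq : ℕ) (l : Fin n) (ρ : Sig n V) : LState n V × Out n V :=
  let L := s.lbv (sq, l)
  match L.proposal with
  | some v =>
    if l = i ∧ L.started = true ∧ src ∉ L.heard r then
      let S := if ρ = .share src ⟨r, sq, l, v⟩ then insert src (L.shares r) else L.shares r
      let L' := { L with
        heard := Function.update L.heard r (insert src (L.heard r))
        shares := Function.update L.shares r S }
      if L.waiting = some r ∧ n - t ≤ S.card then
        (s.setLBV sq l { L' with waiting := r.next },
          toAll (.cert r sq l v (.thr ⟨r, sq, l, v⟩)))
      else (s.setLBV sq l L', [])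
    else (s, [])
  | none => (s, [])

/-- On a keyRequest from `src`, for the first time: reply with KEY and VALUE. -/
def onKeyRequest {n : ℕ} {V : Type*} (src : Fin n) (s : LState n V) : LState n V × Out n V :=
  if src ∈ s.replied then (s, [])
  else ({ s with replied := insert src s.replied }, [(src, .keyReply s.KEY s.VALUE)])

open scoped Classical in
/-- On a keyReply: adopt the key and the value if the key is valid and more recent. -/
noncomputable def onKeyReply {n : ℕ} {V : Type*} (s : LState n V)
    (key : Option (Key n V)) (value : V) : LState n V :=
  match key with
  | none => s
  | some k =>
    if (∀ k₀, s.KEY = some k₀ → k₀.sq < k.sq) ∧ s.ValidKey k value then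
      { s with KEY := some k, VALUE := value }
    else s

/-- The message handler of party `i`, for a message from `src`. -/
noncomputable def receive {n : ℕ} {V : Type*} (t : ℕ) (i src : Fin n) (s : LState n V) :
    Msg n V → LState n V × Out n V
  | .preKeyStep sq l value key => onPreKeyStep i src s sq l value key
  | .share r sq l ρ => onShare t i src s r sq l ρ
  | .cert r sq l value ν => onCert i src s r sq l value ν
  | .keyRequest => onKeyRequest src s
  | .keyReply key value => (onKeyReply s key value, [])

/-- Entering the time slot of the view led by the party with index `j ≥ 1` (its sequence number is
`j + 1`) at time `now`. All parties but the leader start the view and wedge it after `9Δ`. The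
leader first asks all parties for their keys if it has not decided, and otherwise stays out. -/
noncomputable def enterView {n : ℕ} {V : Type*} (Δ : ℝ) (i : Fin n) (j : ℕ) (now : ℝ)
    (s : LState n V) : LState n V × Out n V :=
  if h : j < n then
    let l : Fin n := ⟨j, h⟩
    if i ≠ l then
      let p := startView i (j + 1) l s
      ({ p.1 with pc := .view l, wake := some (now + 9 * Δ) }, p.2)
    else match s.COMMIT with
      | none => ({ s with pc := .query l, wake := some (now + 2 * Δ) }, toAll .keyRequest)
      | some _ => ({ s with pc := .skip l, wake := some (now + 9 * Δ) }, [])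
  else ({ s with pc := .finished, wake := none }, [])

/-- What party `i` does when its current wait ends, at time `now`. -/
noncomputable def timeout {n : ℕ} {V : Type*} (Δ : ℝ) (i : Fin n) (now : ℝ) (s : LState n V) :
    LState n V × Out n V :=
  match s.pc with
  | .start =>
    let l : Fin n := ⟨0, i.pos⟩
    let p := startView i 1 l s
    ({ p.1 with pc := .view l, wake := some (now + 7 * Δ) }, p.2)
  | .view l => enterView Δ i (l.val + 1) now (wedgeAndUpdate (l.val + 1) l s)
  | .query l =>
    let p := startView i (l.val + 1) l s
    ({ p.1 with pc := .view l, wake := some (now + 7 * Δ) }, p.2)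
  | .skip l => enterView Δ i (l.val + 1) now s
  | .finished => ({ s with wake := none }, [])

/-! ### Runs -/

/-- A message in the network, with its true sender (links are authenticated), its recipient and
the time at which it was sent. -/
structure Env (n : ℕ) (V : Type*) where
  src : Fin n
  dst : Fin n
  msg : Msg n V
  sentAt : ℝ

/-- A global configuration. The states of Byzantine parties play no role. -/
structure Config (n : ℕ) (V : Type*) where
  time : ℝ
  st : Fin n → LState n V
  /-- all messages sent so far -/
  sent : List (Env n V)
  /-- the messages sent and not yet delivered -/
  pending : Multiset (Env n V)

/-- The signatures that the adversary can produce, when `B` is the set of Byzantine parties and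
`known` are the signatures seen so far: it can sign for Byzantine parties and can combine shares
of `n - t` different parties, but it cannot forge. -/
inductive Derivable {n : ℕ} {V : Type*} (t : ℕ) (B : Finset (Fin n)) (known : Sig n V → Prop) :
    Sig n V → Prop where
  | seen (σ : Sig n V) : known σ → Derivable t B known σ
  | junk : Derivable t B known .junk
  | own (b : Fin n) (m : Stmt n V) : b ∈ B → Derivable t B known (.share b m)
  | combine (m : Stmt n V) (Q : Finset (Fin n)) : n - t ≤ Q.card →
      (∀ q ∈ Q, Derivable t B known (.share q m)) → Derivable t B known (.thr m)

/-- The events of a run. -/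
inductive Event (n : ℕ) (V : Type*) where
  /-- a pending message is delivered -/
  | deliver (e : Env n V)
  /-- a Byzantine party sends a message -/
  | byzSend (e : Env n V)
  /-- the clock moves to time `τ` -/
  | advance (τ : ℝ)
  /-- all honest parties whose wait ends at the current time proceed -/
  | tick

/-- The messages in `o`, sent by `src` at time `now`. -/
def envs {n : ℕ} {V : Type*} (src : Fin n) (now : ℝ) (o : Out n V) : List (Env n V) :=
  o.map fun x => ⟨src, x.1, x.2, now⟩

/-- The honest party `i` has a wait that ends at the current time. -/
def Config.Due {n : ℕ} {V : Type*} (B : Finset (Fin n)) (c : Config n V) (i : Fin n) : Prop :=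
  i ∉ B ∧ (c.st i).wake = some c.time

open scoped Classical in
/-- The state and the outgoing messages of party `i` after a tick. -/
noncomputable def Config.tickResult {n : ℕ} {V : Type*} (Δ : ℝ) (B : Finset (Fin n))
    (c : Config n V) (i : Fin n) : LState n V × Out n V :=
  if c.Due B i then timeout Δ i c.time (c.st i) else (c.st i, [])

/-- The transitions, with `B` the set of Byzantine parties. -/
inductive Step {n : ℕ} {V : Type*} (t : ℕ) (Δ : ℝ) (B : Finset (Fin n)) :
    Config n V → Event n V → Config n V → Prop where
  /-- An honest recipient runs its handler. -/
  | deliver (c : Config n V) (e : Env n V) (rest : Multiset (Env n V))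
      (s' : LState n V) (out : Out n V)
      (hpending : c.pending = e ::ₘ rest) (hdst : e.dst ∉ B)
      (hout : receive t e.dst e.src (c.st e.dst) e.msg = (s', out)) :
      Step t Δ B c (.deliver e)
        { time := c.time
          st := Function.update c.st e.dst s'
          sent := c.sent ++ envs e.dst c.time out
          pending := rest + ↑(envs e.dst c.time out) }
  /-- Nothing is prescribed for a Byzantine recipient. -/
  | deliverByz (c : Config n V) (e : Env n V) (rest : Multiset (Env n V))
      (hpending : c.pending = e ::ₘ rest) (hdst : e.dst ∈ B) :
      Step t Δ B c (.deliver e) { c with pending := rest }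
  /-- Byzantine parties send any messages whose signatures the adversary can produce; it sees all
  messages in the network. -/
  | byzSend (c : Config n V) (e : Env n V) (hsrc : e.src ∈ B) (htime : e.sentAt = c.time)
      (hsigs : ∀ σ ∈ e.msg.sigs, Derivable t B (fun σ' => ∃ e' ∈ c.sent, σ' ∈ e'.msg.sigs) σ) :
      Step t Δ B c (.byzSend e)
        { c with sent := c.sent ++ [e], pending := e ::ₘ c.pending }
  /-- The clock does not skip the end of a wait of an honest party. -/
  | advance (c : Config n V) (τ : ℝ) (hlt : c.time < τ)
      (hwake : ∀ i, i ∉ B → ∀ w, (c.st i).wake = some w → τ ≤ w) :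
      Step t Δ B c (.advance τ) { c with time := τ }
  | tick (c : Config n V) (hdue : ∃ i, c.Due B i) :
      Step t Δ B c .tick
        { time := c.time
          st := fun i => (c.tickResult Δ B i).1
          sent := c.sent ++
            (List.finRange n).flatMap fun i => envs i c.time (c.tickResult Δ B i).2
          pending := c.pending +
            ↑((List.finRange n).flatMap fun i => envs i c.time (c.tickResult Δ B i).2) }

/-- The initial configuration. -/
def Config.initial {n : ℕ} {V : Type*} (input : Fin n → V) : Config n V where
  time := 0
  st := fun i => LState.initial (input i)
  sent := []
  pending := 0

/-- A run of the protocol with `n` parties, resilience `t`, delay parameter `Δ`, Byzantine parties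
`B` and the given inputs. -/
structure Run {V : Type*} (n t : ℕ) (Δ : ℝ) (B : Finset (Fin n)) (input : Fin n → V) where
  cfg : ℕ → Config n V
  ev : ℕ → Event n V
  start : cfg 0 = Config.initial input
  step : ∀ k, Step t Δ B (cfg k) (ev k) (cfg (k + 1))
  /-- time passes beyond every bound -/
  diverges : ∀ T : ℝ, ∃ k, T ≤ (cfg k).time

/-- The run is synchronous: every message between honest parties is delivered within time `Δ`. A
message that is due at the very moment at which a wait ends is delivered before the wait ends. -/
def Run.Synchronous {V : Type*} {n t : ℕ} {Δ : ℝ} {B : Finset (Fin n)} {input : Fin n → V}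
    (ρ : Run n t Δ B input) : Prop :=
  ∀ k, ∀ e ∈ (ρ.cfg k).pending, e.src ∉ B → e.dst ∉ B →
    (ρ.cfg k).time ≤ e.sentAt + Δ ∧ (ρ.ev k = .tick → (ρ.cfg k).time < e.sentAt + Δ)

/-- All honest parties eventually decide. -/
def Run.Terminates {V : Type*} {n t : ℕ} {Δ : ℝ} {B : Finset (Fin n)} {input : Fin n → V}
    (ρ : Run n t Δ B input) : Prop :=
  ∀ i, i ∉ B → ∃ k, ((ρ.cfg k).st i).Decided

/-- The time at which party `l`, if it takes part as the leader, starts its view: the first view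
starts at time `0` and is wedged at time `7Δ`, and each later one takes `9Δ`, of which the
leader spends the first `2Δ` on asking for keys. -/
def leaderStart {n : ℕ} (Δ : ℝ) (l : Fin n) : ℝ :=
  9 * Δ * (l.val : ℝ)

/-- If the leader of a view is honest and has not decided before it starts the view at time `τ`,
then all honest parties have decided at time `τ + 7Δ`. -/
def Run.ConditionalProgress {V : Type*} {n t : ℕ} {Δ : ℝ} {B : Finset (Fin n)}
    {input : Fin n → V} (ρ : Run n t Δ B input) : Prop :=
  ∀ l, l ∉ B → (∀ k, (ρ.cfg k).time < leaderStart Δ l → ¬ ((ρ.cfg k).st l).Decided) →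
    ∃ k, (ρ.cfg k).time ≤ leaderStart Δ l + 7 * Δ ∧ ∀ i, i ∉ B → ((ρ.cfg k).st i).Decided

/-- The number of words in a list of messages. -/
def totalWords {n : ℕ} {V : Type*} (es : List (Env n V)) : ℕ :=
  (es.map fun e => e.msg.words).sum

/-- The communication cost of a run: the words sent in messages among honest parties. -/
noncomputable def Run.commCost {V : Type*} {n t : ℕ} {Δ : ℝ} {B : Finset (Fin n)}
    {input : Fin n → V} (ρ : Run n t Δ B input) : ℕ∞ :=
  ⨆ k, (totalWords ((ρ.cfg k).sent.filter fun e => e.src ∉ B ∧ e.dst ∉ B) : ℕ∞)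

/-- The words sent by honest parties in a run, to honest or Byzantine parties. -/
noncomputable def Run.honestCost {V : Type*} {n t : ℕ} {Δ : ℝ} {B : Finset (Fin n)}
    {input : Fin n → V} (ρ : Run n t Δ B input) : ℕ∞ :=
  ⨆ k, (totalWords ((ρ.cfg k).sent.filter fun e => e.src ∉ B) : ℕ∞)

end AdaptiveBA

/-! Keys. A lock of view `x` rests on a threshold signature of the key round. Since `n - t > t`,
some honest party gave a share to it, and that party had stored its keyProof before. Honest parties
wedge a view simultaneously, so at the end of that very slot this party holds a key of sequence
number `x`. Hence at every later time each honest lock `x` is matched by an honest key of sequence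
number at least `x` (field `lock` of `Safe`). Keys are also transferable (`Safe.validKey_transfer`):
honest parties agree on the leader of each wedged view. The only exception is a party that sat out
its own view, but then nobody honest signed in that view and no key of it exists.

Progress. Let an honest leader take part and start its view at time `τ`. It asked for keys at `τ -
2Δ`, unless its view is the first, before which there are neither keys nor locks. No honest party
had answered it before, so by `τ` it has a key that dominates every honest lock, and all honest
parties accept its proposal. Each of the three rounds then takes at most `2Δ`: a request within `Δ`,
and the `n - t` or more honest shares within another `Δ`. The commit message goes out by `τ + 6Δ`
and arrives by `τ + 7Δ`, when the view is wedged and all honest parties decide. `QueryInv` and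
`ViewInv` express these deadlines independently of the order of delivery: the message that matters
is still pending and was sent early enough, or its effect is present.

Termination. An honest leader either has decided before its slot and skips it, or makes everybody
decide.

Cost. Once one honest leader has completed its slot as a participant, every later honest leader
finds itself decided and stays silent. So at most one honest party ever leads. An honest party then
serves at most `f + 1` leaders, each with one key reply and three shares, and the single honest
leader sends to all at most five times. This gives at most `4n(f + 1) + 5n ≤ 9n(f + 1)` messages of
at most three words, that is, `O(ft + t)` words for `n ≤ Kt`.

All this is packed into one invariant `Inv`, indexed by the phase of the schedule. `Inv.step` shows
that every event preserves it or closes the phase at the right time. `Run.exists_inv` carries it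
along the run, and `Inv.sum_cost_le` reads off the cost. -/

namespace AdaptiveBA

variable {n : ℕ} {V : Type*}

/-! ### Progress of a local state -/

/-- The position of a round among the three. -/
def Round.rank : Round → ℕ
  | .preKey => 0
  | .key => 1
  | .lock => 2

/-- The number of rounds that a leader waiting for shares of the given round has completed. -/
def waitRank : Option Round → ℕ
  | some r => r.rank
  | none => 3

theorem Round.rank_lt_three (r : Round) : r.rank < 3 := by cases r <;> decide

theorem waitRank_next (r : Round) : waitRank r.next = r.rank + 1 := by cases r <;> rfl

theorem rank_of_next {r r' : Round} (h : r.next = some r') : r'.rank = r.rank + 1 := by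
  rw [← waitRank_next, h]; rfl

theorem waitRank_le_three (w : Option Round) : waitRank w ≤ 3 := by
  rcases w with _ | r
  · exact le_rfl
  · exact r.rank_lt_three.le

/-- KEY is present with sequence number at least `x`. -/
def LState.KeyGe (s : LState n V) (x : ℕ) : Prop := ∃ k, s.KEY = some k ∧ x ≤ k.sq

/-- Party `i` takes, or has taken, part in its own view as the leader. -/
def LState.Active (i : Fin n) (s : LState n V) : Prop :=
  s.pc = .query i ∨ (s.lbv (i.val + 1, i)).started = true

/-- The state of party `i` has evolved from `s` to `s'`. -/
structure LState.Le (i : Fin n) (s s' : LState n V) : Prop where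
  started : ∀ x, (s.lbv x).started = true → (s'.lbv x).started = true
  signed : ∀ x r, (s.lbv x).signed r = true → (s'.lbv x).signed r = true
  proof : ∀ x r, (s.lbv x).proof r ≠ none → (s'.lbv x).proof r ≠ none
  shares : ∀ x r, (s.lbv x).shares r ⊆ (s'.lbv x).shares r
  proposal : ∀ x v, (s.lbv x).proposal = some v →
    (s'.lbv x).proposal = some v ∧ waitRank (s.lbv x).waiting ≤ waitRank (s'.lbv x).waiting
  keyGe : ∀ x, s.KeyGe x → s'.KeyGe x
  decided : s.Decided → s'.Decided
  active : s.Active i → s'.Active i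

theorem LState.Le.refl (i : Fin n) (s : LState n V) : s.Le i s :=
  ⟨fun _ => id, fun _ _ => id, fun _ _ => id, fun _ _ => subset_rfl, fun _ _ h => ⟨h, le_rfl⟩,
    fun _ => id, id, id⟩

/-- The conditions under which a party answers a preKeyStep message with the given value and
key. -/
def LState.Accepts (s : LState n V) (value : V) (key : Option (Key n V)) : Prop :=
  (s.LOCK = none ∨ ∃ k x, key = some k ∧ s.LOCK = some x ∧ x ≤ k.sq) ∧
    ∀ k, key = some k → s.ValidKey k value

/-! ### The message handler -/

/-- The leader has enough shares of the round for which it is waiting. -/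
def LBV.Fires (t : ℕ) (L : LBV n V) (r : Round) (S : Finset (Fin n)) : Prop :=
  L.waiting = some r ∧ n - t ≤ S.card

open scoped Classical in
/-- The leader's collection of shares of round `r` after the receipt of `ρ` from `src`. -/
noncomputable def LBV.collected (L : LBV n V) (src : Fin n) (r : Round) (sq : ℕ) (l : Fin n)
    (ρ : Sig n V) (v : V) : Finset (Fin n) :=
  if ρ = .share src ⟨r, sq, l, v⟩ then insert src (L.shares r) else L.shares r

open scoped Classical in
/-- The leader's instance after the receipt of a share message. -/
noncomputable def LBV.collect (L : LBV n V) (src : Fin n) (r : Round) (S : Finset (Fin n)) :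
    LBV n V :=
  { L with
    heard := Function.update L.heard r (insert src (L.heard r))
    shares := Function.update L.shares r S }

open scoped Classical in
/-- The outcomes of the message handler. -/
inductive Recv (t : ℕ) (i src : Fin n) (s : LState n V) :
    Msg n V → LState n V → Out n V → Prop where
  | ignore (m : Msg n V) : Recv t i src s m s []
  | signPreKey (sq : ℕ) (value : V) (key : Option (Key n V))
      (hst : (s.lbv (sq, src)).started = true)
      (hsg : (s.lbv (sq, src)).signed .preKey = false) (hacc : s.Accepts value key) :
      Recv t i src s (.preKeyStep sq src value key)
        (s.setLBV sq src { s.lbv (sq, src) with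
          signed := Function.update (s.lbv (sq, src)).signed .preKey true })
        [(src, .share .preKey sq src (.share i ⟨.preKey, sq, src, value⟩))]
  | signNext (r r' : Round) (sq : ℕ) (value : V) (hr : r.next = some r')
      (hst : (s.lbv (sq, src)).started = true)
      (hsg : (s.lbv (sq, src)).signed r' = false) :
      Recv t i src s (.cert r sq src value (.thr ⟨r, sq, src, value⟩))
        (s.setLBV sq src { s.lbv (sq, src) with
          proof := Function.update (s.lbv (sq, src)).proof r
            (some ⟨value, .thr ⟨r, sq, src, value⟩⟩)
          signed := Function.update (s.lbv (sq, src)).signed r' true })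
        [(src, .share r' sq src (.share i ⟨r', sq, src, value⟩))]
  | store (r : Round) (sq : ℕ) (value : V) (hr : r.next = none)
      (hst : (s.lbv (sq, src)).started = true) :
      Recv t i src s (.cert r sq src value (.thr ⟨r, sq, src, value⟩))
        (s.setLBV sq src { s.lbv (sq, src) with
          proof := Function.update (s.lbv (sq, src)).proof r
            (some ⟨value, .thr ⟨r, sq, src, value⟩⟩) })
        []
  | collect (r : Round) (sq : ℕ) (ρ : Sig n V) (v : V)
      (hv : (s.lbv (sq, i)).proposal = some v) (hst : (s.lbv (sq, i)).started = true)
      (hsrc : src ∉ (s.lbv (sq, i)).heard r)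
      (hf : ¬ (s.lbv (sq, i)).Fires t r ((s.lbv (sq, i)).collected src r sq i ρ v)) :
      Recv t i src s (.share r sq i ρ)
        (s.setLBV sq i ((s.lbv (sq, i)).collect src r
          ((s.lbv (sq, i)).collected src r sq i ρ v))) []
  | fire (r : Round) (sq : ℕ) (ρ : Sig n V) (v : V)
      (hv : (s.lbv (sq, i)).proposal = some v) (hst : (s.lbv (sq, i)).started = true)
      (hsrc : src ∉ (s.lbv (sq, i)).heard r)
      (hf : (s.lbv (sq, i)).Fires t r ((s.lbv (sq, i)).collected src r sq i ρ v)) :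
      Recv t i src s (.share r sq i ρ)
        (s.setLBV sq i { (s.lbv (sq, i)).collect src r
          ((s.lbv (sq, i)).collected src r sq i ρ v) with waiting := r.next })
        (toAll (.cert r sq i v (.thr ⟨r, sq, i, v⟩)))
  | reply (hsrc : src ∉ s.replied) :
      Recv t i src s .keyRequest { s with replied := insert src s.replied }
        [(src, .keyReply s.KEY s.VALUE)]
  | adopt (k : Key n V) (value : V) (hk : ∀ k₀, s.KEY = some k₀ → k₀.sq < k.sq)
      (hv : s.ValidKey k value) :
      Recv t i src s (.keyReply (some k) value) { s with KEY := some k, VALUE := value } []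

/-- All later facts about deliveries follow by cases on `Recv`, so the nested conditionals of the
handlers are unfolded only here and in the few lemmas on guaranteed reactions. -/
theorem recv_of_receive {t : ℕ} {i src : Fin n} {s s' : LState n V} {m : Msg n V} {out : Out n V}
    (h : receive t i src s m = (s', out)) : Recv t i src s m s' out := by
  classical
  cases m with
  | preKeyStep sq l value key =>
    simp only [receive, onPreKeyStep] at h
    split_ifs at h with hc
    · obtain ⟨rfl, h1, h2, h3, h4⟩ := hc
      cases h
      convert Recv.signPreKey sq value key h1 h3 h4
    · cases h; exact .ignore _
  | share r sq l ρ =>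
    simp only [receive, onShare] at h
    split at h
    · rename_i v hv
      split_ifs at h with hc hρ hf
      on_goal 5 => cases h; exact .ignore _
      -- Four cases remain: the share is valid or not, and the threshold is reached or not.
      all_goals
        obtain ⟨rfl, h1, h2⟩ := hc
        cases h
      · have := Recv.fire (t := t) r sq ρ v hv h1 h2
          (by simpa [LBV.Fires, LBV.collected, hρ] using hf)
        simpa [LBV.collected, LBV.collect, hρ] using this
      · have := Recv.collect (t := t) r sq ρ v hv h1 h2
          (by simpa [LBV.Fires, LBV.collected, hρ] using hf)
        simpa [LBV.collected, LBV.collect, hρ] using this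
      · rename_i hf
        have := Recv.fire (t := t) r sq ρ v hv h1 h2
          (by simpa [LBV.Fires, LBV.collected, hρ] using hf)
        simpa [LBV.collected, LBV.collect, hρ] using this
      · rename_i hf
        have := Recv.collect (t := t) r sq ρ v hv h1 h2
          (by simpa [LBV.Fires, LBV.collected, hρ] using hf)
        simpa [LBV.collected, LBV.collect, hρ] using this
    · cases h; exact .ignore _
  | cert r sq l value ν =>
    simp only [receive, onCert] at h
    split_ifs at h with hc
    · obtain ⟨rfl, h1, h2, rfl⟩ := hc
      split at h
      · rename_i r' hr
        split_ifs at h with hs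
        · cases h
          convert Recv.signNext r r' sq value hr h1 hs
        · cases h; exact .ignore _
      · rename_i hr
        cases h
        convert Recv.store r sq value hr h1
    · cases h; exact .ignore _
  | keyRequest =>
    simp only [receive, onKeyRequest] at h
    split_ifs at h with hc
    · cases h; exact .ignore _
    · cases h; exact .reply hc
  | keyReply key value =>
    simp only [receive, onKeyReply] at h
    split at h
    · cases h; exact .ignore _
    · split_ifs at h with hc
      · cases h; exact .adopt _ _ hc.1 hc.2
      · cases h; exact .ignore _

theorem setLBV_lbv (s : LState n V) (sq : ℕ) (l : Fin n) (L : LBV n V) (x : ℕ × Fin n) :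
    (s.setLBV sq l L).lbv x = if x = (sq, l) then L else s.lbv x := by
  simp [LState.setLBV, Function.update_apply]

/-! ### Effects of one handled message -/

section Recv

variable {t : ℕ} {i src : Fin n} {s s' : LState n V} {m : Msg n V} {out : Out n V}

/-- What the message handler leaves unchanged. -/
theorem Recv.frame (h : Recv t i src s m s' out) :
    s'.LOCK = s.LOCK ∧ s'.COMMIT = s.COMMIT ∧ s'.LEADER = s.LEADER ∧ s'.pc = s.pc ∧
      s'.wake = s.wake ∧ ∀ x, (s'.lbv x).started = (s.lbv x).started ∧
        (s'.lbv x).active = (s.lbv x).active ∧ (s'.lbv x).proposal = (s.lbv x).proposal := by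
  cases h <;> refine ⟨rfl, rfl, rfl, rfl, rfl, fun x => ?_⟩ <;>
    first
    | exact ⟨rfl, rfl, rfl⟩
    | (rw [setLBV_lbv]; split_ifs with hx <;> simp [hx, LBV.collect])

theorem Recv.fresh (h : Recv t i src s m s' out) (x : ℕ × Fin n)
    (hx : (s.lbv x).started = false) : s'.lbv x = s.lbv x := by
  cases h <;> first
    | rfl
    | (rw [setLBV_lbv]; split_ifs with hx' <;> simp_all)

/-- A share flag is raised only by a request of the leader over its authenticated link. The value
and the unique outgoing message are recorded because an honest leader's state determines that value.
-/
theorem Recv.signed (h : Recv t i src s m s' out) {x : ℕ × Fin n} {r : Round}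
    (hx : (s'.lbv x).signed r = true) :
    (s.lbv x).signed r = true ∨ (src = x.2 ∧ (s.lbv x).started = true ∧ ∃ v,
      out = [(x.2, .share r x.1 x.2 (.share i ⟨r, x.1, x.2, v⟩))] ∧
      ((r = .preKey ∧ ∃ key, m = .preKeyStep x.1 x.2 v key) ∨
        ∃ r₀, r₀.next = some r ∧ m = .cert r₀ x.1 x.2 v (.thr ⟨r₀, x.1, x.2, v⟩) ∧
          (s'.lbv x).proof r₀ ≠ none)) := by
  classical
  cases h with
  | ignore | reply | adopt => exact .inl hx
  | collect | fire | store =>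
    rw [setLBV_lbv] at hx
    split_ifs at hx with h1
    · subst h1; exact .inl hx
    · exact .inl hx
  | signPreKey sq value key hst hsg hacc =>
    rw [setLBV_lbv] at hx
    split_ifs at hx with h1
    · subst h1
      by_cases hr : r = .preKey
      · subst hr
        exact .inr ⟨rfl, hst, value, rfl, .inl ⟨rfl, key, rfl⟩⟩
      · simp only [Function.update_of_ne hr] at hx
        exact .inl hx
    · exact .inl hx
  | signNext r₀ r' sq value hr₀ hst hsg =>
    rw [setLBV_lbv] at hx
    split_ifs at hx with h1
    · subst h1
      by_cases hr : r = r'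
      · subst hr
        exact .inr ⟨rfl, hst, value, rfl, .inr ⟨r₀, hr₀, rfl, by simp [setLBV_lbv]⟩⟩
      · simp only [Function.update_of_ne hr] at hx
        exact .inl hx
    · exact .inl hx

theorem Recv.proof (h : Recv t i src s m s' out) {x : ℕ × Fin n} {r : Round} {c : Cert n V}
    (hx : (s'.lbv x).proof r = some c) :
    (s.lbv x).proof r = some c ∨
      (c.proof = .thr ⟨r, x.1, x.2, c.val⟩ ∧ m = .cert r x.1 x.2 c.val c.proof) := by
  classical
  cases h with
  | ignore | reply | adopt => exact .inl hx
  | collect | fire | signPreKey =>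
    rw [setLBV_lbv] at hx
    split_ifs at hx with h1
    · subst h1; exact .inl hx
    · exact .inl hx
  | signNext r₀ _ sq value | store r₀ sq value =>
    rw [setLBV_lbv] at hx
    split_ifs at hx with h1
    · subst h1
      by_cases hr : r = r₀
      · subst hr
        simp only [Function.update_self, Option.some.injEq] at hx
        subst hx
        exact .inr ⟨rfl, rfl⟩
      · simp only [Function.update_of_ne hr] at hx
        exact .inl hx
    · exact .inl hx

theorem mem_collected {L : LBV n V} {q src l : Fin n} {r : Round} {sq : ℕ} {ρ : Sig n V} {v : V} :
    q ∈ L.collected src r sq l ρ v ↔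
      q ∈ L.shares r ∨ (q = src ∧ ρ = .share src ⟨r, sq, l, v⟩) := by
  unfold LBV.collected
  split_ifs with h
  · simp [h, or_comm]
  · simp [h]

/-- Only the first share message of a party counts. The final implication says that this first
message, when valid, is not lost: hearing and collecting coincide for it. -/
theorem Recv.heard (h : Recv t i src s m s' out) {x : ℕ × Fin n} {r : Round} {q : Fin n}
    (hx : q ∈ (s'.lbv x).heard r) :
    q ∈ (s.lbv x).heard r ∨ (q = src ∧ i = x.2 ∧ ∃ ρ v, m = .share r x.1 x.2 ρ ∧
      (s.lbv x).proposal = some v ∧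
      (ρ = .share src ⟨r, x.1, x.2, v⟩ → q ∈ (s'.lbv x).shares r)) := by
  classical
  cases h with
  | ignore | reply | adopt => exact .inl hx
  | store | signNext | signPreKey =>
    rw [setLBV_lbv] at hx
    split_ifs at hx with h1
    · subst h1; exact .inl hx
    · exact .inl hx
  | collect r₀ sq ρ v hv | fire r₀ sq ρ v hv =>
    rw [setLBV_lbv] at hx
    split_ifs at hx with h1
    · subst h1
      by_cases hr : r = r₀
      · subst hr
        simp only [LBV.collect, Function.update_self, Finset.mem_insert] at hx
        rcases hx with rfl | hx
        · exact .inr ⟨rfl, rfl, ρ, v, rfl, hv, fun hρ => by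
            simp [setLBV_lbv, LBV.collect, mem_collected, hρ]⟩
        · exact .inl hx
      · simp only [LBV.collect, Function.update_of_ne hr] at hx
        exact .inl hx
    · exact .inl hx

theorem Recv.shares (h : Recv t i src s m s' out) {x : ℕ × Fin n} {r : Round} {q : Fin n}
    (hx : q ∈ (s'.lbv x).shares r) :
    q ∈ (s.lbv x).shares r ∨ (q = src ∧ ∃ v, (s.lbv x).proposal = some v ∧
      m = .share r x.1 x.2 (.share src ⟨r, x.1, x.2, v⟩)) := by
  classical
  cases h with
  | ignore | reply | adopt => exact .inl hx
  | store | signNext | signPreKey =>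
    rw [setLBV_lbv] at hx
    split_ifs at hx with h1
    · subst h1; exact .inl hx
    · exact .inl hx
  | collect r₀ sq ρ v hv | fire r₀ sq ρ v hv =>
    rw [setLBV_lbv] at hx
    split_ifs at hx with h1
    · subst h1
      by_cases hr : r = r₀
      · subst hr
        simp only [LBV.collect, Function.update_self, mem_collected] at hx
        rcases hx with hx | ⟨rfl, rfl⟩
        · exact .inl hx
        · exact .inr ⟨rfl, v, hv, rfl⟩
      · simp only [LBV.collect, Function.update_of_ne hr] at hx
        exact .inl hx
    · exact .inl hx

/-- Either the leader keeps waiting, with too few shares if this was so before, or it sends a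
threshold signature. -/
theorem Recv.waiting (h : Recv t i src s m s' out) (x : ℕ × Fin n) :
    ((s'.lbv x).waiting = (s.lbv x).waiting ∧
      ∀ r, (s.lbv x).waiting = some r → ((s.lbv x).shares r).card < n - t →
        ((s'.lbv x).shares r).card < n - t) ∨
    (i = x.2 ∧ ∃ r v, (s.lbv x).proposal = some v ∧ (s.lbv x).started = true ∧
      (s.lbv x).waiting = some r ∧ (s'.lbv x).waiting = r.next ∧
      out = toAll (.cert r x.1 x.2 v (.thr ⟨r, x.1, x.2, v⟩)) ∧
      n - t ≤ ((s'.lbv x).shares r).card ∧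
      ∀ r', r' ≠ r → (s'.lbv x).shares r' = (s.lbv x).shares r') := by
  classical
  cases h with
  | ignore | reply | adopt => exact .inl ⟨rfl, fun _ _ h => h⟩
  | store | signNext | signPreKey =>
    rw [setLBV_lbv]
    split_ifs with h1
    · subst h1; exact .inl ⟨rfl, fun _ _ h => h⟩
    · exact .inl ⟨rfl, fun _ _ h => h⟩
  | collect r₀ sq ρ v hv hst hsrc hf =>
    rw [setLBV_lbv]
    split_ifs with h1
    · subst h1
      refine .inl ⟨rfl, fun r hr hc => ?_⟩
      by_cases h : r = r₀
      · subst h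
        simp only [LBV.Fires, hr, true_and, not_le] at hf
        simpa [LBV.collect] using hf
      · simpa [LBV.collect, Function.update_of_ne h] using hc
    · exact .inl ⟨rfl, fun _ _ h => h⟩
  | fire r₀ sq ρ v hv hst hsrc hf =>
    rw [setLBV_lbv]
    split_ifs with h1
    · subst h1
      refine .inr ⟨rfl, r₀, v, hv, hst, hf.1, rfl, rfl, by simpa [LBV.collect] using hf.2, ?_⟩
      intro r' h
      simp [LBV.collect, Function.update_of_ne h]
    · exact .inl ⟨rfl, fun _ _ h => h⟩

theorem Recv.key (h : Recv t i src s m s' out) :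
    (s'.KEY = s.KEY ∧ s'.VALUE = s.VALUE) ∨ ∃ k value, m = .keyReply (some k) value ∧
      s'.KEY = some k ∧ s'.VALUE = value ∧ s.ValidKey k value ∧
      ∀ k₀, s.KEY = some k₀ → k₀.sq < k.sq := by
  cases h with
  | adopt k value hk hv => exact .inr ⟨k, value, rfl, rfl, rfl, hv, hk⟩
  | _ => exact .inl ⟨rfl, rfl⟩

theorem Recv.replied (h : Recv t i src s m s' out) :
    s'.replied = s.replied ∨ (m = .keyRequest ∧ s'.replied = insert src s.replied ∧
      out = [(src, .keyReply s.KEY s.VALUE)]) := by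
  cases h with
  | reply hk => exact .inr ⟨rfl, rfl, rfl⟩
  | _ => exact .inl rfl

/-- The messages that the handler sends. -/
theorem Recv.mem_out (h : Recv t i src s m s' out) {d : Fin n} {m' : Msg n V} (hm : (d, m') ∈ out) :
    (∃ r sq v, d = src ∧ m' = .share r sq src (.share i ⟨r, sq, src, v⟩) ∧
      (s.lbv (sq, src)).started = true ∧ (s'.lbv (sq, src)).signed r = true ∧
      ((r = .preKey ∧ ∃ key, m = .preKeyStep sq src v key) ∨
        ∃ r₀, r₀.next = some r ∧ m = .cert r₀ sq src v (.thr ⟨r₀, sq, src, v⟩) ∧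
          (s'.lbv (sq, src)).proof r₀ ≠ none)) ∨
    (∃ r sq v, m' = .cert r sq i v (.thr ⟨r, sq, i, v⟩) ∧ (s.lbv (sq, i)).proposal = some v ∧
      (s'.lbv (sq, i)).waiting = r.next ∧ n - t ≤ ((s'.lbv (sq, i)).shares r).card) ∨
    (d = src ∧ m' = .keyReply s.KEY s.VALUE) := by
  classical
  cases h with
  | ignore | store | collect | adopt => simp at hm
  | signPreKey sq value key hst hsg hacc =>
    simp only [List.mem_singleton, Prod.mk.injEq] at hm
    exact .inl ⟨.preKey, sq, value, hm.1, hm.2, hst, by simp [setLBV_lbv], .inl ⟨rfl, key, rfl⟩⟩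
  | signNext r r' sq value hr hst hsg =>
    simp only [List.mem_singleton, Prod.mk.injEq] at hm
    exact .inl ⟨r', sq, value, hm.1, hm.2, hst, by simp [setLBV_lbv],
      .inr ⟨r, hr, rfl, by simp [setLBV_lbv]⟩⟩
  | fire r sq ρ v hv hst hsrc hf =>
    simp only [toAll, List.mem_map, Prod.mk.injEq] at hm
    obtain ⟨q, -, -, rfl⟩ := hm
    exact .inr (.inl ⟨r, sq, v, rfl, hv, by simp [setLBV_lbv],
      by simpa [setLBV_lbv, LBV.collect] using hf.2⟩)
  | reply hk =>
    simp only [List.mem_singleton, Prod.mk.injEq] at hm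
    exact .inr (.inr hm)

/-- A key is replaced only by one of larger sequence number, and the leader's round only moves
forward. The other components are unchanged or grow. -/
theorem Recv.le (h : Recv t i src s m s' out) : s.Le i s' := by
  classical
  refine ⟨fun x hx => by rw [(h.frame.2.2.2.2.2 x).1]; exact hx, fun x r hx => ?_,
    fun x r hx => ?_, fun x r => ?_, fun x v hx => ?_, fun x hx => ?_, fun hx => ?_, fun hx => ?_⟩
  · cases h with
    | ignore | reply | adopt => exact hx
    | _ =>
      rw [setLBV_lbv]
      split_ifs with h1
      · subst h1
        first
        | exact hx
        | simp only [Function.update_apply]; split_ifs <;> simp [hx]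
      · exact hx
  · cases h with
    | ignore | reply | adopt => exact hx
    | _ =>
      rw [setLBV_lbv]
      split_ifs with h1
      · subst h1
        first
        | exact hx
        | simp only [Function.update_apply]; split_ifs <;> simp [hx]
      · exact hx
  · cases h with
    | ignore | reply | adopt => exact subset_rfl
    | signPreKey | signNext | store =>
      rw [setLBV_lbv]
      split_ifs with h1
      · subst h1; exact subset_rfl
      · exact subset_rfl
    | collect r₀ | fire r₀ =>
      rw [setLBV_lbv]
      split_ifs with h1
      · subst h1
        by_cases hr : r = r₀
        · subst hr
          intro q hq
          simp [LBV.collect, mem_collected, hq]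
        · simp [LBV.collect, Function.update_of_ne hr]
      · exact subset_rfl
  · refine ⟨by rw [(h.frame.2.2.2.2.2 x).2.2]; exact hx, ?_⟩
    rcases h.waiting x with ⟨h1, -⟩ | ⟨-, r, v, -, -, h1, h2, -⟩
    · rw [h1]
    · rw [h1, h2, waitRank_next]; exact Nat.le_succ _
  · obtain ⟨k, hk, hkx⟩ := hx
    rcases h.key with ⟨h1, -⟩ | ⟨k', v, -, h1, -, -, h2⟩
    · exact ⟨k, by rw [h1, hk], hkx⟩
    · exact ⟨k', h1, hkx.trans (h2 k hk).le⟩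
  · unfold LState.Decided; rw [h.frame.2.1]; exact hx
  · unfold LState.Active; rw [h.frame.2.2.2.1, (h.frame.2.2.2.2.2 _).1]; exact hx

end Recv

/-- A preKeyStep message that is due to be answered leaves the party with a share produced. -/
theorem signed_of_receive_preKeyStep {t : ℕ} {i src : Fin n} {s s' : LState n V} {sq : ℕ} {v : V}
    {key : Option (Key n V)} {out : Out n V}
    (h : receive t i src s (.preKeyStep sq src v key) = (s', out))
    (hst : (s.lbv (sq, src)).started = true) (hact : (s.lbv (sq, src)).active = true)
    (hacc : s.Accepts v key) : (s'.lbv (sq, src)).signed .preKey = true := by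
  by_cases hs : (s.lbv (sq, src)).signed .preKey = true
  · exact (recv_of_receive h).le.signed _ _ hs
  · rw [Bool.not_eq_true] at hs
    simp only [receive, onPreKeyStep] at h
    rw [if_pos ⟨rfl, hst, hact, hs, hacc⟩] at h
    cases h
    simp [setLBV_lbv]

/-- Either the share was produced earlier and the flag persists, or the once-per-round guard is open
and the handler signs now. -/
theorem signed_of_receive_cert {t : ℕ} {i src : Fin n} {s s' : LState n V} {sq : ℕ} {v : V}
    {r r' : Round} {out : Out n V} (hr : r.next = some r')
    (h : receive t i src s (.cert r sq src v (.thr ⟨r, sq, src, v⟩)) = (s', out))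
    (hst : (s.lbv (sq, src)).started = true) (hact : (s.lbv (sq, src)).active = true) :
    (s'.lbv (sq, src)).signed r' = true := by
  by_cases hs : (s.lbv (sq, src)).signed r' = true
  · exact (recv_of_receive h).le.signed _ _ hs
  · rw [Bool.not_eq_true] at hs
    simp only [receive, onCert] at h
    rw [if_pos ⟨trivial, hst, hact, trivial⟩] at h
    simp only [hr, hs, if_true] at h
    cases h
    simp [setLBV_lbv]

theorem proof_of_receive_cert {t : ℕ} {i src : Fin n} {s s' : LState n V} {sq : ℕ} {v : V}
    {out : Out n V}
    (h : receive t i src s (.cert .lock sq src v (.thr ⟨.lock, sq, src, v⟩)) = (s', out))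
    (hst : (s.lbv (sq, src)).started = true) (hact : (s.lbv (sq, src)).active = true) :
    (s'.lbv (sq, src)).proof .lock ≠ none := by
  simp only [receive, onCert] at h
  rw [if_pos ⟨trivial, hst, hact, trivial⟩] at h
  simp only [Round.next] at h
  cases h
  simp [setLBV_lbv]

theorem heard_of_receive_share {t : ℕ} {i src : Fin n} {s s' : LState n V} {sq : ℕ} {v : V}
    {r : Round} {ρ : Sig n V} {out : Out n V}
    (h : receive t i src s (.share r sq i ρ) = (s', out))
    (hst : (s.lbv (sq, i)).started = true) (hv : (s.lbv (sq, i)).proposal = some v)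
    (hs : src ∉ (s.lbv (sq, i)).heard r) : src ∈ (s'.lbv (sq, i)).heard r := by
  classical
  simp only [receive, onShare, hv] at h
  rw [if_pos ⟨trivial, hst, hs⟩] at h
  split_ifs at h <;> cases h <;> simp [setLBV_lbv]

/-- A valid key is refused only in favour of an own key that is at least as recent. -/
theorem keyGe_of_receive_keyReply {t : ℕ} {i src : Fin n} {s s' : LState n V} {v : V}
    {k : Key n V} {out : Out n V} (h : receive t i src s (.keyReply (some k) v) = (s', out))
    (hv : s.ValidKey k v) : s'.KeyGe k.sq := by
  simp only [receive, onKeyReply] at h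
  split_ifs at h with hc
  · cases h; exact ⟨k, rfl, le_rfl⟩
  · cases h
    simp only [hv, and_true, not_forall, not_lt] at hc
    obtain ⟨k₀, h₀, hle⟩ := hc
    exact ⟨k₀, h₀, hle⟩

/-! ### The schedule of an honest party -/

/-- The time at which the slot of the leader with index `j` ends. -/
def slotEnd (Δ : ℝ) (j : ℕ) : ℝ := 9 * Δ * j + 7 * Δ

/-- The control point of party `i` and the end of its current wait in phase `p`: phase `0` precedes
the first view, phase `j + 1` is the slot of the leader with index `j`, and phase `n + 1` follows
the last view. -/
inductive Position (Δ : ℝ) (i : Fin n) (s : LState n V) : ℕ → Prop where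
  | start (hpc : s.pc = .start) (hw : s.wake = some 0) : Position Δ i s 0
  | view (l : Fin n) (hpc : s.pc = .view l) (hw : s.wake = some (slotEnd Δ l))
      (hst : (s.lbv (l.val + 1, l)).started = true) : Position Δ i s (l.val + 1)
  | query (h0 : 0 < i.val) (hpc : s.pc = .query i) (hw : s.wake = some (leaderStart Δ i))
      (hst : (s.lbv (i.val + 1, i)).started = false) : Position Δ i s (i.val + 1)
  | skip (h0 : 0 < i.val) (hpc : s.pc = .skip i) (hw : s.wake = some (slotEnd Δ i))
      (hc : s.Decided) (hst : (s.lbv (i.val + 1, i)).started = false) : Position Δ i s (i.val + 1)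
  | finished (hpc : s.pc = .finished) (hw : s.wake = none) : Position Δ i s (n + 1)

/-- Party `i` has started views of leaders with index less than `a` only, and has wedged exactly the
views of leaders with index less than `b`, except perhaps its own. -/
structure Core (i : Fin n) (a b : ℕ) (s : LState n V) : Prop where
  started : ∀ sq l, (s.lbv (sq, l)).started = true → sq = l.val + 1 ∧ l.val < a
  fresh : ∀ x, (s.lbv x).started = false → s.lbv x = LBV.fresh n V
  active : ∀ sq l, (s.lbv (sq, l)).started = true → b ≤ l.val → (s.lbv (sq, l)).active = true
  leader : ∀ sq l, s.LEADER sq = some l → sq = l.val + 1 ∧ l.val < b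
  wedged : ∀ l : Fin n, l.val < b → s.LEADER (l.val + 1) = some l ∨
    (l = i ∧ (s.lbv (l.val + 1, l)).started = false)
  proposal : ∀ x v, (s.lbv x).proposal = some v → x.2 = i
  proposes : ∀ sq, (s.lbv (sq, i)).started = true → ∃ v, (s.lbv (sq, i)).proposal = some v

/-- The local invariant of party `i` in phase `p`. -/
structure Shape (Δ : ℝ) (i : Fin n) (p : ℕ) (s : LState n V) : Prop where
  core : Core i p (p - 1) s
  pos : Position Δ i s p
  part : i.val < p → s.Active i ∨ (0 < i.val ∧ s.Decided)

theorem Core.unstarted {i : Fin n} {a b : ℕ} {s : LState n V} (h : Core i a b s) {sq : ℕ}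
    {l : Fin n} (hl : a ≤ l.val) : (s.lbv (sq, l)).started = false := by
  by_contra hc
  exact absurd (h.started sq l (by simpa using hc)).2 hl.not_gt

theorem Core.started_of_proposal {i : Fin n} {a b : ℕ} {s : LState n V} (h : Core i a b s)
    {x : ℕ × Fin n} {v : V} (hx : (s.lbv x).proposal = some v) : (s.lbv x).started = true := by
  by_contra hc
  rw [h.fresh x (by simpa using hc)] at hx
  simp [LBV.fresh] at hx

theorem Shape.initial (Δ : ℝ) (i : Fin n) (v : V) : Shape Δ i 0 (LState.initial v) where
  core := by
    constructor <;> simp [LState.initial, LBV.fresh]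
  pos := .start rfl rfl
  part := by simp

/-- Delivering a message touches neither the control point and the wait nor the flags of starting
and wedging, so the schedule depends on ends of waits alone. -/
theorem Shape.recv {Δ : ℝ} {t p : ℕ} {i src : Fin n} {s s' : LState n V} {m : Msg n V}
    {out : Out n V} (hs : Shape Δ i p s) (h : Recv t i src s m s' out) : Shape Δ i p s' := by
  obtain ⟨-, hcom, hlead, hpc, hw, hl⟩ := h.frame
  have hst := fun x => (hl x).1
  have hle := h.le
  refine ⟨⟨?_, ?_, ?_, ?_, ?_, ?_, ?_⟩, ?_, ?_⟩
  · simpa only [hst] using hs.core.started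
  · intro x hx
    rw [hst] at hx
    rw [h.fresh x hx]; exact hs.core.fresh x hx
  · simpa only [hst, fun x => (hl x).2.1] using hs.core.active
  · simpa only [hlead] using hs.core.leader
  · simpa only [hst, hlead] using hs.core.wedged
  · simpa only [fun x => (hl x).2.2] using hs.core.proposal
  · simpa only [hst, fun x => (hl x).2.2] using hs.core.proposes
  · cases hs.pos with
    | start h1 h2 => exact .start (hpc ▸ h1) (hw ▸ h2)
    | view l h1 h2 h3 => exact .view l (hpc ▸ h1) (hw ▸ h2) (by rw [hst]; exact h3)
    | query h0 h1 h2 h3 => exact .query h0 (hpc ▸ h1) (hw ▸ h2) (by rw [hst]; exact h3)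
    | skip h0 h1 h2 h3 h4 =>
      exact .skip h0 (hpc ▸ h1) (hw ▸ h2) (hle.decided h3) (by rw [hst]; exact h4)
    | finished h1 h2 => exact .finished (hpc ▸ h1) (hw ▸ h2)
  · exact fun hp => (hs.part hp).imp hle.active fun h => ⟨h.1, hle.decided h.2⟩

/-! ### Starting and wedging a view -/

theorem startView_lbv (i : Fin n) (sq : ℕ) (l : Fin n) (s : LState n V) (x : ℕ × Fin n) :
    (startView i sq l s).1.lbv x = if x = (sq, l) then
      (if l = i then { s.lbv x with
          started := true, proposal := some s.VALUE, waiting := some .preKey }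
        else { s.lbv x with started := true }) else s.lbv x := by
  unfold startView
  split_ifs with h1 h2 <;> simp_all [setLBV_lbv]

theorem startView_frame (i : Fin n) (sq : ℕ) (l : Fin n) (s : LState n V) :
    let s' := (startView i sq l s).1
    s'.LOCK = s.LOCK ∧ s'.KEY = s.KEY ∧ s'.VALUE = s.VALUE ∧ s'.COMMIT = s.COMMIT ∧
      s'.LEADER = s.LEADER ∧ s'.replied = s.replied ∧ s'.pc = s.pc := by
  unfold startView
  split_ifs <;> simp [LState.setLBV]

theorem wedgeAndUpdate_lbv (sq : ℕ) (l : Fin n) (s : LState n V) (x : ℕ × Fin n) :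
    (wedgeAndUpdate sq l s).lbv x = if x = (sq, l) then { s.lbv x with active := false }
      else s.lbv x := by
  unfold wedgeAndUpdate
  simp only [setLBV_lbv]
  split_ifs with h <;> simp [h]

theorem enterView_lbv (Δ : ℝ) (i : Fin n) (j : ℕ) (now : ℝ) (s : LState n V) (x : ℕ × Fin n) :
    (enterView Δ i j now s).1.lbv x = if x.1 = j + 1 ∧ x.2.val = j ∧ x.2 ≠ i then
      { s.lbv x with started := true } else s.lbv x := by
  unfold enterView
  obtain ⟨sq, l⟩ := x
  by_cases h : j < n
  · simp only [h, dite_true]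
    by_cases hi : i = ⟨j, h⟩
    · have : ¬ (sq = j + 1 ∧ l.val = j ∧ l ≠ i) := by
        rintro ⟨-, h1, h2⟩
        exact h2 (by rw [hi]; exact Fin.ext h1)
      rw [if_neg this, if_neg (not_not.2 hi)]
      split <;> rfl
    · rw [if_pos hi]
      simp only [startView_lbv, if_neg (Ne.symm hi)]
      by_cases hx : (sq, l) = (j + 1, ⟨j, h⟩)
      · rw [if_pos hx]
        cases hx
        simp [Ne.symm hi]
      · rw [if_neg hx, if_neg]
        rintro ⟨rfl, h1, -⟩
        exact hx (by simp [Fin.ext_iff]; exact h1)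
  · have : ¬ (sq = j + 1 ∧ l.val = j ∧ l ≠ i) := by
      rintro ⟨-, h1, -⟩; exact h (h1 ▸ l.isLt)
    simp [h, this]

theorem enterView_frame (Δ : ℝ) (i : Fin n) (j : ℕ) (now : ℝ) (s : LState n V) :
    let s' := (enterView Δ i j now s).1
    s'.LOCK = s.LOCK ∧ s'.KEY = s.KEY ∧ s'.VALUE = s.VALUE ∧ s'.COMMIT = s.COMMIT ∧
      s'.LEADER = s.LEADER ∧ s'.replied = s.replied := by
  unfold enterView
  by_cases h : j < n
  · simp only [h, dite_true]
    split_ifs with hi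
    · have := startView_frame i (j + 1) ⟨j, h⟩ s
      exact ⟨this.1, this.2.1, this.2.2.1, this.2.2.2.1, this.2.2.2.2.1, this.2.2.2.2.2.1⟩
    · cases s.COMMIT <;> simp
  · simp [h]

/-- With `slotEnd Δ j = 9Δj + 7Δ`, adding `2Δ` gives the start `9Δ(j + 1)` of the next leader, and
adding `9Δ` gives the end of the next slot. -/
theorem enterView_position {Δ : ℝ} {i : Fin n} {j : ℕ} {s : LState n V} (hj : j < n)
    (hst : ∀ l : Fin n, l.val = j + 1 → (s.lbv (j + 1 + 1, l)).started = false) :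
    Position Δ i (enterView Δ i (j + 1) (slotEnd Δ j) s).1 (j + 2) := by
  have hl := enterView_lbv Δ i (j + 1) (slotEnd Δ j) s
  rcases Nat.lt_or_ge (j + 1) n with h | h
  · by_cases hi : i = ⟨j + 1, h⟩
    · have hiv : i.val = j + 1 := by rw [hi]
      have hu : ((enterView Δ i (j + 1) (slotEnd Δ j) s).1.lbv (i.val + 1, i)).started = false := by
        rw [hl, if_neg (by simp)]
        have := hst i hiv; rwa [← hiv] at this
      rw [show j + 2 = i.val + 1 by omega]
      cases hc : s.COMMIT with
      | none =>
        refine .query (by omega) ?_ ?_ hu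
        · simp [enterView, h, hi, hc]
        · simp only [enterView, dif_pos h]
          rw [if_neg (not_not.2 hi), hc]
          simp only [slotEnd, leaderStart, hiv]; congr 1; push_cast; ring
      | some c =>
        refine .skip (by omega) ?_ ?_ ?_ hu
        · simp [enterView, h, hi, hc]
        · simp only [enterView, dif_pos h]
          rw [if_neg (not_not.2 hi), hc]
          simp only [slotEnd, hiv]; congr 1; push_cast; ring
        · unfold LState.Decided
          rw [(enterView_frame Δ i (j + 1) (slotEnd Δ j) s).2.2.2.1, hc]; simp
    · refine .view ⟨j + 1, h⟩ ?_ ?_ ?_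
      · simp [enterView, h, hi]
      · simp only [enterView, dif_pos h]
        rw [if_pos hi]
        simp only [slotEnd]; congr 1; push_cast; ring
      · rw [hl, if_pos ⟨rfl, rfl, fun h => hi h.symm⟩]
  · obtain rfl : n = j + 1 := by omega
    refine .finished ?_ ?_ <;> simp [enterView]

/-- Sending a key request, beginning to query and being the undecided leader of the slot occur
together. This is what ties the number of broadcasts to activity. -/
theorem enterView_out {Δ : ℝ} {i : Fin n} {j : ℕ} {now : ℝ} {s : LState n V} :
    ((enterView Δ i j now s).2 = [] ∧ (enterView Δ i j now s).1.pc ≠ .query i ∧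
      (s.COMMIT = none → i.val ≠ j)) ∨
    ((enterView Δ i j now s).2 = toAll .keyRequest ∧ i.val = j ∧ s.COMMIT = none ∧
      (enterView Δ i j now s).1.pc = .query i) := by
  by_cases h : j < n
  · by_cases hi : i = ⟨j, h⟩
    · have hiv : i.val = j := by rw [hi]
      cases hc : s.COMMIT with
      | none =>
        refine .inr ⟨?_, hiv, rfl, ?_⟩ <;> simp [enterView, h, hi, hc]
      | some c =>
        refine .inl ⟨?_, ?_, by simp⟩ <;> simp [enterView, h, hi, hc]
    · refine .inl ⟨?_, ?_, fun _ h' => hi (Fin.ext h')⟩ <;>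
        simp [enterView, h, hi, startView, Ne.symm hi]
  · refine .inl ⟨by simp [enterView, h], by simp [enterView, h], fun _ h' => h (h' ▸ i.isLt)⟩

/-- The effect of the end of a wait on party `i`. -/
structure Ticked (i : Fin n) (s s' : LState n V) (out : Out n V) : Prop where
  le : s.Le i s'
  votes : ∀ x, (s'.lbv x).signed = (s.lbv x).signed ∧ (s'.lbv x).heard = (s.lbv x).heard ∧
    (s'.lbv x).shares = (s.lbv x).shares ∧ (s'.lbv x).proof = (s.lbv x).proof
  replied : s'.replied = s.replied
  leader : ∀ sq l, s.LEADER sq = some l → s'.LEADER sq = some l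
  key : (s'.KEY = s.KEY ∧ s'.VALUE = s.VALUE) ∨ ∃ sq l c, (s.lbv (sq, l)).proof .preKey = some c ∧
    s'.KEY = some ⟨sq, c.proof⟩ ∧ s'.VALUE = c.val ∧ s'.LEADER sq = some l
  proposal : ∀ x v, (s'.lbv x).proposal = some v →
    ((s.lbv x).proposal = some v ∧ (s'.lbv x).waiting = (s.lbv x).waiting) ∨
    (s.lbv x = LBV.fresh n V ∧ (s'.lbv x).waiting = some .preKey)
  out : ∀ d m, (d, m) ∈ out →
    (∃ sq v, m = .preKeyStep sq i v s'.KEY ∧ (s'.lbv (sq, i)).proposal = some v) ∨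
    (m = .keyRequest ∧ s'.Active i)

theorem Ticked.refl (i : Fin n) (s : LState n V) : Ticked i s s [] where
  le := .refl i s
  votes _ := ⟨rfl, rfl, rfl, rfl⟩
  replied := rfl
  leader _ _ := id
  key := .inl ⟨rfl, rfl⟩
  proposal _ _ h := .inl ⟨h, rfl⟩
  out := by simp

section startView

variable {i : Fin n} {s : LState n V} {sq : ℕ} {l : Fin n} {pc : PC n} {w : Option ℝ}

/-- The hypothesis `hpc` keeps `Active` monotone: a querying party loses that control point, but its
own instance gets started in exchange. -/
theorem ticked_startView (hf : s.lbv (sq, l) = LBV.fresh n V)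
    (hpc : s.pc = .query i → (sq, l) = (i.val + 1, i)) :
    Ticked i s { (startView i sq l s).1 with pc := pc, wake := w } (startView i sq l s).2 := by
  have hl := startView_lbv i sq l s
  obtain ⟨h1, h2, h3, h4, h5, h6, h7⟩ := startView_frame i sq l s
  have hv : ∀ x, ((startView i sq l s).1.lbv x).signed = (s.lbv x).signed ∧
      ((startView i sq l s).1.lbv x).heard = (s.lbv x).heard ∧
      ((startView i sq l s).1.lbv x).shares = (s.lbv x).shares ∧
      ((startView i sq l s).1.lbv x).proof = (s.lbv x).proof := by
    intro x; rw [hl]; split_ifs <;> exact ⟨rfl, rfl, rfl, rfl⟩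
  have hst : ∀ x, (s.lbv x).started = true → ((startView i sq l s).1.lbv x).started = true := by
    intro x hx; rw [hl]; split_ifs <;> simp [hx]
  refine ⟨⟨hst, ?_, ?_, ?_, ?_, ?_, ?_, ?_⟩, hv, h6, ?_, .inl ⟨h2, h3⟩, ?_, ?_⟩
  · intro x r; simp [hv x]
  · intro x r; simp [hv x]
  · intro x r; simp [hv x]
  · intro x v hx
    simp only [hl]
    split_ifs with h
    · subst h; simp [hf, LBV.fresh] at hx
    · subst h; simp [hf, LBV.fresh] at hx
    · exact ⟨hx, le_rfl⟩
  · intro x; simp [LState.KeyGe, h2]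
  · simp [LState.Decided, h4]
  · rintro (h | h)
    · right
      simp only [← hpc h, hl, if_true]; split_ifs <;> rfl
    · exact .inr (hst _ h)
  · intro sq' l' h; simpa [h5] using h
  · intro x v hx
    simp only [hl] at hx ⊢
    split_ifs at hx ⊢ with h h'
    · subst h; exact .inr ⟨hf, rfl⟩
    · exact .inl ⟨hx, rfl⟩
    · exact .inl ⟨hx, rfl⟩
  · intro d m hm
    by_cases h : l = i
    · subst h
      simp only [startView, if_true, toAll, List.mem_map, Prod.mk.injEq] at hm
      obtain ⟨q, -, -, rfl⟩ := hm
      exact .inl ⟨sq, s.VALUE, by simp [h2], by simp [hl]⟩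
    · simp [startView, h] at hm

theorem core_startView {a a' b : ℕ} (hc : Core i a b s) (ha : a ≤ a') (hla : l.val < a')
    (hbl : b ≤ l.val) (hf : (s.lbv (l.val + 1, l)).started = false) :
    Core i a' b { (startView i (l.val + 1) l s).1 with pc := pc, wake := w } := by
  have hl := startView_lbv i (l.val + 1) l s
  have h5 := (startView_frame i (l.val + 1) l s).2.2.2.2.1
  have hfr := hc.fresh _ hf
  refine ⟨?_, ?_, ?_, ?_, ?_, ?_, ?_⟩
  · intro sq l' h
    simp only [hl] at h
    split_ifs at h with h1
    · cases h1; exact ⟨rfl, hla⟩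
    · cases h1; exact ⟨rfl, hla⟩
    · exact ⟨(hc.started _ _ h).1, (hc.started _ _ h).2.trans_le ha⟩
  · intro x h
    simp only [hl] at h ⊢
    split_ifs at h ⊢ with h1
    exact hc.fresh _ h
  · intro sq l' h hb
    simp only [hl] at h ⊢
    split_ifs at h ⊢ with h1
    · rw [h1, hfr]; rfl
    · rw [h1, hfr]; rfl
    · exact hc.active _ _ h hb
  · simpa only [h5] using hc.leader
  · intro l' h'
    have hne : (l'.val + 1, l') ≠ (l.val + 1, l) := by
      intro h; have := congrArg Prod.fst h; dsimp only at this; omega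
    simp only [hl, if_neg hne, h5]
    exact hc.wedged l' h'
  · intro x v h
    simp only [hl] at h
    split_ifs at h with h1 h2
    · subst h1; exact h2
    · exact hc.proposal _ _ h
    · exact hc.proposal _ _ h
  · intro sq h
    simp only [hl] at h ⊢
    split_ifs at h ⊢ with h1 h2
    · exact ⟨_, rfl⟩
    · cases h1; exact absurd rfl h2
    · exact hc.proposes sq h

end startView

section wedge

variable {i : Fin n} {s : LState n V} {l : Fin n}

theorem core_wedgeAndUpdate (hc : Core i (l.val + 1) l.val s)
    (hst : (s.lbv (l.val + 1, l)).started = true) :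
    Core i (l.val + 1) (l.val + 1) (wedgeAndUpdate (l.val + 1) l s) := by
  have hl := wedgeAndUpdate_lbv (l.val + 1) l s
  have hs : ∀ x, ((wedgeAndUpdate (l.val + 1) l s).lbv x).started = (s.lbv x).started ∧
      ((wedgeAndUpdate (l.val + 1) l s).lbv x).proposal = (s.lbv x).proposal := by
    intro x; rw [hl]; split_ifs <;> exact ⟨rfl, rfl⟩
  have hL : (wedgeAndUpdate (l.val + 1) l s).LEADER =
      Function.update s.LEADER (l.val + 1) (some l) := rfl
  refine ⟨?_, ?_, ?_, ?_, ?_, ?_, ?_⟩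
  · simpa only [hs] using hc.started
  · intro x h
    rw [(hs x).1] at h
    rw [hl, if_neg, hc.fresh x h]
    rintro rfl; simp [hst] at h
  · intro sq l' h hb
    rw [(hs _).1] at h
    have := (hc.started _ _ h).2
    omega
  · intro sq l' h
    rw [hL, Function.update_apply] at h
    split_ifs at h with h1
    · cases h; exact ⟨h1, by omega⟩
    · exact ⟨(hc.leader _ _ h).1, by have := (hc.leader _ _ h).2; omega⟩
  · intro l' h
    rw [hL, Function.update_apply, (hs _).1]
    by_cases h1 : l' = l
    · subst h1; simp
    · have : l'.val ≠ l.val := fun h => h1 (Fin.ext h)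
      rw [if_neg (by omega)]
      exact hc.wedged l' (by omega)
  · simpa only [hs] using hc.proposal
  · simpa only [hs] using hc.proposes

end wedge

/-- The state at the end of a slot after the update with the proofs of the wedged view. -/
def LState.closeSlot (l : Fin n) (s : LState n V) : LState n V :=
  match s.pc with
  | .view _ => wedgeAndUpdate (l.val + 1) l s
  | _ => s

/-! ### The local effect of the end of a slot -/

section slotEnd

variable {Δ : ℝ} {i : Fin n} {s : LState n V} {l : Fin n}

theorem core_closeSlot (hs : Shape Δ i (l.val + 1) s) (hq : s.pc ≠ .query i) :
    Core i (l.val + 1) (l.val + 1) (s.closeSlot l) := by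
  generalize hp : l.val + 1 = p at hs
  have hc := hs.core
  cases hs.pos with
  | start => omega
  | finished => have := l.isLt; omega
  | view l' hpc hw hst =>
    obtain rfl : l = l' := Fin.ext (by omega)
    simp only [LState.closeSlot, hpc]
    exact core_wedgeAndUpdate hc hst
  | query h0 hpc => exact absurd hpc hq
  | skip h0 hpc hw hd hst =>
    obtain rfl : l = i := Fin.ext (by omega)
    simp only [LState.closeSlot, hpc]
    -- Nothing is wedged in a skipped slot. The second bound still rises by one, because the party's
    -- own unstarted view is the exception allowed in `wedged`.
    refine { hc with active := ?_, leader := ?_, wedged := ?_ }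
    · intro sq l' h hb
      have := (hc.started _ _ h).2
      omega
    · intro sq l' h
      exact ⟨(hc.leader _ _ h).1, by have := (hc.leader _ _ h).2; omega⟩
    · intro l' h
      rcases Nat.lt_succ_iff_lt_or_eq.1 h with h | h
      · exact hc.wedged l' h
      · obtain rfl : l' = l := Fin.ext h
        exact .inr ⟨rfl, hst⟩

theorem closeSlot_lbv (x : ℕ × Fin n) : ∃ b, (s.closeSlot l).lbv x =
    { s.lbv x with active := b } := by
  unfold LState.closeSlot
  split
  · rw [wedgeAndUpdate_lbv]
    split_ifs
    · exact ⟨_, rfl⟩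
    · exact ⟨(s.lbv x).active, rfl⟩
  · exact ⟨(s.lbv x).active, rfl⟩

/-- Waiting in a view and skipping one's own view both become `closeSlot` followed by `enterView`,
so the two cases need not be separated again. -/
theorem timeout_slotEnd (hs : Shape Δ i (l.val + 1) s) (hq : s.pc ≠ .query i) (now : ℝ) :
    timeout Δ i now s = enterView Δ i (l.val + 1) now (s.closeSlot l) := by
  generalize hp : l.val + 1 = p at hs
  cases hs.pos with
  | start => omega
  | finished => have := l.isLt; omega
  | view l' hpc hw hst =>
    obtain rfl : l = l' := Fin.ext (by omega)
    simp only [timeout, LState.closeSlot, hpc]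
  | query h0 hpc => exact absurd hpc hq
  | skip h0 hpc hw hd hst =>
    obtain rfl : l = i := Fin.ext (by omega)
    simp only [timeout, LState.closeSlot, hpc]

theorem core_enterView {now : ℝ} (hc : Core i (l.val + 1) (l.val + 1) s) :
    Core i (l.val + 2) (l.val + 1) (enterView Δ i (l.val + 1) now s).1 := by
  have hl := enterView_lbv Δ i (l.val + 1) now s
  have h5 := (enterView_frame Δ i (l.val + 1) now s).2.2.2.2.1
  have hp : ∀ x, ((enterView Δ i (l.val + 1) now s).1.lbv x).proposal = (s.lbv x).proposal := by
    intro x; rw [hl]; split_ifs <;> rfl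
  refine ⟨?_, ?_, ?_, ?_, ?_, ?_, ?_⟩
  · intro sq l' h
    rw [hl] at h
    split_ifs at h with h1
    · dsimp only at h1; omega
    · exact ⟨(hc.started _ _ h).1, by have := (hc.started _ _ h).2; omega⟩
  · intro x h
    rw [hl] at h ⊢
    split_ifs at h ⊢ with h1
    exact hc.fresh _ h
  · intro sq l' h hb
    rw [hl] at h ⊢
    split_ifs at h ⊢ with h1
    · rw [hc.fresh _ (hc.unstarted hb)]; rfl
    · exact hc.active _ _ h hb
  · simpa only [h5] using hc.leader
  · intro l' h'
    rw [h5, hl, if_neg (by dsimp only; omega)]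
    exact hc.wedged l' h'
  · simpa only [hp] using hc.proposal
  · intro sq h
    rw [hp]
    rw [hl, if_neg (by simp)] at h
    exact hc.proposes sq h

theorem closeSlot_decided (h : s.Decided) : (s.closeSlot l).Decided := by
  unfold LState.closeSlot
  split
  · unfold LState.Decided wedgeAndUpdate at *
    dsimp only
    split <;> simp_all
  · exact h

theorem shape_slotEnd (hs : Shape Δ i (l.val + 1) s) (hq : s.pc ≠ .query i) :
    Shape Δ i (l.val + 2) (timeout Δ i (slotEnd Δ l) s).1 := by
  rw [timeout_slotEnd hs hq]
  have hc := core_closeSlot hs hq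
  refine ⟨core_enterView hc, enterView_position l.isLt fun l' h => hc.unstarted (by omega), ?_⟩
  intro hp
  have hcom := (enterView_frame Δ i (l.val + 1) (slotEnd Δ l) (s.closeSlot l)).2.2.2.1
  rcases Nat.lt_succ_iff_lt_or_eq.1 hp with h | h
  · refine (hs.part h).imp (fun ha => .inr ?_) fun hd => ⟨hd.1, ?_⟩
    · rcases ha with ha | ha
      · exact absurd ha hq
      · rw [enterView_lbv, if_neg (by simp)]
        obtain ⟨b, hb⟩ := closeSlot_lbv (s := s) (l := l) (i.val + 1, i)
        rw [hb]; exact ha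
    · unfold LState.Decided; rw [hcom]; exact closeSlot_decided hd.2
  -- The party leads the next slot: if it does not start to query, the reason is that it has
  -- decided.
  · rcases enterView_out (Δ := Δ) (i := i) (j := l.val + 1) (now := slotEnd Δ l)
      (s := s.closeSlot l) with ⟨-, -, h1⟩ | ⟨-, -, -, h1⟩
    · right
      refine ⟨by omega, ?_⟩
      unfold LState.Decided; rw [hcom]
      exact fun h2 => h1 h2 h
    · exact .inl (.inl h1)

theorem ticked_slotEnd {now : ℝ} (hs : Shape Δ i (l.val + 1) s) (hq : s.pc ≠ .query i)
    (hkey : ∀ k, s.KEY = some k → s.ValidKey k s.VALUE) :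
    Ticked i s (timeout Δ i now s).1 (timeout Δ i now s).2 := by
  have hto := timeout_slotEnd hs hq now
  rw [hto]
  set s₁ := s.closeSlot l with hs₁
  have hfr : ∀ x, (enterView Δ i (l.val + 1) now s₁).1.lbv x =
      { s.lbv x with
        started := ((enterView Δ i (l.val + 1) now s₁).1.lbv x).started
        active := ((enterView Δ i (l.val + 1) now s₁).1.lbv x).active } := by
    intro x
    obtain ⟨b, hb⟩ := closeSlot_lbv (s := s) (l := l) x
    rw [enterView_lbv]
    split_ifs <;> rw [hs₁, hb]
  have hst : ∀ x, (s.lbv x).started = true →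
      ((enterView Δ i (l.val + 1) now s₁).1.lbv x).started = true := by
    intro x hx
    obtain ⟨b, hb⟩ := closeSlot_lbv (s := s) (l := l) x
    rw [enterView_lbv]
    split_ifs
    · rfl
    · rw [hs₁, hb]; exact hx
  have hsg : ∀ x, ((enterView Δ i (l.val + 1) now s₁).1.lbv x).signed = (s.lbv x).signed :=
    fun x => by rw [hfr]
  have hhd : ∀ x, ((enterView Δ i (l.val + 1) now s₁).1.lbv x).heard = (s.lbv x).heard :=
    fun x => by rw [hfr]
  have hsh : ∀ x, ((enterView Δ i (l.val + 1) now s₁).1.lbv x).shares = (s.lbv x).shares :=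
    fun x => by rw [hfr]
  have hpf : ∀ x, ((enterView Δ i (l.val + 1) now s₁).1.lbv x).proof = (s.lbv x).proof :=
    fun x => by rw [hfr]
  have hpr : ∀ x, ((enterView Δ i (l.val + 1) now s₁).1.lbv x).proposal = (s.lbv x).proposal :=
    fun x => by rw [hfr]
  have hwt : ∀ x, ((enterView Δ i (l.val + 1) now s₁).1.lbv x).waiting = (s.lbv x).waiting :=
    fun x => by rw [hfr]
  obtain ⟨-, e2, e3, e4, e5, e6⟩ := enterView_frame Δ i (l.val + 1) now s₁
  have hk₁ : (s₁.KEY = s.KEY ∧ s₁.VALUE = s.VALUE) ∨ ∃ c,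
      (s.lbv (l.val + 1, l)).proof .preKey = some c ∧ s₁.KEY = some ⟨l.val + 1, c.proof⟩ ∧
      s₁.VALUE = c.val ∧ s₁.LEADER (l.val + 1) = some l := by
    rw [hs₁]
    unfold LState.closeSlot
    split
    · cases hp : (s.lbv (l.val + 1, l)).proof .preKey with
      | none => left; simp [wedgeAndUpdate, hp]
      | some c => right; exact ⟨c, rfl, by simp [wedgeAndUpdate, hp]⟩
    · exact .inl ⟨rfl, rfl⟩
  refine ⟨⟨hst, by simp [hsg], by simp [hpf], by simp [hsh], ?_, ?_, ?_, ?_⟩,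
    fun x => ⟨hsg x, hhd x, hsh x, hpf x⟩, ?_, ?_, ?_, ?_, ?_⟩
  · intro x v h; rw [hpr, hwt]; exact ⟨h, le_rfl⟩
  · rintro x ⟨k, hk, hx⟩
    unfold LState.KeyGe
    rw [e2]
    rcases hk₁ with ⟨h1, -⟩ | ⟨c, -, h1, -⟩
    · exact ⟨k, by rw [h1, hk], hx⟩
    -- A valid old key belongs to a view wedged earlier, so its sequence number is less than `l.val
    -- + 1` and the new key is more recent.
    · refine ⟨_, h1, hx.trans ?_⟩
      obtain ⟨l', h1, -⟩ := hkey k hk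
      have := hs.core.leader _ _ h1
      dsimp only; omega
  · intro hd; unfold LState.Decided; rw [e4]; exact closeSlot_decided hd
  · rintro (h | h)
    · exact absurd h hq
    · exact .inr (hst _ h)
  · rw [e6, hs₁]
    unfold LState.closeSlot
    split <;> rfl
  · intro sq l' h
    rw [e5, hs₁]
    unfold LState.closeSlot
    split
    · simp only [wedgeAndUpdate, Function.update_apply]
      split_ifs with h1
      · have := (hs.core.leader _ _ h).1
        congr 1; exact Fin.ext (by omega)
      · exact h
    · exact h
  · rw [e2, e3, e5]
    exact hk₁.imp id fun ⟨c, hc⟩ => ⟨_, _, c, hc⟩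
  · intro x v h; rw [hpr] at h; exact .inl ⟨h, hwt x⟩
  · intro d m hm
    rcases enterView_out (Δ := Δ) (i := i) (j := l.val + 1) (now := now) (s := s₁) with
      ⟨h, -, -⟩ | ⟨h, -, -, h'⟩
    · simp [h] at hm
    · simp only [h, toAll, List.mem_map, Prod.mk.injEq] at hm
      obtain ⟨q, -, -, rfl⟩ := hm
      exact .inr ⟨rfl, .inl h'⟩

/-- Entering a slot starts only instances led by others; a leader starts its own instance when its
query ends (or at time `0`). -/
theorem own_lbv_slotEnd {now : ℝ} (hs : Shape Δ i (l.val + 1) s) (hq : s.pc ≠ .query i) (sq : ℕ) :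
    ∃ b, (timeout Δ i now s).1.lbv (sq, i) = { s.lbv (sq, i) with active := b } := by
  rw [timeout_slotEnd hs hq, enterView_lbv, if_neg (by simp)]
  exact closeSlot_lbv _

/-- Whoever becomes active at the end of a slot asks for keys, being the next leader, undecided. -/
theorem active_slotEnd {now : ℝ} (hs : Shape Δ i (l.val + 1) s) (hq : s.pc ≠ .query i) :
    ((timeout Δ i now s).2 = [] ∧ (timeout Δ i now s).1.pc ≠ .query i ∧
      ((timeout Δ i now s).1.Active i → s.Active i)) ∨
    ((timeout Δ i now s).2 = toAll .keyRequest ∧ i.val = l.val + 1 ∧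
      ¬ (timeout Δ i now s).1.Decided ∧ (timeout Δ i now s).1.Active i) := by
  obtain ⟨b, hb⟩ := own_lbv_slotEnd (now := now) hs hq (i.val + 1)
  have hto := timeout_slotEnd hs hq now
  have hfr := (enterView_frame Δ i (l.val + 1) now (s.closeSlot l)).2.2.2.1
  rcases enterView_out (Δ := Δ) (i := i) (j := l.val + 1) (now := now) (s := s.closeSlot l) with
    ⟨h1, h2, -⟩ | ⟨h1, h2, h3, h4⟩
  · rw [← hto] at h1 h2
    refine .inl ⟨h1, h2, ?_⟩
    rintro (h | h)
    · exact absurd h h2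
    · right; rw [hb] at h; exact h
  · rw [← hto] at h1 h4 hfr
    refine .inr ⟨h1, h2, ?_, .inl h4⟩
    unfold LState.Decided
    rw [hfr, h3]; simp

/-- The locks after the end of a slot. -/
theorem lock_slotEnd {now : ℝ} (hs : Shape Δ i (l.val + 1) s) (hq : s.pc ≠ .query i) {x : ℕ}
    (hx : (timeout Δ i now s).1.LOCK = some x) :
    s.LOCK = some x ∨ (x = l.val + 1 ∧ (s.lbv (l.val + 1, l)).proof .key ≠ none) := by
  rw [timeout_slotEnd hs hq, (enterView_frame _ _ _ _ _).1] at hx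
  unfold LState.closeSlot at hx
  split at hx
  · simp only [wedgeAndUpdate] at hx
    cases hp : (s.lbv (l.val + 1, l)).proof .key with
    | none => simp only [hp] at hx; exact .inl hx
    | some c => simp only [hp, Option.some.injEq] at hx; exact .inr ⟨hx.symm, by simp⟩
  · exact .inl hx

theorem pc_of_started (hs : Shape Δ i (l.val + 1) s)
    (hst : (s.lbv (l.val + 1, l)).started = true) : s.pc = .view l := by
  generalize hp : l.val + 1 = p at hs
  cases hs.pos with
  | start => omega
  | finished => have := l.isLt; omega
  | view l' hpc hw _ =>
    obtain rfl : l = l' := Fin.ext (by omega)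
    exact hpc
  | query h0 hpc hw h =>
    obtain rfl : l = i := Fin.ext (by omega)
    simp [hst] at h
  | skip h0 hpc hw hd h =>
    obtain rfl : l = i := Fin.ext (by omega)
    simp [hst] at h

theorem keyGe_slotEnd {now : ℝ} (hs : Shape Δ i (l.val + 1) s)
    (hst : (s.lbv (l.val + 1, l)).started = true)
    (hp : (s.lbv (l.val + 1, l)).proof .preKey ≠ none) :
    (timeout Δ i now s).1.KeyGe (l.val + 1) := by
  have hpc := pc_of_started hs hst
  rw [timeout_slotEnd hs (by simp [hpc])]
  unfold LState.KeyGe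
  rw [(enterView_frame _ _ _ _ _).2.1]
  obtain ⟨c, hc⟩ := Option.ne_none_iff_exists'.1 hp
  exact ⟨⟨l.val + 1, c.proof⟩, by simp [LState.closeSlot, hpc, wedgeAndUpdate, hc], le_rfl⟩

theorem decided_slotEnd {now : ℝ} (hs : Shape Δ i (l.val + 1) s)
    (hst : (s.lbv (l.val + 1, l)).started = true)
    (hp : (s.lbv (l.val + 1, l)).proof .lock ≠ none) :
    (timeout Δ i now s).1.Decided := by
  have hpc := pc_of_started hs hst
  rw [timeout_slotEnd hs (by simp [hpc])]
  unfold LState.Decided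
  rw [(enterView_frame _ _ _ _ _).2.2.2.1]
  obtain ⟨c, hc⟩ := Option.ne_none_iff_exists'.1 hp
  simp [LState.closeSlot, hpc, wedgeAndUpdate, hc]

end slotEnd

/-! ### Unforgeability -/

/-- Party `q` has produced its share on `m`; if the leader is honest, then it has asked for it. -/
def SignedOK (B : Finset (Fin n)) (st : Fin n → LState n V) (q : Fin n) (m : Stmt n V) : Prop :=
  ((st q).lbv (m.sq, m.leader)).started = true ∧
  ((st q).lbv (m.sq, m.leader)).signed m.round = true ∧
  (m.round = .key → ((st q).lbv (m.sq, m.leader)).proof .preKey ≠ none) ∧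
  (m.leader ∉ B → ((st m.leader).lbv (m.sq, m.leader)).proposal = some m.value ∧
    m.round.rank ≤ waitRank ((st m.leader).lbv (m.sq, m.leader)).waiting)

/-- A signature is accounted for by the honest parties that have signed. -/
def GoodSig (B : Finset (Fin n)) (st : Fin n → LState n V) : Sig n V → Prop
  | .share q m => q ∉ B → SignedOK B st q m
  | .thr m => ∃ q, q ∉ B ∧ SignedOK B st q m
  | .junk => True

/-- A message of an honest party is accounted for by the state of its sender. -/
def GoodMsg (st : Fin n → LState n V) (src : Fin n) : Msg n V → Prop
  | .preKeyStep sq l v _ => l = src ∧ ((st src).lbv (sq, src)).proposal = some v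
  | .cert r sq l v ν => l = src ∧ ((st src).lbv (sq, src)).proposal = some v ∧
      r.rank < waitRank ((st src).lbv (sq, src)).waiting ∧ ν = .thr ⟨r, sq, src, v⟩
  | .share r sq l ρ => ∃ v, ρ = .share src ⟨r, sq, l, v⟩
  | .keyRequest => (st src).Active src
  | .keyReply _ _ => True

section mono

variable {B : Finset (Fin n)} {st st' : Fin n → LState n V}

/-- Evidence for a share consists of flags that are never lowered, a stored proof, a fixed proposal
and a round that only advances, so it is never invalidated. -/
theorem SignedOK.mono (hle : ∀ i, i ∉ B → (st i).Le i (st' i)) {q : Fin n} (hq : q ∉ B)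
    {m : Stmt n V} (h : SignedOK B st q m) : SignedOK B st' q m := by
  refine ⟨(hle q hq).started _ h.1, (hle q hq).signed _ _ h.2.1,
    fun hr => (hle q hq).proof _ _ (h.2.2.1 hr), fun hl => ?_⟩
  obtain ⟨h1, h2⟩ := h.2.2.2 hl
  obtain ⟨h3, h4⟩ := (hle _ hl).proposal _ _ h1
  exact ⟨h3, h2.trans h4⟩

theorem GoodSig.mono (hle : ∀ i, i ∉ B → (st i).Le i (st' i)) {σ : Sig n V}
    (h : GoodSig B st σ) : GoodSig B st' σ := by
  cases σ with
  | share q m => exact fun hq => (h hq).mono hle hq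
  | thr m => obtain ⟨q, hq, h⟩ := h; exact ⟨q, hq, h.mono hle hq⟩
  | junk => trivial

theorem GoodMsg.mono (hle : ∀ i, i ∉ B → (st i).Le i (st' i)) {src : Fin n} (hs : src ∉ B)
    {m : Msg n V} (h : GoodMsg st src m) : GoodMsg st' src m := by
  cases m with
  | preKeyStep => exact ⟨h.1, ((hle _ hs).proposal _ _ h.2).1⟩
  | cert =>
    obtain ⟨h1, h2, h3, h4⟩ := h
    obtain ⟨h5, h6⟩ := (hle _ hs).proposal _ _ h2
    exact ⟨h1, h5, h3.trans_le h6, h4⟩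
  | share => exact h
  | keyRequest => exact (hle _ hs).active h
  | keyReply => trivial

end mono

theorem exists_honest {t : ℕ} {B : Finset (Fin n)} (hn : 3 * t < n) (hB : B.card ≤ t)
    {Q : Finset (Fin n)} (hQ : n - t ≤ Q.card) : ∃ q ∈ Q, q ∉ B := by
  by_contra! h
  have := Finset.card_le_card (show Q ⊆ B from h)
  omega

/-- Induction on the derivation. Shares of Byzantine parties need no account, and among the `n - t`
signers of a combined signature one is honest, whose share must have been seen. -/
theorem goodSig_of_derivable {t : ℕ} {B : Finset (Fin n)} (hn : 3 * t < n) (hB : B.card ≤ t)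
    {st : Fin n → LState n V} {known : Sig n V → Prop} (hk : ∀ σ, known σ → GoodSig B st σ)
    {σ : Sig n V} (h : Derivable t B known σ) : GoodSig B st σ := by
  induction h with
  | seen σ h => exact hk σ h
  | junk => trivial
  | own b m hb => exact fun h => absurd hb h
  | combine m Q hQ _ ih =>
    obtain ⟨q, hq, hqB⟩ := exists_honest hn hB hQ
    exact ⟨q, hqB, ih q hq hqB⟩

/-- What the states of the honest parties and the messages sent tell about each other. -/
structure Safe (t : ℕ) (B : Finset (Fin n)) (st : Fin n → LState n V) (sent : List (Env n V)) :
    Prop where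
  sigs : ∀ e ∈ sent, ∀ σ ∈ e.msg.sigs, GoodSig B st σ
  msgs : ∀ e ∈ sent, e.src ∉ B → GoodMsg st e.src e.msg
  proofs : ∀ i, i ∉ B → ∀ x r c, ((st i).lbv x).proof r = some c →
    c.proof = .thr ⟨r, x.1, x.2, c.val⟩ ∧ GoodSig B st c.proof
  shares : ∀ i, i ∉ B → ∀ x v r q, ((st i).lbv x).proposal = some v →
    q ∈ ((st i).lbv x).shares r → q ∉ B → SignedOK B st q ⟨r, x.1, x.2, v⟩
  heard : ∀ i, i ∉ B → ∀ x r q, q ∈ ((st i).lbv x).heard r → q ∉ B →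
    ((st q).lbv x).signed r = true
  key : ∀ i, i ∉ B → ∀ k, (st i).KEY = some k →
    (st i).ValidKey k (st i).VALUE ∧ GoodSig B st k.proof
  lock : ∀ i, i ∉ B → ∀ x, (st i).LOCK = some x → ∃ q, q ∉ B ∧ (st q).KeyGe x
  signed : ∀ i, i ∉ B → ∀ x r, ((st i).lbv x).signed r = true → x.2 ∉ B →
    ∃ v, ((st x.2).lbv x).proposal = some v ∧ r.rank ≤ waitRank ((st x.2).lbv x).waiting
  card : ∀ i, i ∉ B → ∀ x v r, ((st i).lbv x).proposal = some v →
    ((st i).lbv x).waiting = some r → (((st i).lbv x).shares r).card < n - t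
  replied : ∀ i, i ∉ B → ∀ q ∈ (st i).replied, q ∉ B → (st q).Active q

theorem Safe.initial (t : ℕ) (B : Finset (Fin n)) (input : Fin n → V) :
    Safe t B (Config.initial input).st [] := by
  constructor <;> simp [Config.initial, LState.initial, LBV.fresh]

theorem Safe.byzSend {t : ℕ} {B : Finset (Fin n)} (hn : 3 * t < n) (hB : B.card ≤ t)
    {st : Fin n → LState n V} {sent : List (Env n V)} (h : Safe t B st sent) {e : Env n V}
    (hsrc : e.src ∈ B)
    (hsigs : ∀ σ ∈ e.msg.sigs, Derivable t B (fun σ' => ∃ e' ∈ sent, σ' ∈ e'.msg.sigs) σ) :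
    Safe t B st (sent ++ [e]) := by
  refine { h with sigs := ?_, msgs := ?_ }
  · intro e' he' σ hσ
    rcases List.mem_append.1 he' with he' | he'
    · exact h.sigs e' he' σ hσ
    · obtain rfl := List.mem_singleton.1 he'
      exact goodSig_of_derivable hn hB (fun σ ⟨e₀, he₀, h₀⟩ => h.sigs e₀ he₀ σ h₀) (hsigs σ hσ)
  · intro e' he' hs
    rcases List.mem_append.1 he' with he' | he'
    · exact h.msgs e' he' hs
    · obtain rfl := List.mem_singleton.1 he'
      exact absurd hsrc hs

theorem LState.ValidKey.mono {s s' : LState n V} {k : Key n V} {v : V} (h : s.ValidKey k v)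
    (hl : ∀ sq l, s.LEADER sq = some l → s'.LEADER sq = some l) : s'.ValidKey k v := by
  obtain ⟨l, h1, h2⟩ := h
  exact ⟨l, hl _ _ h1, h2⟩

/-- The share that the handler produces is accounted for. -/
theorem Safe.signedOK_recv {t : ℕ} {B : Finset (Fin n)} {st : Fin n → LState n V}
    {sent : List (Env n V)} (h : Safe t B st sent) {e : Env n V} (he : e ∈ sent)
    {s' : LState n V} {out : Out n V}
    (hr : Recv t e.dst e.src (st e.dst) e.msg s' out)
    (hle : ∀ i, i ∉ B → (st i).Le i (Function.update st e.dst s' i))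
    {r : Round} {sq : ℕ} {v : V}
    (hst : ((st e.dst).lbv (sq, e.src)).started = true)
    (hsg : (s'.lbv (sq, e.src)).signed r = true)
    (hc : (r = .preKey ∧ ∃ key, e.msg = .preKeyStep sq e.src v key) ∨
        ∃ r₀, r₀.next = some r ∧ e.msg = .cert r₀ sq e.src v (.thr ⟨r₀, sq, e.src, v⟩) ∧
          (s'.lbv (sq, e.src)).proof r₀ ≠ none) :
    SignedOK B (Function.update st e.dst s') e.dst ⟨r, sq, e.src, v⟩ := by
  refine ⟨?_, ?_, ?_, ?_⟩
  · simpa using hr.le.started _ hst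
  · simpa using hsg
  · rintro rfl
    rcases hc with ⟨h1, -⟩ | ⟨r₀, h1, -, h2⟩
    · cases h1
    · cases r₀ <;> simp_all [Round.next]
  · intro hl
    dsimp only at hl ⊢
    have hm := h.msgs e he hl
    rcases hc with ⟨rfl, key, h1⟩ | ⟨r₀, h1, h2, -⟩
    · rw [h1] at hm
      exact ⟨((hle _ hl).proposal _ _ hm.2).1, Nat.zero_le _⟩
    · rw [h2] at hm
      obtain ⟨-, h3, h4, -⟩ := hm
      obtain ⟨h5, h6⟩ := (hle _ hl).proposal _ _ h3
      exact ⟨h5, by rw [rank_of_next h1]; exact h4.trans_le h6⟩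

theorem mem_envs {src : Fin n} {now : ℝ} {out : Out n V} {e : Env n V} :
    e ∈ AdaptiveBA.envs src now out ↔ e.src = src ∧ e.sentAt = now ∧ (e.dst, e.msg) ∈ out := by
  obtain ⟨a, b, c, d⟩ := e
  simp only [AdaptiveBA.envs, List.mem_map, Env.mk.injEq]
  constructor
  · rintro ⟨⟨x, y⟩, h, rfl, rfl, rfl, rfl⟩; exact ⟨rfl, rfl, h⟩
  · rintro ⟨rfl, rfl, h⟩; exact ⟨_, h, rfl, rfl, rfl, rfl⟩

theorem le_update {B : Finset (Fin n)} {st : Fin n → LState n V} {d : Fin n} {s' : LState n V}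
    (h : (st d).Le d s') (i : Fin n) (_ : i ∉ B) : (st i).Le i (Function.update st d s' i) := by
  by_cases hi : i = d
  · subst hi; simpa using h
  · rw [Function.update_of_ne hi]; exact .refl _ _

/-- Every clause about a party other than the recipient survives by monotonicity. For the recipient,
each new piece of state is traced to the delivered message, which `sigs` and `msgs` already account
for. -/
theorem Safe.recv {t : ℕ} {B : Finset (Fin n)} (hn : 3 * t < n) (hB : B.card ≤ t)
    {st : Fin n → LState n V} {sent : List (Env n V)} (h : Safe t B st sent) {e : Env n V}
    (he : e ∈ sent) (hd : e.dst ∉ B) {s' : LState n V} {out : Out n V}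
    (hr : Recv t e.dst e.src (st e.dst) e.msg s' out) (now : ℝ) :
    Safe t B (Function.update st e.dst s') (sent ++ AdaptiveBA.envs e.dst now out) := by
  have hle := le_update (B := B) hr.le
  set st' := Function.update st e.dst s' with hst'
  have hsd : st' e.dst = s' := by simp [hst']
  have hso : ∀ i, i ≠ e.dst → st' i = st i := fun i hi => Function.update_of_ne hi _ _
  have hsig := h.sigs e he
  -- Proved in advance: a certificate that the leader sends now is accounted for by an honest member
  -- of its updated collection.
  have hshares : ∀ i, i ∉ B → ∀ x v r q, ((st' i).lbv x).proposal = some v →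
      q ∈ ((st' i).lbv x).shares r → q ∉ B → SignedOK B st' q ⟨r, x.1, x.2, v⟩ := by
    intro i hi x v r q hv hq hqB
    by_cases hid : i = e.dst
    · subst hid
      rw [hsd] at hv hq
      rw [(hr.frame.2.2.2.2.2 x).2.2] at hv
      rcases hr.shares hq with h1 | ⟨rfl, v', h1, h2⟩
      · exact (h.shares _ hi x v r q hv h1 hqB).mono hle hqB
      · obtain rfl : v' = v := by rw [h1] at hv; exact Option.some.inj hv
        have := hsig (.share e.src ⟨r, x.1, x.2, v'⟩) (by rw [h2]; simp [Msg.sigs])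
        exact (this hqB).mono hle hqB
    · rw [hso i hid] at hv hq
      exact (h.shares i hi x v r q hv hq hqB).mono hle hqB
  have hfr := hr.frame
  refine ⟨?_, ?_, ?_, hshares, ?_, ?_, ?_, ?_, ?_, ?_⟩
  · intro e' he' σ hσ
    rcases List.mem_append.1 he' with he' | he'
    · exact (h.sigs e' he' σ hσ).mono hle
    · obtain ⟨-, -, he'⟩ := mem_envs.1 he'
      rcases hr.mem_out he' with ⟨r, sq, v, -, h2, h3, h4, h5⟩ | ⟨r, sq, v, h2, h3, h4, h5⟩ |
        ⟨-, h2⟩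
      · rw [h2] at hσ
        obtain rfl := List.mem_singleton.1 hσ
        exact fun _ => h.signedOK_recv he hr hle h3 h4 h5
      · rw [h2] at hσ
        obtain rfl := List.mem_singleton.1 hσ
        obtain ⟨q, hq, hqB⟩ := exists_honest hn hB h5
        refine ⟨q, hqB, hshares e.dst hd (sq, e.dst) v r q ?_ ?_ hqB⟩
        · rw [hsd, (hfr.2.2.2.2.2 _).2.2]; exact h3
        · rw [hsd]; exact hq
      · rw [h2] at hσ
        cases hk : (st e.dst).KEY with
        | none => simp [hk, Msg.sigs] at hσ
        | some k =>
          simp only [hk, Msg.sigs, List.mem_singleton] at hσ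
          rw [hσ]; exact (h.key _ hd k hk).2.mono hle
  · intro e' he' hs
    rcases List.mem_append.1 he' with he' | he'
    · exact (h.msgs e' he' hs).mono hle hs
    · obtain ⟨h1, -, he'⟩ := mem_envs.1 he'
      rw [h1]
      rcases hr.mem_out he' with ⟨r, sq, v, -, h2, h3, h4, h5⟩ | ⟨r, sq, v, h2, h3, h4, h5⟩ |
        ⟨-, h2⟩
      · rw [h2]; exact ⟨v, rfl⟩
      · rw [h2]
        refine ⟨rfl, ?_, ?_, rfl⟩
        · rw [hsd, (hfr.2.2.2.2.2 _).2.2]; exact h3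
        · rw [hsd, h4, waitRank_next]; exact Nat.lt_succ_self _
      · rw [h2]; trivial
  · intro i hi x r c hc
    by_cases hid : i = e.dst
    · subst hid
      rw [hsd] at hc
      rcases hr.proof hc with h1 | ⟨h1, h2⟩
      · exact ⟨(h.proofs _ hi x r c h1).1, (h.proofs _ hi x r c h1).2.mono hle⟩
      · exact ⟨h1, (hsig c.proof (by rw [h2]; simp [Msg.sigs])).mono hle⟩
    · rw [hso i hid] at hc
      exact ⟨(h.proofs _ hi x r c hc).1, (h.proofs _ hi x r c hc).2.mono hle⟩
  · intro i hi x r q hq hqB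
    by_cases hid : i = e.dst
    · subst hid
      rw [hsd] at hq
      rcases hr.heard hq with h1 | ⟨rfl, h1, ρ, v, h2, -, -⟩
      · exact (hle q hqB).signed _ _ (h.heard _ hi x r q h1 hqB)
      -- The link is authenticated, and an honest sender puts only its own share into a share
      -- message, so it has signed in this round.
      · have h3 := h.msgs e he hqB
        rw [h2] at h3
        obtain ⟨v', h3⟩ := h3
        have := hsig ρ (by rw [h2]; simp [Msg.sigs])
        rw [h3] at this
        exact (hle _ hqB).signed _ _ (this hqB).2.1
    · rw [hso i hid] at hq
      exact (hle q hqB).signed _ _ (h.heard _ hi x r q hq hqB)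
  · intro i hi k hk
    by_cases hid : i = e.dst
    · subst hid
      rw [hsd] at hk ⊢
      have hl : ∀ sq l, (st e.dst).LEADER sq = some l → s'.LEADER sq = some l := by
        rw [hfr.2.2.1]; exact fun _ _ => id
      rcases hr.key with ⟨h1, h2⟩ | ⟨k', v, h1, h2, h3, h4, -⟩
      · rw [h1] at hk
        rw [h2]
        exact ⟨(h.key _ hi k hk).1.mono hl, (h.key _ hi k hk).2.mono hle⟩
      · obtain rfl : k' = k := by rw [h2] at hk; exact Option.some.inj hk
        rw [h3]
        exact ⟨h4.mono hl, (hsig k'.proof (by rw [h1]; simp [Msg.sigs])).mono hle⟩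
    · rw [hso i hid] at hk ⊢
      exact ⟨(h.key _ hi k hk).1, (h.key _ hi k hk).2.mono hle⟩
  · intro i hi x hx
    have : (st' i).LOCK = (st i).LOCK := by
      by_cases hid : i = e.dst
      · subst hid; rw [hsd, hfr.1]
      · rw [hso i hid]
    rw [this] at hx
    obtain ⟨q, hq, hk⟩ := h.lock i hi x hx
    exact ⟨q, hq, (hle q hq).keyGe x hk⟩
  · intro i hi x r hx hl
    have key : ((st i).lbv x).signed r = true → ∃ v, ((st' x.2).lbv x).proposal = some v ∧
        r.rank ≤ waitRank ((st' x.2).lbv x).waiting := by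
      intro hx
      obtain ⟨v, h1, h2⟩ := h.signed i hi x r hx hl
      obtain ⟨h3, h4⟩ := (hle _ hl).proposal _ _ h1
      exact ⟨v, h3, h2.trans h4⟩
    by_cases hid : i = e.dst
    · subst hid
      rw [hsd] at hx
      rcases hr.signed hx with h1 | ⟨h1, h2, v, -, h3⟩
      · exact key h1
      · obtain ⟨sq, l⟩ := x
        dsimp only at h1
        subst h1
        exact ⟨v, (h.signedOK_recv he hr hle h2 hx h3).2.2.2 hl⟩
    · rw [hso i hid] at hx
      exact key hx
  · intro i hi x v r hv hw
    by_cases hid : i = e.dst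
    · subst hid
      rw [hsd] at hv hw ⊢
      rw [(hfr.2.2.2.2.2 x).2.2] at hv
      rcases hr.waiting x with ⟨h1, h2⟩ | ⟨h1, r₀, v', h2, -, h3, h4, -, -, h5⟩
      · rw [h1] at hw
        exact h2 r hw (h.card _ hi x v r hv hw)
      · have hrk : r.rank = r₀.rank + 1 := rank_of_next (h4 ▸ hw)
        rw [h5 r (by rintro rfl; omega)]
        -- The leader turns from `r₀` to `r`. An honest share of round `r` presupposes that it had
        -- reached `r` already, so every share collected in advance is Byzantine, and these are at
        -- most `t < n - t`. Otherwise the leader could hold enough shares with no further message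
        -- to trigger the certificate.
        have : ((st e.dst).lbv x).shares r ⊆ B := by
          intro q hq
          by_contra hqB
          have := ((h.shares _ hi x v r q hv hq hqB).2.2.2 (h1 ▸ hi)).2
          change r.rank ≤ waitRank ((st x.2).lbv x).waiting at this
          rw [← h1, h3] at this
          simp only [waitRank] at this
          omega
        have := Finset.card_le_card this
        omega
    · rw [hso i hid] at hv hw ⊢
      exact h.card _ hi x v r hv hw
  · intro i hi q hq hqB
    by_cases hid : i = e.dst
    · subst hid
      rw [hsd] at hq
      rcases hr.replied with h1 | ⟨h1, h2, -⟩
      · rw [h1] at hq; exact (hle q hqB).active (h.replied _ hi q hq hqB)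
      · rw [h2, Finset.mem_insert] at hq
        rcases hq with rfl | hq
        · have := h.msgs e he hqB
          rw [h1] at this
          exact (hle _ hqB).active this
        · exact (hle q hqB).active (h.replied _ hi q hq hqB)
    · rw [hso i hid] at hq
      exact (hle q hqB).active (h.replied _ hi q hq hqB)

/-- The clause on locks is a hypothesis because a new lock of one party is matched by the new key of
another one. That needs the simultaneous end of the slot, not just the local effects in `Ticked`. -/
theorem Safe.tick {t : ℕ} {B : Finset (Fin n)} (hn : 3 * t < n)
    {st st' : Fin n → LState n V} {sent sent' : List (Env n V)} (h : Safe t B st sent)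
    {out : Fin n → Out n V} (hT : ∀ i, i ∉ B → Ticked i (st i) (st' i) (out i))
    (hsent : ∀ e ∈ sent', e ∈ sent ∨ (e.src ∉ B ∧ (e.dst, e.msg) ∈ out e.src))
    (hlock : ∀ i, i ∉ B → ∀ x, (st' i).LOCK = some x → ∃ q, q ∉ B ∧ (st' q).KeyGe x) :
    Safe t B st' sent' := by
  have hle := fun i hi => (hT i hi).le
  have hkey : ∀ i, i ∉ B → ∀ k, (st' i).KEY = some k →
      (st' i).ValidKey k (st' i).VALUE ∧ GoodSig B st' k.proof := by
    intro i hi k hk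
    rcases (hT i hi).key with ⟨h1, h2⟩ | ⟨sq, l, c, h1, h2, h3, h4⟩
    · rw [h1] at hk
      rw [h2]
      exact ⟨(h.key i hi k hk).1.mono (hT i hi).leader, (h.key i hi k hk).2.mono hle⟩
    · rw [h2, Option.some.injEq] at hk
      subst hk
      obtain ⟨h5, h6⟩ := h.proofs i hi _ _ c h1
      rw [h3]
      exact ⟨⟨l, h4, h5⟩, h6.mono hle⟩
  refine ⟨?_, ?_, ?_, ?_, ?_, hkey, hlock, ?_, ?_, ?_⟩
  · intro e he σ hσ
    rcases hsent e he with he | ⟨hs, he⟩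
    · exact (h.sigs e he σ hσ).mono hle
    · rcases (hT _ hs).out _ _ he with ⟨sq, v, h1, -⟩ | ⟨h1, -⟩
      · rw [h1] at hσ
        cases hk : (st' e.src).KEY with
        | none => simp [hk, Msg.sigs] at hσ
        | some k =>
          simp only [hk, Msg.sigs, List.mem_singleton] at hσ
          rw [hσ]; exact (hkey _ hs k hk).2
      · simp [h1, Msg.sigs] at hσ
  · intro e he hs
    rcases hsent e he with he | ⟨-, he⟩
    · exact (h.msgs e he hs).mono hle hs
    · rcases (hT _ hs).out _ _ he with ⟨sq, v, h1, h2⟩ | ⟨h1, h2⟩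
      · rw [h1]; exact ⟨rfl, h2⟩
      · rw [h1]; exact h2
  · intro i hi x r c hc
    rw [((hT i hi).votes x).2.2.2] at hc
    exact ⟨(h.proofs i hi x r c hc).1, (h.proofs i hi x r c hc).2.mono hle⟩
  · intro i hi x v r q hv hq hqB
    rw [((hT i hi).votes x).2.2.1] at hq
    rcases (hT i hi).proposal x v hv with ⟨h1, -⟩ | ⟨h1, -⟩
    · exact (h.shares i hi x v r q h1 hq hqB).mono hle hqB
    · simp [h1, LBV.fresh] at hq
  · intro i hi x r q hq hqB
    rw [((hT i hi).votes x).2.1] at hq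
    exact (hle q hqB).signed _ _ (h.heard i hi x r q hq hqB)
  · intro i hi x r hx hl
    rw [((hT i hi).votes x).1] at hx
    obtain ⟨v, h1, h2⟩ := h.signed i hi x r hx hl
    obtain ⟨h3, h4⟩ := (hle _ hl).proposal _ _ h1
    exact ⟨v, h3, h2.trans h4⟩
  · intro i hi x v r hv hw
    rw [((hT i hi).votes x).2.2.1]
    rcases (hT i hi).proposal x v hv with ⟨h1, h2⟩ | ⟨h1, -⟩
    · exact h.card i hi x v r h1 (h2 ▸ hw)
    · simp only [h1, LBV.fresh, Finset.card_empty]; omega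
  · intro i hi q hq hqB
    rw [(hT i hi).replied] at hq
    exact (hle q hqB).active (h.replied i hi q hq hqB)

/-! ### The slot of an honest leader -/

/-- A key held by one honest party is valid for every other. -/
theorem Safe.validKey_transfer {t p : ℕ} {Δ : ℝ} {B : Finset (Fin n)} {st : Fin n → LState n V}
    {sent : List (Env n V)} (h : Safe t B st sent)
    (hs : ∀ i, i ∉ B → Shape Δ i p (st i)) {q i : Fin n} (hq : q ∉ B) (hi : i ∉ B)
    {k : Key n V} {v : V} (hk : (st q).KEY = some k) (hv : (st q).ValidKey k v) :
    (st i).ValidKey k v := by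
  obtain ⟨l, h1, h2⟩ := hv
  obtain ⟨h3, h4⟩ := (hs q hq).core.leader _ _ h1
  have h5 := (h.key q hq k hk).2
  rw [h2] at h5
  obtain ⟨q', -, -, -, -, h6⟩ := h5
  rcases (hs i hi).core.wedged l h4 with h7 | ⟨rfl, h7⟩
  · exact ⟨l, by rw [h3]; exact h7, h2⟩
  -- The receiver is the leader of the key's view and never started it. But the proof of the key
  -- involves an honest share, and honest parties sign only what this leader has proposed.
  · have := (hs l hi).core.started_of_proposal (h6 hi).1
    dsimp only at this
    rw [h3, h7] at this
    cases this

/-- The message with which leader `l` asks a party in state `s` for its share of round `r` on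
value `v`. -/
def StageMsg (l : Fin n) (v : V) (s : LState n V) : Round → Msg n V → Prop
  | .preKey, m => ∃ key, m = .preKeyStep (l.val + 1) l v key ∧ s.Accepts v key
  | .key, m => m = .cert .preKey (l.val + 1) l v (.thr ⟨.preKey, l.val + 1, l, v⟩)
  | .lock, m => m = .cert .key (l.val + 1) l v (.thr ⟨.key, l.val + 1, l, v⟩)

/-- The request of leader `l` for the share of party `i` in round `r` is under way, or the share
is under way, or it has arrived. -/
def Served (Δ : ℝ) (st : Fin n → LState n V) (pending : Multiset (Env n V)) (l : Fin n) (v : V)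
    (i : Fin n) (r : Round) : Prop :=
  (∃ e ∈ pending, e.src = l ∧ e.dst = i ∧ e.sentAt ≤ leaderStart Δ l + 2 * Δ * r.rank ∧
    StageMsg l v (st i) r e.msg ∧ ((st i).lbv (l.val + 1, l)).signed r = false) ∨
  (∃ e ∈ pending, e.src = i ∧ e.dst = l ∧ e.sentAt ≤ leaderStart Δ l + 2 * Δ * r.rank + Δ ∧
    e.msg = .share r (l.val + 1) l (.share i ⟨r, l.val + 1, l, v⟩) ∧
    i ∉ ((st l).lbv (l.val + 1, l)).heard r) ∨
  i ∈ ((st l).lbv (l.val + 1, l)).shares r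

/-- The commit message of leader `l` to party `i` is under way or has arrived. -/
def Committed (Δ : ℝ) (st : Fin n → LState n V) (pending : Multiset (Env n V)) (l : Fin n) (v : V)
    (i : Fin n) : Prop :=
  (∃ e ∈ pending, e.src = l ∧ e.dst = i ∧ e.sentAt ≤ leaderStart Δ l + 6 * Δ ∧
    e.msg = .cert .lock (l.val + 1) l v (.thr ⟨.lock, l.val + 1, l, v⟩)) ∨
  ((st i).lbv (l.val + 1, l)).proof .lock ≠ none

/-- The progress of the view of the honest leader `l` during its slot. -/
def ViewInv (Δ : ℝ) (B : Finset (Fin n)) (st : Fin n → LState n V) (pending : Multiset (Env n V))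
    (l : Fin n) : Prop :=
  ∀ v, ((st l).lbv (l.val + 1, l)).proposal = some v →
    (∀ r : Round, r.rank ≤ waitRank ((st l).lbv (l.val + 1, l)).waiting →
      ∀ i, i ∉ B → Served Δ st pending l v i r) ∧
    (((st l).lbv (l.val + 1, l)).waiting = none → ∀ i, i ∉ B → Committed Δ st pending l v i)

/-- While the honest leader `l` asks for keys, a key that matches a given lock is on its way. -/
def QueryInv (Δ : ℝ) (B : Finset (Fin n)) (st : Fin n → LState n V) (pending : Multiset (Env n V))
    (l : Fin n) : Prop :=
  (st l).pc = .query l → ∀ i, i ∉ B → ∀ x, (st i).LOCK = some x →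
    (∃ e ∈ pending, e.src = l ∧ e.dst ∉ B ∧ e.sentAt ≤ leaderStart Δ l - 2 * Δ ∧
      e.msg = .keyRequest ∧ (st e.dst).KeyGe x ∧ l ∉ (st e.dst).replied) ∨
    (∃ e ∈ pending, e.src ∉ B ∧ e.dst = l ∧ e.sentAt ≤ leaderStart Δ l - Δ ∧
      ∃ k v, e.msg = .keyReply (some k) v ∧ x ≤ k.sq ∧ (st l).ValidKey k v) ∨
    (st l).KeyGe x

/-! ### Deadlines implied by pending messages -/

section pending

variable {Δ : ℝ} {B : Finset (Fin n)} {st : Fin n → LState n V}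
  {pending pending' : Multiset (Env n V)} {l : Fin n}

/-- The progress invariants mention messages among honest parties only, so sends by Byzantine
parties and deliveries to them are harmless. -/
theorem ViewInv.of_pending (hl : l ∉ B)
    (hp : ∀ e ∈ pending, e.src ∉ B → e.dst ∉ B → e ∈ pending') (h : ViewInv Δ B st pending l) :
    ViewInv Δ B st pending' l := by
  intro v hv
  obtain ⟨h1, h2⟩ := h v hv
  refine ⟨fun r hr i hi => ?_, fun hw i hi => ?_⟩
  · rcases h1 r hr i hi with ⟨e, he, h3, h4, h5⟩ | ⟨e, he, h3, h4, h5⟩ | h3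
    · exact .inl ⟨e, hp e he (h3 ▸ hl) (h4 ▸ hi), h3, h4, h5⟩
    · exact .inr (.inl ⟨e, hp e he (h3 ▸ hi) (h4 ▸ hl), h3, h4, h5⟩)
    · exact .inr (.inr h3)
  · rcases h2 hw i hi with ⟨e, he, h3, h4, h5⟩ | h3
    · exact .inl ⟨e, hp e he (h3 ▸ hl) (h4 ▸ hi), h3, h4, h5⟩
    · exact .inr h3

theorem QueryInv.of_pending (hl : l ∉ B)
    (hp : ∀ e ∈ pending, e.src ∉ B → e.dst ∉ B → e ∈ pending') (h : QueryInv Δ B st pending l) :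
    QueryInv Δ B st pending' l := by
  intro hq i hi x hx
  rcases h hq i hi x hx with ⟨e, he, h3, h4, h5⟩ | ⟨e, he, h3, h4, h5⟩ | h3
  · exact .inl ⟨e, hp e he (h3 ▸ hl) h4, h3, h4, h5⟩
  · exact .inr (.inl ⟨e, hp e he h3 (h4 ▸ hl), h3, h4, h5⟩)
  · exact .inr (.inr h3)

/-- While the leader waits for shares of round `r`, the requests and shares of that round have not
all been delivered. -/
theorem ViewInv.time_le {t : ℕ} {now : ℝ} (h : ViewInv Δ B st pending l) (hl : l ∉ B)
    (hΔ : 0 < Δ) (hB : B.card ≤ t)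
    (hsync : ∀ e ∈ pending, e.src ∉ B → e.dst ∉ B → now ≤ e.sentAt + Δ)
    {v : V} (hv : ((st l).lbv (l.val + 1, l)).proposal = some v) {r : Round}
    (hw : ((st l).lbv (l.val + 1, l)).waiting = some r)
    (hc : (((st l).lbv (l.val + 1, l)).shares r).card < n - t) :
    now ≤ leaderStart Δ l + 2 * Δ * r.rank + 2 * Δ := by
  -- If all honest shares had arrived there would be at least `n - t` of them. So one is missing,
  -- and its request or the share itself is still pending.
  obtain ⟨i, hi, hns⟩ : ∃ i, i ∉ B ∧ i ∉ ((st l).lbv (l.val + 1, l)).shares r := by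
    by_contra! hcon
    have h1 : Bᶜ ⊆ ((st l).lbv (l.val + 1, l)).shares r := fun i hi =>
      hcon i (by simpa using hi)
    have h2 := Finset.card_le_card h1
    rw [Finset.card_compl, Fintype.card_fin] at h2
    omega
  rcases (h v hv).1 r (by rw [hw]; exact le_rfl) i hi with ⟨e, he, h3, h4, h5, -⟩ |
    ⟨e, he, h3, h4, h5, -⟩ | h3
  · have := hsync e he (h3 ▸ hl) (h4 ▸ hi); linarith
  · have := hsync e he (h3 ▸ hi) (h4 ▸ hl); linarith
  · exact absurd h3 hns

/-- At the end of the slot of an honest leader that has started its view, all commit messages have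
been delivered. -/
theorem ViewInv.all_committed {t : ℕ} {sent : List (Env n V)} (h : ViewInv Δ B st pending l)
    (hl : l ∉ B) (hΔ : 0 < Δ) (hB : B.card ≤ t) (hsafe : Safe t B st sent)
    (hsync : ∀ e ∈ pending, e.src ∉ B → e.dst ∉ B → slotEnd Δ l < e.sentAt + Δ)
    {v : V} (hv : ((st l).lbv (l.val + 1, l)).proposal = some v) {i : Fin n} (hi : i ∉ B) :
    ((st i).lbv (l.val + 1, l)).proof .lock ≠ none := by
  cases hw : ((st l).lbv (l.val + 1, l)).waiting with
  | some r =>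
    -- A leader still waiting would bound the time by `leaderStart Δ l + 6Δ`, as `r.rank ≤ 2`, but
    -- the slot ends `Δ` later.
    have := h.time_le hl hΔ hB (fun e he h1 h2 => (hsync e he h1 h2).le) hv hw
      (hsafe.card l hl _ v r hv hw)
    have hr : (r.rank : ℝ) ≤ 2 := by exact_mod_cast Nat.lt_succ_iff.1 r.rank_lt_three
    unfold slotEnd leaderStart at *
    nlinarith
  | none =>
    rcases (h v hv).2 hw i hi with ⟨e, he, h3, h4, h5, -⟩ | h3
    · have := hsync e he (h3 ▸ hl) (h4 ▸ hi)
      unfold slotEnd leaderStart at *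
      linarith
    · exact h3

end pending

/-! ### Stability of the progress invariants under a delivery -/

section deliver

variable {t p : ℕ} {Δ now : ℝ} {B : Finset (Fin n)} {st : Fin n → LState n V}
  {sent : List (Env n V)} {rest : Multiset (Env n V)} {l : Fin n} {e₀ : Env n V}
  {s' : LState n V} {out : Out n V}

theorem LState.Accepts.congr {s s' : LState n V} {v : V} {key : Option (Key n V)}
    (h : s.Accepts v key) (h1 : s'.LOCK = s.LOCK) (h2 : s'.LEADER = s.LEADER) :
    s'.Accepts v key := by
  unfold LState.Accepts LState.ValidKey at *
  rw [h1, h2]; exact h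

theorem StageMsg.congr {v : V} {r : Round} {m : Msg n V} {s s' : LState n V}
    (h : StageMsg l v s r m) (h1 : s'.LOCK = s.LOCK) (h2 : s'.LEADER = s.LEADER) :
    StageMsg l v s' r m := by
  cases r with
  | preKey => obtain ⟨key, h3, h4⟩ := h; exact ⟨key, h3, h4.congr h1 h2⟩
  | key => exact h
  | lock => exact h

theorem frame_update (hr : Recv t e₀.dst e₀.src (st e₀.dst) e₀.msg s' out) (i : Fin n) :
    (Function.update st e₀.dst s' i).LOCK = (st i).LOCK ∧
    (Function.update st e₀.dst s' i).LEADER = (st i).LEADER ∧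
    (Function.update st e₀.dst s' i).pc = (st i).pc ∧
    (∀ x, ((Function.update st e₀.dst s' i).lbv x).proposal = ((st i).lbv x).proposal) := by
  by_cases hi : i = e₀.dst
  · subst hi
    simp only [Function.update_self]
    exact ⟨hr.frame.1, hr.frame.2.2.1, hr.frame.2.2.2.1, fun x => (hr.frame.2.2.2.2.2 x).2.2⟩
  · rw [Function.update_of_ne hi]; exact ⟨rfl, rfl, rfl, fun _ => rfl⟩

theorem mem_pending_of_ne {e : Env n V} (he : e ∈ e₀ ::ₘ rest) (hne : e ≠ e₀)
    (l' : List (Env n V)) : e ∈ rest + (l' : Multiset (Env n V)) :=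
  Multiset.mem_add.2 (.inl ((Multiset.mem_cons.1 he).resolve_left hne))

/-- A share can move only from requested to sent to collected. The delivered message need not be the
recorded one, so the cases are split by whether the flag changed, not by which message arrived.
Synchrony turns the time limit of a request into that of its share, `Δ` later. -/
theorem Served.deliver (hl : l ∉ B) (hsafe : Safe t B st sent)
    (hps : ∀ e ∈ e₀ ::ₘ rest, e ∈ sent)
    (hrcv : receive t e₀.dst e₀.src (st e₀.dst) e₀.msg = (s', out))
    (hsync : ∀ e ∈ e₀ ::ₘ rest, e.src ∉ B → e.dst ∉ B → now ≤ e.sentAt + Δ)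
    (hst : ∀ i, i ∉ B → ((st i).lbv (l.val + 1, l)).started = true ∧
      ((st i).lbv (l.val + 1, l)).active = true)
    {v : V} (hv : ((st l).lbv (l.val + 1, l)).proposal = some v) {i : Fin n} (hi : i ∉ B)
    {r : Round} (h : Served Δ st (e₀ ::ₘ rest) l v i r) :
    Served Δ (Function.update st e₀.dst s')
      (rest + (AdaptiveBA.envs e₀.dst now out : Multiset (Env n V))) l v i r := by
  have hr := recv_of_receive hrcv
  have hle := le_update (B := B) hr.le
  have he₀ := hps e₀ (Multiset.mem_cons_self _ _)
  have hfr := frame_update hr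
  rcases h with ⟨e, he, h1, h2, h3, h4, h5⟩ | ⟨e, he, h1, h2, h3, h4, h5⟩ | h
  · by_cases hs : ((Function.update st e₀.dst s' i).lbv (l.val + 1, l)).signed r = true
    · have hid : i = e₀.dst := by
        by_contra hid
        rw [Function.update_of_ne hid, h5] at hs
        cases hs
      subst hid
      rw [Function.update_self] at hs
      rcases hr.signed hs with h6 | ⟨h6, h7, v', h8, h9⟩
      · rw [h5] at h6; cases h6
      · dsimp only at h6 h8 h9
        -- An honest leader asks for shares on its single proposal only.
        have hvv : v' = v := by
          subst h6
          have h10 := ((hsafe.signedOK_recv he₀ hr hle h7 hs h9).2.2.2 hl).1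
          dsimp only at h10
          rw [(hfr _).2.2.2, hv] at h10
          exact (Option.some.inj h10).symm
        subst hvv
        refine .inr (.inl ⟨⟨e₀.dst, l, _, now⟩, Multiset.mem_add.2 (.inr (mem_envs.2
          ⟨rfl, rfl, by rw [h8]; exact List.mem_singleton.2 rfl⟩)), rfl, rfl, ?_, rfl, ?_⟩)
        · have := hsync e he (h1 ▸ hl) (h2 ▸ hi)
          dsimp only; linarith
        -- The new share cannot have been preceded by a heard one: hearing from an honest party
        -- presupposes its flag, which was down. If the leader serves itself, the message just
        -- handled is a request, not a share.
        · intro hh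
          by_cases hld : l = e₀.dst
          · rw [hld, Function.update_self, ← hld] at hh
            rcases hr.heard hh with h11 | ⟨-, -, ρ, v'', h11, -⟩
            · rw [← hld] at h11
              have := hsafe.heard l hl _ _ _ h11 (hld ▸ hl)
              rw [← hld] at h5
              rw [h5] at this; cases this
            · rw [h11] at h9
              rcases h9 with ⟨-, key, h9⟩ | ⟨r₀, -, h9, -⟩ <;> cases h9
          · rw [Function.update_of_ne hld] at hh
            have := hsafe.heard l hl _ _ _ hh hi
            rw [h5] at this; cases this
    · rw [Bool.not_eq_true] at hs
      refine .inl ⟨e, mem_pending_of_ne he ?_ _, h1, h2, h3,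
        h4.congr (hfr i).1 (hfr i).2.1, hs⟩
      rintro rfl
      subst h1 h2
      rw [Function.update_self] at hs
      -- Were the request itself the delivered message, the party, which has started and not wedged
      -- the view, would have signed.
      have hcontra : (s'.lbv (e.src.val + 1, e.src)).signed r = true := by
        cases r with
        | preKey =>
          obtain ⟨key, h6, h7⟩ := h4
          rw [h6] at hrcv
          exact signed_of_receive_preKeyStep hrcv (hst _ hi).1 (hst _ hi).2 h7
        | key =>
          rw [h4] at hrcv
          exact signed_of_receive_cert rfl hrcv (hst _ hi).1 (hst _ hi).2
        | lock =>
          rw [h4] at hrcv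
          exact signed_of_receive_cert rfl hrcv (hst _ hi).1 (hst _ hi).2
      rw [hs] at hcontra; cases hcontra
  · by_cases hh : i ∈ ((Function.update st e₀.dst s' l).lbv (l.val + 1, l)).heard r
    · have hld : l = e₀.dst := by
        by_contra hld
        rw [Function.update_of_ne hld] at hh
        exact h5 hh
      subst hld
      rw [Function.update_self] at hh
      rcases hr.heard hh with h6 | ⟨h6, -, ρ, v', h7, h8, h9⟩
      · exact absurd h6 h5
      · refine .inr (.inr ?_)
        rw [Function.update_self]
        refine h9 ?_
        -- Whatever share the honest party sent in this round is on the leader's proposal, hence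
        -- valid, so being heard means being collected.
        have h10 := hsafe.msgs e₀ he₀ (h6 ▸ hi)
        rw [h7] at h10
        obtain ⟨w, h10⟩ := h10
        have h11 := hsafe.sigs e₀ he₀ ρ (by rw [h7]; simp [Msg.sigs])
        rw [h10] at h11
        have h12 := ((h11 (h6 ▸ hi)).2.2.2 hl).1
        dsimp only at h12 h8
        rw [h8, Option.some.injEq] at h12
        rw [h10, h12]
    · refine .inr (.inl ⟨e, mem_pending_of_ne he ?_ _, h1, h2, h3, h4, hh⟩)
      rintro rfl
      subst h1 h2
      rw [Function.update_self] at hh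
      rw [h4] at hrcv
      exact hh (heard_of_receive_share hrcv (hst _ hl).1 hv h5)
  · exact .inr (.inr ((hle l hl).shares _ _ h))

theorem Committed.deliver
    (hrcv : receive t e₀.dst e₀.src (st e₀.dst) e₀.msg = (s', out))
    (hst : ∀ i, i ∉ B → ((st i).lbv (l.val + 1, l)).started = true ∧
      ((st i).lbv (l.val + 1, l)).active = true)
    {v : V} {i : Fin n} (hi : i ∉ B) (h : Committed Δ st (e₀ ::ₘ rest) l v i) :
    Committed Δ (Function.update st e₀.dst s')
      (rest + (AdaptiveBA.envs e₀.dst now out : Multiset (Env n V))) l v i := by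
  have hle := le_update (B := B) (recv_of_receive hrcv).le
  rcases h with ⟨e, he, h1, h2, h3, h4⟩ | h
  · by_cases hp : e = e₀
    · subst hp
      subst h1 h2
      right
      rw [Function.update_self]
      rw [h4] at hrcv
      refine proof_of_receive_cert hrcv (hst _ hi).1 (hst _ hi).2
    · exact .inl ⟨e, mem_pending_of_ne he hp _, h1, h2, h3, h4⟩
  · exact .inr ((hle i hi).proof _ _ h)

theorem mem_toAll (m : Msg n V) (q : Fin n) : (q, m) ∈ toAll m := by simp [toAll]

/-- Besides transporting the served rounds, the delivery may complete a round. Then the requests of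
the next round, or the commit messages, leave at this moment, which `ViewInv.time_le` bounds. -/
theorem ViewInv.deliver (hl : l ∉ B) (hΔ : 0 < Δ) (hB : B.card ≤ t) (hsafe : Safe t B st sent)
    (hps : ∀ e ∈ e₀ ::ₘ rest, e ∈ sent)
    (hrcv : receive t e₀.dst e₀.src (st e₀.dst) e₀.msg = (s', out))
    (hsync : ∀ e ∈ e₀ ::ₘ rest, e.src ∉ B → e.dst ∉ B → now ≤ e.sentAt + Δ)
    (hst : ((st l).lbv (l.val + 1, l)).proposal ≠ none → ∀ i, i ∉ B →
      ((st i).lbv (l.val + 1, l)).started = true ∧ ((st i).lbv (l.val + 1, l)).active = true)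
    (h : ViewInv Δ B st (e₀ ::ₘ rest) l) :
    ViewInv Δ B (Function.update st e₀.dst s')
      (rest + (AdaptiveBA.envs e₀.dst now out : Multiset (Env n V))) l := by
  intro v hv
  have hr := recv_of_receive hrcv
  rw [(frame_update hr l).2.2.2] at hv
  have hst := hst (by simp [hv])
  obtain ⟨h1, h2⟩ := h v hv
  have hw : ((Function.update st e₀.dst s' l).lbv (l.val + 1, l)).waiting =
      ((st l).lbv (l.val + 1, l)).waiting ∨ (e₀.dst = l ∧ ∃ r,
        ((st l).lbv (l.val + 1, l)).waiting = some r ∧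
        ((Function.update st e₀.dst s' l).lbv (l.val + 1, l)).waiting = r.next ∧
        out = toAll (.cert r (l.val + 1) l v (.thr ⟨r, l.val + 1, l, v⟩)) ∧
        now ≤ leaderStart Δ l + 2 * Δ * r.rank + 2 * Δ) := by
    by_cases hld : l = e₀.dst
    · subst hld
      simp only [Function.update_self]
      rcases hr.waiting (e₀.dst.val + 1, e₀.dst) with ⟨h3, -⟩ | ⟨-, r, v', h3, -, h4, h5, h6, -⟩
      · exact .inl h3
      · obtain rfl : v' = v := by rw [hv] at h3; exact (Option.some.inj h3).symm
        exact .inr ⟨trivial, r, h4, h5, h6, h.time_le hl hΔ hB hsync hv h4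
          (hsafe.card _ hl _ _ r hv h4)⟩
    · rw [Function.update_of_ne hld]; exact .inl rfl
  have hnew : ∀ r, out = toAll (.cert r (l.val + 1) l v (.thr ⟨r, l.val + 1, l, v⟩)) →
      e₀.dst = l → ∀ i, (⟨l, i, .cert r (l.val + 1) l v (.thr ⟨r, l.val + 1, l, v⟩), now⟩ :
        Env n V) ∈ rest + (AdaptiveBA.envs e₀.dst now out : Multiset (Env n V)) := by
    intro r hout hd i
    exact Multiset.mem_add.2 (.inr (mem_envs.2 ⟨hd.symm, rfl, by rw [hout]; exact mem_toAll _ _⟩))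
  refine ⟨fun r hr' i hi => ?_, fun hw' i hi => ?_⟩
  · by_cases hold : r.rank ≤ waitRank ((st l).lbv (l.val + 1, l)).waiting
    · exact (h1 r hold i hi).deliver hl hsafe hps hrcv hsync hst hv hi
    · rcases hw with hw | ⟨hd, r₀, hw, hw', hout, htime⟩
      · rw [hw] at hr'; exact absurd hr' hold
      · rw [hw] at hold
        rw [hw', waitRank_next] at hr'
        have hrk : r.rank = r₀.rank + 1 := by simp only [waitRank] at hold; omega
        refine .inl ⟨_, hnew r₀ hout hd i, rfl, rfl, ?_, ?_, ?_⟩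
        · rw [hrk]; push_cast; linarith
        · cases r <;> cases r₀ <;> first | rfl | simp [Round.rank] at hrk
        -- No honest party can have signed for the new round: earlier this would presuppose that the
        -- leader had reached it, and the present delivery produces the leader's broadcast rather
        -- than a share.
        · by_contra hs
          rw [Bool.not_eq_false] at hs
          have hs' : ((st i).lbv (l.val + 1, l)).signed r = true := by
            by_cases hid : i = e₀.dst
            · subst hid
              rw [Function.update_self] at hs
              rcases hr.signed hs with h6 | ⟨-, -, v', h6, -⟩
              · exact h6
              · have := mem_toAll (.cert r₀ (l.val + 1) l v (.thr ⟨r₀, l.val + 1, l, v⟩)) l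
                rw [← hout, h6] at this
                simp at this
            · rwa [Function.update_of_ne hid] at hs
          obtain ⟨v', -, h6⟩ := hsafe.signed i hi _ r hs' hl
          exact hold (by rw [← hw]; exact h6)
  · rcases hw with hw | ⟨hd, r₀, hw, hw'', hout, htime⟩
    · rw [hw] at hw'
      exact (h2 hw' i hi).deliver hrcv hst hi
    · rw [hw''] at hw'
      -- Only the lock round has no successor. Its rank `2` gives the time limit `2Δ · 2 + 2Δ = 6Δ`
      -- for the commit message.
      obtain rfl : r₀ = .lock := by cases r₀ <;> simp_all [Round.next]
      refine .inl ⟨_, hnew _ hout hd i, rfl, rfl, ?_, rfl⟩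
      simp only [Round.rank] at htime
      push_cast at htime
      linarith

/-- A matching key advances from a pending request to a pending reply to the leader's own KEY.
Between request and reply the holder may only get a more recent key, and the reply is valid for the
leader by `Safe.validKey_transfer`. -/
theorem QueryInv.deliver (hl : l ∉ B) (hd : e₀.dst ∉ B) (hsafe : Safe t B st sent)
    (hs : ∀ i, i ∉ B → Shape Δ i p (st i))
    (hrcv : receive t e₀.dst e₀.src (st e₀.dst) e₀.msg = (s', out))
    (hsync : ∀ e ∈ e₀ ::ₘ rest, e.src ∉ B → e.dst ∉ B → now ≤ e.sentAt + Δ)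
    (h : QueryInv Δ B st (e₀ ::ₘ rest) l) :
    QueryInv Δ B (Function.update st e₀.dst s')
      (rest + (AdaptiveBA.envs e₀.dst now out : Multiset (Env n V))) l := by
  intro hq i hi x hx
  have hr := recv_of_receive hrcv
  have hle := le_update (B := B) hr.le
  have hfr := frame_update hr
  rw [(hfr l).2.2.1] at hq
  rw [(hfr i).1] at hx
  have hvk : ∀ k v, (st l).ValidKey k v → (Function.update st e₀.dst s' l).ValidKey k v := by
    intro k v h
    unfold LState.ValidKey at *
    rw [(hfr l).2.1]; exact h
  rcases h hq i hi x hx with ⟨e, he, h1, h2, h3, h4, h5, h6⟩ | ⟨e, he, h1, h2, h3, k, v, h4, h5, h6⟩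
    | h
  · by_cases hrep : l ∈ (Function.update st e₀.dst s' e.dst).replied
    · have hed : e.dst = e₀.dst := by
        by_contra hne
        rw [Function.update_of_ne hne] at hrep
        exact h6 hrep
      rw [hed, Function.update_self] at hrep
      rw [hed] at h5 h6
      rcases hr.replied with h7 | ⟨-, h7, h8⟩
      · rw [h7] at hrep; exact absurd hrep h6
      · rw [h7, Finset.mem_insert] at hrep
        have hls := hrep.resolve_right h6
        obtain ⟨k, hk, hkx⟩ := h5
        refine .inr (.inl ⟨⟨e₀.dst, l, _, now⟩, Multiset.mem_add.2 (.inr (mem_envs.2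
          ⟨rfl, rfl, by rw [h8, hls]; exact List.mem_singleton.2 rfl⟩)), hd, rfl, ?_, k,
          (st e₀.dst).VALUE, by rw [hk], hkx, ?_⟩)
        · have := hsync e he (h1 ▸ hl) h2
          dsimp only; linarith
        · exact hvk _ _ (hsafe.validKey_transfer hs hd hl hk (hsafe.key _ hd k hk).1)
    · refine .inl ⟨e, mem_pending_of_ne he ?_ _, h1, h2, h3, h4, (hle _ h2).keyGe _ h5, hrep⟩
      rintro rfl
      rw [Function.update_self] at hrep
      subst h1
      rw [h4] at hrcv
      simp only [receive, onKeyRequest, if_neg h6] at hrcv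
      cases hrcv
      exact hrep (Finset.mem_insert_self _ _)
  · by_cases hee : e = e₀
    · subst hee
      subst h2
      rw [h4] at hrcv
      obtain ⟨k', h7, h8⟩ := keyGe_of_receive_keyReply hrcv h6
      exact .inr (.inr ⟨k', by rw [Function.update_self]; exact h7, h5.trans h8⟩)
    · exact .inr (.inl ⟨e, mem_pending_of_ne he hee _, h1, h2, h3, k, v, h4, h5, hvk _ _ h6⟩)
  · exact .inr (.inr ((hle l hl).keyGe _ h))

end deliver

/-! ### Counting messages -/

/-- The number of shares that a party has produced in a view. -/
def LBV.numSigned (L : LBV n V) : ℕ :=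
  (L.signed .preKey).toNat + (L.signed .key).toNat + (L.signed .lock).toNat

open scoped Classical in
/-- A bound for the number of times that party `i` has sent a message to all parties. -/
noncomputable def LState.numBroadcasts (i : Fin n) (s : LState n V) : ℕ :=
  if s.Active i then
    1 + if (s.lbv (i.val + 1, i)).started = true then
      1 + waitRank (s.lbv (i.val + 1, i)).waiting else 0
  else 0

/-- A bound for the number of messages that party `i` has sent. -/
noncomputable def LState.cost (i : Fin n) (s : LState n V) : ℕ :=
  s.replied.card + ∑ l : Fin n, (s.lbv (l.val + 1, l)).numSigned + n * s.numBroadcasts i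

theorem numSigned_le_three (L : LBV n V) : L.numSigned ≤ 3 := by
  unfold LBV.numSigned
  have := (L.signed .preKey).toNat_le
  have := (L.signed .key).toNat_le
  have := (L.signed .lock).toNat_le
  omega

theorem toNat_mono {a b : Bool} (h : a = true → b = true) : a.toNat ≤ b.toNat := by
  cases a <;> simp_all

theorem numSigned_mono {L L' : LBV n V} (h : ∀ r, L.signed r = true → L'.signed r = true) :
    L.numSigned ≤ L'.numSigned := by
  have h1 := toNat_mono (h .preKey)
  have h2 := toNat_mono (h .key)
  have h3 := toNat_mono (h .lock)
  unfold LBV.numSigned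
  omega

theorem numSigned_lt {L L' : LBV n V} (h : ∀ r, L.signed r = true → L'.signed r = true)
    {r : Round} (h₀ : L.signed r = false) (h₁ : L'.signed r = true) :
    L.numSigned < L'.numSigned := by
  have h1 := toNat_mono (h .preKey)
  have h2 := toNat_mono (h .key)
  have h3 := toNat_mono (h .lock)
  unfold LBV.numSigned
  cases r <;> rw [h₀, h₁] at * <;> simp only [Bool.toNat_true, Bool.toNat_false] at * <;> omega

theorem numBroadcasts_mono {i : Fin n} {a b : ℕ} {s s' : LState n V} (hc : Core i a b s)
    (hle : s.Le i s') : s.numBroadcasts i ≤ s'.numBroadcasts i := by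
  unfold LState.numBroadcasts
  by_cases ha : s.Active i
  · rw [if_pos ha, if_pos (hle.active ha)]
    by_cases hst : (s.lbv (i.val + 1, i)).started = true
    · rw [if_pos hst, if_pos (hle.started _ hst)]
      obtain ⟨v, hv⟩ := hc.proposes _ hst
      have := (hle.proposal _ _ hv).2
      omega
    · rw [if_neg hst]; exact Nat.le_add_right _ _
  · rw [if_neg ha]; exact Nat.zero_le _

/-- One key request, one proposal and three certificates. -/
theorem numBroadcasts_le_five (i : Fin n) (s : LState n V) : s.numBroadcasts i ≤ 5 := by
  unfold LState.numBroadcasts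
  have := waitRank_le_three (s.lbv (i.val + 1, i)).waiting
  split_ifs <;> omega

theorem length_toAll (m : Msg n V) : (toAll m).length = n := by simp [toAll]

theorem cost_mono {i : Fin n} {a b : ℕ} {s s' : LState n V} (hc : Core i a b s)
    (hle : s.Le i s') (hr : s.replied.card ≤ s'.replied.card) : s.cost i ≤ s'.cost i := by
  unfold LState.cost
  have h1 : ∑ l : Fin n, (s.lbv (l.val + 1, l)).numSigned ≤
      ∑ l : Fin n, (s'.lbv (l.val + 1, l)).numSigned :=
    Finset.sum_le_sum fun l _ => numSigned_mono (hle.signed _)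
  have h2 := Nat.mul_le_mul_left n (numBroadcasts_mono hc hle)
  omega

theorem cost_broadcast {i : Fin n} {s s' : LState n V}
    (hle : s.Le i s') (hr : s.replied.card ≤ s'.replied.card)
    (hb : s.numBroadcasts i < s'.numBroadcasts i) : s.cost i + n ≤ s'.cost i := by
  unfold LState.cost
  have h1 : ∑ l : Fin n, (s.lbv (l.val + 1, l)).numSigned ≤
      ∑ l : Fin n, (s'.lbv (l.val + 1, l)).numSigned :=
    Finset.sum_le_sum fun l _ => numSigned_mono (hle.signed _)
  have h2 := Nat.mul_le_mul_left n (Nat.succ_le_of_lt hb)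
  rw [Nat.mul_succ] at h2
  omega

/-- Each message sent is paid for by a change that happens once: a raised share flag, a newly
answered requester, or a completed round. A started instance has sequence number one more than the
index of its leader, so its flags occur in the sum that defines `LState.cost`. -/
theorem cost_recv {t a b : ℕ} {i src : Fin n} {s s' : LState n V} {m : Msg n V} {out : Out n V}
    (hc : Core i a b s) (h : Recv t i src s m s' out) : s.cost i + out.length ≤ s'.cost i := by
  classical
  have hle := h.le
  have hsum : ∀ sq r, (s.lbv (sq, src)).started = true → (s.lbv (sq, src)).signed r = false →
      (s'.lbv (sq, src)).signed r = true → s'.replied = s.replied →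
      s.cost i + 1 ≤ s'.cost i := by
    intro sq r h1 h2 h3 h4
    obtain ⟨rfl, -⟩ := hc.started _ _ h1
    unfold LState.cost
    have h5 : ∑ l : Fin n, (s.lbv (l.val + 1, l)).numSigned <
        ∑ l : Fin n, (s'.lbv (l.val + 1, l)).numSigned :=
      Finset.sum_lt_sum (fun l _ => numSigned_mono (hle.signed _))
        ⟨src, Finset.mem_univ _, numSigned_lt (hle.signed _) h2 h3⟩
    have h6 := Nat.mul_le_mul_left n (numBroadcasts_mono hc hle)
    rw [h4]
    omega
  cases h with
  | ignore | store | collect | adopt => exact cost_mono hc hle le_rfl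
  | signPreKey sq value key hst hsg hacc =>
    exact hsum sq .preKey hst hsg (by simp [setLBV_lbv]) rfl
  | signNext r r' sq value hr hst hsg =>
    exact hsum sq r' hst hsg (by simp [setLBV_lbv]) rfl
  | fire r sq ρ v hv hst hsrc hf =>
    rw [length_toAll]
    refine cost_broadcast hle le_rfl ?_
    obtain ⟨rfl, -⟩ := hc.started _ _ hst
    have ha : s.Active i := .inr hst
    unfold LState.numBroadcasts
    rw [if_pos ha, if_pos (hle.active ha), if_pos hst, if_pos (hle.started _ hst), hf.1,
      setLBV_lbv, if_pos rfl]
    simp only [waitRank_next]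
    simp [waitRank]
  | reply hs =>
    unfold LState.cost
    have h6 := Nat.mul_le_mul_left n (numBroadcasts_mono hc hle)
    have h7 := Finset.card_insert_of_notMem hs
    simp only [List.length_singleton]
    omega

/-! ### The invariant of a run -/

/-- The end of phase `p`, for `p ≤ n`. -/
def phaseEnd (Δ : ℝ) : ℕ → ℝ
  | 0 => 0
  | j + 1 => slotEnd Δ j

open scoped Classical in
/-- The invariant of a synchronous run in phase `p`. -/
structure Inv (t : ℕ) (Δ : ℝ) (B : Finset (Fin n)) (c : Config n V) (p : ℕ) : Prop where
  shape : ∀ i, i ∉ B → Shape Δ i p (c.st i)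
  safe : Safe t B c.st c.sent
  pend : ∀ e ∈ c.pending, e ∈ c.sent
  clock : ∀ i, i ∉ B → ∀ w, (c.st i).wake = some w → c.time ≤ w
  query : ∀ l, l ∉ B → p = l.val + 1 → QueryInv Δ B c.st c.pending l
  view : ∀ l, l ∉ B → p = l.val + 1 → ViewInv Δ B c.st c.pending l
  decided : ∀ l, l ∉ B → l.val + 1 < p → (c.st l).Active l → ∀ i, i ∉ B → (c.st i).Decided
  unique : ∀ l l', l ∉ B → l' ∉ B → (c.st l).Active l → (c.st l').Active l' → l = l'
  cost : (c.sent.filter fun e => e.src ∉ B).length ≤ ∑ i ∈ Bᶜ, (c.st i).cost i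

theorem Inv.initial (t : ℕ) (Δ : ℝ) (B : Finset (Fin n)) (input : Fin n → V) :
    Inv t Δ B (Config.initial input) 0 where
  shape i _ := .initial Δ i _
  safe := .initial t B input
  pend := by simp [Config.initial]
  clock := by simp [Config.initial, LState.initial]
  query := by simp
  view := by simp
  decided := by simp
  unique := by simp [Config.initial, LState.initial, LState.Active, LBV.fresh]
  cost := by simp [Config.initial]

/-! ### Preservation by all events other than ends of waits -/

section step

variable {t p : ℕ} {Δ : ℝ} {B : Finset (Fin n)} {c : Config n V}

/-- The other parties start the view at the beginning of the slot and wedge it at its end; the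
leader has started it, having a proposal. So throughout this phase the handlers of all honest
parties are open to the leader. -/
theorem Inv.started_active (h : Inv t Δ B c p) {l : Fin n} (hl : l ∉ B) (hp : p = l.val + 1)
    (hv : ((c.st l).lbv (l.val + 1, l)).proposal ≠ none) {i : Fin n} (hi : i ∉ B) :
    ((c.st i).lbv (l.val + 1, l)).started = true ∧
      ((c.st i).lbv (l.val + 1, l)).active = true := by
  obtain ⟨v, hv⟩ := Option.ne_none_iff_exists'.1 hv
  have hst : ((c.st i).lbv (l.val + 1, l)).started = true := by
    by_cases hil : i = l
    · subst hil; exact (h.shape i hi).core.started_of_proposal hv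
    · have := (h.shape i hi).pos
      generalize hs : c.st i = s at this
      cases this with
      | start => omega
      | finished => have := l.isLt; omega
      | view l' _ _ hst =>
        obtain rfl : l = l' := Fin.ext (by omega)
        exact hst
      | query | skip => exact absurd (Fin.ext (by omega)) hil
  exact ⟨hst, (h.shape i hi).core.active _ _ hst (by omega)⟩

theorem Inv.deliver (hn : 3 * t < n) (hB : B.card ≤ t) (hΔ : 0 < Δ) (h : Inv t Δ B c p)
    {e : Env n V} {rest : Multiset (Env n V)} {s' : LState n V} {out : Out n V}
    (hpending : c.pending = e ::ₘ rest) (hdst : e.dst ∉ B)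
    (hout : receive t e.dst e.src (c.st e.dst) e.msg = (s', out))
    (hsync : ∀ e ∈ c.pending, e.src ∉ B → e.dst ∉ B → c.time ≤ e.sentAt + Δ) :
    Inv t Δ B
      { time := c.time
        st := Function.update c.st e.dst s'
        sent := c.sent ++ envs e.dst c.time out
        pending := rest + ↑(envs e.dst c.time out) } p := by
  classical
  have hr := recv_of_receive hout
  have hps := h.pend
  rw [hpending] at hps hsync
  have he := hps e (Multiset.mem_cons_self _ _)
  have hle := le_update (B := B) hr.le
  have hact : ∀ i, (Function.update c.st e.dst s' i).Active i ↔ (c.st i).Active i := by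
    intro i
    by_cases hi : i = e.dst
    · subst hi
      rw [Function.update_self]
      unfold LState.Active
      rw [hr.frame.2.2.2.1, (hr.frame.2.2.2.2.2 _).1]
    · rw [Function.update_of_ne hi]
  refine ⟨?_, h.safe.recv hn hB he hdst hr _, ?_, ?_, ?_, ?_, ?_, ?_, ?_⟩
  · intro i hi
    by_cases hid : i = e.dst
    · subst hid
      simp only [Function.update_self]
      exact (h.shape _ hi).recv hr
    · simp only [Function.update_of_ne hid]
      exact h.shape i hi
  · intro e' he'
    rcases Multiset.mem_add.1 he' with he' | he'
    · exact List.mem_append.2 (.inl (hps e' (Multiset.mem_cons_of_mem he')))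
    · exact List.mem_append.2 (.inr he')
  · intro i hi w hw
    by_cases hid : i = e.dst
    · subst hid
      simp only [Function.update_self, hr.frame.2.2.2.2.1] at hw
      exact h.clock _ hi w hw
    · simp only [Function.update_of_ne hid] at hw
      exact h.clock i hi w hw
  · intro l hl hp
    exact QueryInv.deliver hl hdst h.safe h.shape hout hsync (hpending ▸ h.query l hl hp)
  · intro l hl hp
    exact ViewInv.deliver hl hΔ hB h.safe hps hout hsync
      (fun hv i hi => h.started_active hl hp hv hi) (hpending ▸ h.view l hl hp)
  · intro l hl hp ha i hi
    exact (hle i hi).decided (h.decided l hl hp ((hact l).1 ha) i hi)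
  · intro l l' hl hl' ha ha'
    exact h.unique l l' hl hl' ((hact l).1 ha) ((hact l').1 ha')
  · have h1 : ((envs e.dst c.time out).filter fun e => e.src ∉ B).length = out.length := by
      rw [List.filter_eq_self.2]
      · simp [envs]
      · intro e' he'
        rw [(mem_envs.1 he').1]; simpa using hdst
    have h2 : e.dst ∈ Bᶜ := by simpa using hdst
    have h3 := h.cost
    rw [← Finset.add_sum_erase _ _ h2] at h3
    rw [List.filter_append, List.length_append, h1, ← Finset.add_sum_erase _ _ h2]
    have h4 : ∑ i ∈ Bᶜ.erase e.dst, (Function.update c.st e.dst s' i).cost i =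
        ∑ i ∈ Bᶜ.erase e.dst, (c.st i).cost i :=
      Finset.sum_congr rfl fun i hi => by
        rw [Function.update_of_ne (Finset.ne_of_mem_erase hi)]
    have h5 := cost_recv (h.shape _ hdst).core hr
    rw [h4]
    simp only [Function.update_self]
    omega

theorem Inv.deliverByz (h : Inv t Δ B c p)
    {e : Env n V} {rest : Multiset (Env n V)}
    (hpending : c.pending = e ::ₘ rest) (hdst : e.dst ∈ B) :
    Inv t Δ B { c with pending := rest } p := by
  have hp : ∀ e' ∈ c.pending, e'.src ∉ B → e'.dst ∉ B → e' ∈ rest := by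
    intro e' he' _ hd
    rw [hpending] at he'
    refine (Multiset.mem_cons.1 he').resolve_left ?_
    rintro rfl; exact hd hdst
  exact { h with
    pend := fun e' he' => h.pend e' (by rw [hpending]; exact Multiset.mem_cons_of_mem he')
    query := fun l hl hpl => (h.query l hl hpl).of_pending hl hp
    view := fun l hl hpl => (h.view l hl hpl).of_pending hl hp }

theorem Inv.byzSend (hn : 3 * t < n) (hB : B.card ≤ t) (h : Inv t Δ B c p) {e : Env n V}
    (hsrc : e.src ∈ B)
    (hsigs : ∀ σ ∈ e.msg.sigs, Derivable t B (fun σ' => ∃ e' ∈ c.sent, σ' ∈ e'.msg.sigs) σ) :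
    Inv t Δ B { c with sent := c.sent ++ [e], pending := e ::ₘ c.pending } p := by
  have hp : ∀ e' ∈ c.pending, e'.src ∉ B → e'.dst ∉ B → e' ∈ e ::ₘ c.pending :=
    fun e' he' _ _ => Multiset.mem_cons_of_mem he'
  refine { h with
    safe := h.safe.byzSend hn hB hsrc hsigs
    pend := fun e' he' => ?_
    query := fun l hl hpl => (h.query l hl hpl).of_pending hl hp
    view := fun l hl hpl => (h.view l hl hpl).of_pending hl hp
    cost := ?_ }
  · rcases Multiset.mem_cons.1 he' with rfl | he'
    · simp
    · exact List.mem_append.2 (.inl (h.pend e' he'))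
  · have := h.cost
    rw [List.filter_append, List.length_append]
    simpa [hsrc] using this

theorem Inv.advance (h : Inv t Δ B c p) {τ : ℝ}
    (hwake : ∀ i, i ∉ B → ∀ w, (c.st i).wake = some w → τ ≤ w) :
    Inv t Δ B { c with time := τ } p :=
  { h with clock := hwake }

end step

/-! ### Ends of waits -/

/-- The configuration after a tick. -/
noncomputable def Config.ticked (Δ : ℝ) (B : Finset (Fin n)) (c : Config n V) : Config n V where
  time := c.time
  st := fun i => (c.tickResult Δ B i).1
  sent := c.sent ++ (List.finRange n).flatMap fun i => envs i c.time (c.tickResult Δ B i).2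
  pending := c.pending +
    ↑((List.finRange n).flatMap fun i => envs i c.time (c.tickResult Δ B i).2)

section tick

variable {t p : ℕ} {Δ : ℝ} {B : Finset (Fin n)} {c : Config n V}

theorem tickResult_of_due {i : Fin n} (h : c.Due B i) :
    c.tickResult Δ B i = timeout Δ i c.time (c.st i) := if_pos h

theorem tickResult_of_not_due {i : Fin n} (h : ¬ c.Due B i) :
    c.tickResult Δ B i = (c.st i, []) := if_neg h

theorem mem_tick_pending {i : Fin n} {d : Fin n} {m : Msg n V}
    (h : (d, m) ∈ (c.tickResult Δ B i).2) :
    (⟨i, d, m, c.time⟩ : Env n V) ∈ (c.ticked Δ B).pending :=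
  Multiset.mem_add.2 (.inr (List.mem_flatMap.2 ⟨i, List.mem_finRange i, mem_envs.2 ⟨rfl, rfl, h⟩⟩))

theorem Inv.tick_safe (hn : 3 * t < n) (h : Inv t Δ B c p)
    (hT : ∀ i, i ∉ B → Ticked i (c.st i) (c.tickResult Δ B i).1 (c.tickResult Δ B i).2)
    (hlock : ∀ i, i ∉ B → ∀ x, ((c.ticked Δ B).st i).LOCK = some x →
      ∃ q, q ∉ B ∧ ((c.ticked Δ B).st q).KeyGe x) :
    Safe t B (c.ticked Δ B).st (c.ticked Δ B).sent := by
  refine h.safe.tick hn hT (fun e he => ?_) hlock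
  rcases List.mem_append.1 he with he | he
  · exact .inl he
  · obtain ⟨i, -, he⟩ := List.mem_flatMap.1 he
    obtain ⟨h1, -, h2⟩ := mem_envs.1 he
    rw [h1]
    refine .inr ⟨fun hi => ?_, h2⟩
    rw [tickResult_of_not_due fun hd => hd.1 hi] at h2
    simp at h2

theorem Inv.tick_pend (h : Inv t Δ B c p) :
    ∀ e ∈ (c.ticked Δ B).pending, e ∈ (c.ticked Δ B).sent := by
  intro e he
  rcases Multiset.mem_add.1 he with he | he
  · exact List.mem_append.2 (.inl (h.pend e he))
  · exact List.mem_append.2 (.inr he)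

open scoped Classical in
theorem Inv.tick_cost (h : Inv t Δ B c p)
    (hT : ∀ i, i ∉ B → Ticked i (c.st i) (c.tickResult Δ B i).1 (c.tickResult Δ B i).2)
    (hb : ∀ i, i ∉ B → (c.tickResult Δ B i).2 = [] ∨ ((c.tickResult Δ B i).2.length = n ∧
      (c.st i).numBroadcasts i < (c.tickResult Δ B i).1.numBroadcasts i)) :
    ((c.ticked Δ B).sent.filter fun e => e.src ∉ B).length ≤
      ∑ i ∈ Bᶜ, ((c.ticked Δ B).st i).cost i := by
  have h1 : (((List.finRange n).flatMap fun i =>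
      envs i c.time (c.tickResult Δ B i).2).filter fun e => e.src ∉ B).length ≤
      ∑ i ∈ Bᶜ, (c.tickResult Δ B i).2.length := by
    rw [List.filter_flatMap, List.length_flatMap, ← Finset.sum_filter_add_sum_filter_not Bᶜ
      (fun _ => True)]
    rw [← Fin.sum_univ_def]
    simp only [Finset.filter_true, not_true_eq_false, Finset.filter_false, Finset.sum_empty,
      add_zero]
    rw [← Finset.sum_subset (Finset.subset_univ Bᶜ)]
    · refine Finset.sum_le_sum fun i _ => ?_
      refine (List.length_filter_le _ _).trans ?_
      simp [envs]
    · intro i _ hi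
      rw [Finset.mem_compl, not_not] at hi
      rw [List.length_eq_zero_iff, List.filter_eq_nil_iff]
      intro e he
      rw [(mem_envs.1 he).1]
      simpa using hi
  have h2 := h.cost
  have h3 : ∑ i ∈ Bᶜ, ((c.st i).cost i + (c.tickResult Δ B i).2.length) ≤
      ∑ i ∈ Bᶜ, ((c.ticked Δ B).st i).cost i := by
    refine Finset.sum_le_sum fun i hi => ?_
    rw [Finset.mem_compl] at hi
    have hr : (c.st i).replied.card ≤ (c.tickResult Δ B i).1.replied.card :=
      (congrArg Finset.card (hT i hi).replied).ge
    rcases hb i hi with h4 | ⟨h4, h5⟩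
    · rw [h4]; exact cost_mono (h.shape i hi).core (hT i hi).le hr
    · rw [h4]; exact cost_broadcast (hT i hi).le hr h5
  rw [Finset.sum_add_distrib] at h3
  simp only [Config.ticked, List.filter_append, List.length_append] at *
  omega

theorem numBroadcasts_of_not_active {i : Fin n} {s : LState n V} (h : ¬ s.Active i) :
    s.numBroadcasts i = 0 := if_neg h

theorem numBroadcasts_pos {i : Fin n} {s : LState n V} (h : s.Active i) :
    0 < s.numBroadcasts i := by
  unfold LState.numBroadcasts
  rw [if_pos h]; omega

theorem one_lt_numBroadcasts {i : Fin n} {s : LState n V}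
    (h : (s.lbv (i.val + 1, i)).started = true) : 1 < s.numBroadcasts i := by
  unfold LState.numBroadcasts
  rw [if_pos (show s.Active i from .inr h), if_pos h]; omega

theorem timeout_of_start {i : Fin n} {s : LState n V} (h : s.pc = .start) (now : ℝ) :
    timeout Δ i now s = ({ (startView i 1 ⟨0, i.pos⟩ s).1 with
      pc := .view ⟨0, i.pos⟩, wake := some (now + 7 * Δ) }, (startView i 1 ⟨0, i.pos⟩ s).2) := by
  simp [timeout, h]

theorem timeout_of_query {i l : Fin n} {s : LState n V} (h : s.pc = .query l) (now : ℝ) :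
    timeout Δ i now s = ({ (startView i (l.val + 1) l s).1 with
      pc := .view l, wake := some (now + 7 * Δ) }, (startView i (l.val + 1) l s).2) := by
  simp [timeout, h]

theorem startView_leader_out (i : Fin n) (sq : ℕ) (s : LState n V) :
    (startView i sq i s).2 = toAll (.preKeyStep sq i s.VALUE s.KEY) := by
  simp [startView]

theorem startView_other_out {i l : Fin n} (h : l ≠ i) (sq : ℕ) (s : LState n V) :
    (startView i sq l s).2 = [] := by
  simp [startView, h]

/-- The view of an honest leader right after its start. -/
theorem viewInv_start {st' : Fin n → LState n V} {pending : Multiset (Env n V)} {l : Fin n}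
    {s : LState n V}
    (hl : (st' l).lbv (l.val + 1, l) = (startView l (l.val + 1) l s).1.lbv (l.val + 1, l))
    (hs : ∀ i, i ∉ B → ((st' i).lbv (l.val + 1, l)).signed .preKey = false)
    (hacc : ∀ i, i ∉ B → (st' i).Accepts s.VALUE s.KEY)
    (hp : ∀ i, (⟨l, i, .preKeyStep (l.val + 1) l s.VALUE s.KEY, leaderStart Δ l⟩ : Env n V) ∈
      pending) : ViewInv Δ B st' pending l := by
  intro v hv
  rw [startView_lbv, if_pos rfl, if_pos rfl] at hl
  rw [hl] at hv ⊢
  obtain rfl : s.VALUE = v := Option.some.inj hv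
  refine ⟨fun r hr i hi => ?_, fun h => by simp at h⟩
  obtain rfl : r = .preKey := by cases r <;> simp [waitRank, Round.rank] at hr ⊢
  exact .inl ⟨_, hp i, rfl, rfl, by simp [Round.rank], ⟨_, rfl, hacc i hi⟩, hs i hi⟩

theorem position_wake {i : Fin n} {s : LState n V} (h : Position Δ i s p) {w : ℝ}
    (hw : s.wake = some w) : (p = 0 ∧ w = 0) ∨ ∃ l : Fin n, p = l.val + 1 ∧
      ((w = slotEnd Δ l ∧ s.pc ≠ .query i) ∨
        (w = leaderStart Δ l ∧ s.pc = .query i ∧ i = l ∧ 0 < i.val)) := by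
  cases h with
  | start hpc hw' => rw [hw'] at hw; exact .inl ⟨rfl, (Option.some.inj hw).symm⟩
  | view l hpc hw' =>
    rw [hw'] at hw
    exact .inr ⟨l, rfl, .inl ⟨(Option.some.inj hw).symm, by simp [hpc]⟩⟩
  | query h0 hpc hw' =>
    rw [hw'] at hw; exact .inr ⟨i, rfl, .inr ⟨(Option.some.inj hw).symm, hpc, rfl, h0⟩⟩
  | skip h0 hpc hw' =>
    rw [hw'] at hw
    exact .inr ⟨i, rfl, .inl ⟨(Option.some.inj hw).symm, by simp [hpc]⟩⟩
  | finished hpc hw' => rw [hw'] at hw; cases hw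

theorem Inv.key_lt (h : Inv t Δ B c p) {i : Fin n} (hi : i ∉ B) {k : Key n V}
    (hk : (c.st i).KEY = some k) : ∃ l : Fin n, k.sq = l.val + 1 ∧ l.val < p - 1 := by
  obtain ⟨l, h1, -⟩ := (h.safe.key i hi k hk).1
  exact ⟨l, (h.shape i hi).core.leader _ _ h1⟩

/-- The start of the first view. -/
theorem Inv.tick_start (hn : 3 * t < n) (hΔ : 0 < Δ) (h : Inv t Δ B c 0)
    (htime : c.time = 0) : Inv t Δ B (c.ticked Δ B) 1 := by
  have hn0 : 0 < n := by omega
  have hpos : ∀ i, i ∉ B → (c.st i).pc = .start ∧ (c.st i).wake = some 0 := by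
    intro i hi
    have := (h.shape i hi).pos
    generalize hp : 0 = p at this
    cases this <;> first | omega | exact ⟨by assumption, by assumption⟩
  have hres : ∀ i, i ∉ B → c.tickResult Δ B i = timeout Δ i 0 (c.st i) := by
    intro i hi
    rw [tickResult_of_due ⟨hi, by rw [(hpos i hi).2, htime]⟩, htime]
  set l : Fin n := ⟨0, hn0⟩ with hl
  have hres : ∀ i, i ∉ B → c.tickResult Δ B i =
      ({ (startView i (l.val + 1) l (c.st i)).1 with
        pc := .view l, wake := some (0 + 7 * Δ) }, (startView i (l.val + 1) l (c.st i)).2) := by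
    intro i hi
    rw [hres i hi, timeout_of_start (hpos i hi).1]
  have hun : ∀ i, i ∉ B → ∀ x, (c.st i).lbv x = LBV.fresh n V := fun i hi x =>
    (h.shape i hi).core.fresh _ ((h.shape i hi).core.unstarted (sq := x.1) (l := x.2)
      (Nat.zero_le _))
  have hT : ∀ i, i ∉ B → Ticked i (c.st i) (c.tickResult Δ B i).1 (c.tickResult Δ B i).2 := by
    intro i hi
    rw [hres i hi]
    exact ticked_startView (hun i hi _) (by simp [(hpos i hi).1])
  -- A key held by an honest party belongs to a wedged view, and none is wedged yet. Without honest
  -- keys there are no honest locks, so every proposal of the first view is acceptable.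
  have hnokey : ∀ i, i ∉ B → (c.st i).KEY = none := by
    intro i hi
    by_contra hk
    obtain ⟨k, hk⟩ := Option.ne_none_iff_exists'.1 hk
    obtain ⟨l, -, h1⟩ := h.key_lt hi hk
    omega
  have hnolock : ∀ i, i ∉ B → (c.st i).LOCK = none := by
    intro i hi
    by_contra hk
    obtain ⟨x, hk⟩ := Option.ne_none_iff_exists'.1 hk
    obtain ⟨q, hq, k, hk, -⟩ := h.safe.lock i hi x hk
    rw [hnokey q hq] at hk; cases hk
  have hlock : ∀ i, i ∉ B → ((c.ticked Δ B).st i).LOCK = none := by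
    intro i hi
    simp only [Config.ticked, hres i hi]
    rw [(startView_frame _ _ _ _).1, hnolock i hi]
  have hact : ∀ i, i ∉ B → ((c.ticked Δ B).st i).Active i → i = l := by
    intro i hi ha
    simp only [Config.ticked, hres i hi] at ha
    rcases ha with ha | ha
    · simp only [reduceCtorEq] at ha
    · simp only [startView_lbv] at ha
      split_ifs at ha with h1 h2
      · exact (Prod.mk.inj h1).2
      · exact (Prod.mk.inj h1).2
      · simp [hun i hi, LBV.fresh] at ha
  have hshape : ∀ i, i ∉ B → Shape Δ i 1 ((c.ticked Δ B).st i) := by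
    intro i hi
    simp only [Config.ticked, hres i hi]
    have hst : ((startView i (l.val + 1) l (c.st i)).1.lbv (l.val + 1, l)).started = true := by
      rw [startView_lbv, if_pos rfl]; split_ifs <;> rfl
    refine ⟨core_startView (h.shape i hi).core (Nat.zero_le _) Nat.one_pos (Nat.zero_le _)
      (by simp [hun i hi, LBV.fresh]), .view l rfl ?_ hst, fun hp => ?_⟩
    · simp [slotEnd, hl]
    · obtain rfl : i = l := Fin.ext (by simp [hl]; omega)
      exact .inl (.inr hst)
  refine ⟨hshape, h.tick_safe hn hT ?_, h.tick_pend, ?_, ?_, ?_, ?_, ?_, h.tick_cost hT ?_⟩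
  · intro i hi x hx
    rw [hlock i hi] at hx; cases hx
  · intro i hi w hw
    simp only [Config.ticked, hres i hi, Option.some.injEq] at hw ⊢
    linarith
  · intro l' hl' _ hq
    simp [Config.ticked, hres l' hl'] at hq
  · intro l' hl' hp
    obtain rfl : l' = l := Fin.ext (by simp [hl]; omega)
    refine viewInv_start (s := c.st l) ?_ ?_ ?_ ?_
    · simp only [Config.ticked, hres l hl']
    · intro i hi
      have := ((hT i hi).votes (l.val + 1, l)).1
      simp only [Config.ticked, this, hun i hi, LBV.fresh]
    · intro i hi
      exact ⟨.inl (hlock i hi), fun k hk => by rw [hnokey l hl'] at hk; cases hk⟩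
    · intro i
      have h0 : leaderStart Δ l = c.time := by rw [htime]; simp [leaderStart, hl]
      rw [h0]
      refine mem_tick_pending ?_
      rw [hres l hl', startView_leader_out]
      exact mem_toAll _ _
  · intro l' _ hp; omega
  · intro l₁ l₂ h1 h2 ha1 ha2
    rw [hact l₁ h1 ha1, hact l₂ h2 ha2]
  · intro i hi
    by_cases hil : l = i
    · subst hil
      right
      constructor
      · rw [hres _ hi, startView_leader_out, length_toAll]
      · rw [numBroadcasts_of_not_active]
        · refine numBroadcasts_pos ?_
          rw [hres _ hi]
          right
          simp [startView_lbv]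
        · simp [LState.Active, (hpos _ hi).1, hun _ hi, LBV.fresh]
    · left
      rw [hres _ hi, startView_other_out hil]

/-- The start of the view of a leader that has asked for keys. -/
theorem Inv.tick_query (hn : 3 * t < n) (hΔ : 0 < Δ) {l : Fin n} (hl : l ∉ B)
    (h : Inv t Δ B c (l.val + 1)) (hpc : (c.st l).pc = .query l) (htime : c.time = leaderStart Δ l)
    (hsync : ∀ e ∈ c.pending, e.src ∉ B → e.dst ∉ B → c.time < e.sentAt + Δ) :
    Inv t Δ B (c.ticked Δ B) (l.val + 1) := by
  have hlt : leaderStart Δ l < slotEnd Δ l := by unfold leaderStart slotEnd; linarith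
  have hwl : (c.st l).wake = some (leaderStart Δ l) ∧
      ((c.st l).lbv (l.val + 1, l)).started = false := by
    have := (h.shape l hl).pos
    generalize c.st l = s at this hpc
    generalize l.val + 1 = q at this
    cases this <;> simp_all
  have hother : ∀ i, i ∉ B → i ≠ l → c.tickResult Δ B i = (c.st i, []) := by
    intro i hi hil
    refine tickResult_of_not_due fun hd => ?_
    rcases position_wake (h.shape i hi).pos hd.2 with ⟨h1, -⟩ | ⟨l', h1, ⟨h2, -⟩ | ⟨-, -, h2, -⟩⟩
    · omega
    · obtain rfl : l = l' := Fin.ext (by omega)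
      linarith
    · exact hil (by rw [h2]; exact Fin.ext (by omega))
  have hresl : c.tickResult Δ B l = ({ (startView l (l.val + 1) l (c.st l)).1 with
        pc := .view l, wake := some (leaderStart Δ l + 7 * Δ) },
        (startView l (l.val + 1) l (c.st l)).2) := by
    rw [tickResult_of_due ⟨hl, by rw [hwl.1, htime]⟩, timeout_of_query hpc, htime]
  have hfresh := (h.shape l hl).core.fresh _ hwl.2
  have hT : ∀ i, i ∉ B → Ticked i (c.st i) (c.tickResult Δ B i).1 (c.tickResult Δ B i).2 := by
    intro i hi
    by_cases hil : i = l
    · subst hil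
      rw [hresl]
      exact ticked_startView hfresh fun _ => rfl
    · rw [hother i hi hil]; exact .refl _ _
  have hlock : ∀ i, i ∉ B → ((c.ticked Δ B).st i).LOCK = (c.st i).LOCK := by
    intro i hi
    simp only [Config.ticked]
    by_cases hil : i = l
    · subst hil
      rw [hresl]
      exact (startView_frame _ _ _ _).1
    · rw [hother i hi hil]
  have hact : ∀ i, i ∉ B → ((c.ticked Δ B).st i).Active i → (c.st i).Active i := by
    intro i hi ha
    by_cases hil : i = l
    · subst hil; exact .inl hpc
    · simp only [Config.ticked, hother i hi hil] at ha; exact ha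
  have hst : ((startView l (l.val + 1) l (c.st l)).1.lbv (l.val + 1, l)).started = true := by
    rw [startView_lbv, if_pos rfl, if_pos rfl]
  refine ⟨?_, h.tick_safe hn hT ?_, h.tick_pend, ?_, ?_, ?_, ?_, ?_, h.tick_cost hT ?_⟩
  · intro i hi
    by_cases hil : i = l
    · subst hil
      simp only [Config.ticked, hresl]
      exact ⟨core_startView (h.shape i hi).core le_rfl (Nat.lt_succ_self _) le_rfl hwl.2,
        .view i rfl rfl hst, fun _ => .inl (.inr hst)⟩
    · simp only [Config.ticked, hother i hi hil]; exact h.shape i hi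
  · intro i hi x hx
    rw [hlock i hi] at hx
    obtain ⟨q, hq, hk⟩ := h.safe.lock i hi x hx
    exact ⟨q, hq, (hT q hq).le.keyGe x hk⟩
  · intro i hi w hw
    by_cases hil : i = l
    · subst hil
      simp only [Config.ticked, hresl, Option.some.injEq] at hw ⊢
      rw [htime]; linarith
    · simp only [Config.ticked, hother i hi hil] at hw; exact h.clock i hi w hw
  · intro l' hl' hp hq
    obtain rfl : l' = l := Fin.ext (by omega)
    simp [Config.ticked, hresl] at hq
  · intro l' hl' hp
    obtain rfl : l' = l := Fin.ext (by omega)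
    refine viewInv_start (s := c.st l') ?_ ?_ ?_ ?_
    · simp only [Config.ticked, hresl]
    · intro i hi
      have := ((hT i hi).votes (l'.val + 1, l')).1
      simp only [Config.ticked, this]
      -- A share in this view presupposes a proposal of the honest leader, whose instance is still
      -- fresh.
      by_contra hs
      obtain ⟨v, hv, -⟩ := h.safe.signed i hi (l'.val + 1, l') _ (by simpa using hs) hl
      dsimp only at hv
      rw [hfresh] at hv
      simp [LBV.fresh] at hv
    · intro i hi
      constructor
      · rw [hlock i hi]
        cases hx : (c.st i).LOCK with
        | none => exact .inl rfl
        | some x =>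
          right
          -- At this moment a pending request or reply would be overdue: the strict inequality at
          -- ticks leaves only the case that the leader holds a key matching the lock.
          rcases h.query l' hl hp hpc i hi x hx with ⟨e, he, h1, h2, h3, -⟩ |
            ⟨e, he, h1, h2, h3, -⟩ | ⟨k, hk, hkx⟩
          · have := hsync e he (h1 ▸ hl) h2; linarith
          · have := hsync e he h1 (h2 ▸ hl); linarith
          · exact ⟨k, x, hk, rfl, hkx⟩
      · intro k hk
        exact (h.safe.validKey_transfer h.shape hl hi hk (h.safe.key _ hl k hk).1).mono
          (hT i hi).leader
    · intro i
      rw [← htime]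
      refine mem_tick_pending ?_
      rw [hresl, startView_leader_out]
      exact mem_toAll _ _
  · intro l' hl' hp ha i hi
    exact (hT i hi).le.decided (h.decided l' hl' hp (hact l' hl' ha) i hi)
  · intro l₁ l₂ h1 h2 ha1 ha2
    exact h.unique l₁ l₂ h1 h2 (hact l₁ h1 ha1) (hact l₂ h2 ha2)
  · intro i hi
    by_cases hil : i = l
    · subst hil
      right
      constructor
      · rw [hresl, startView_leader_out, length_toAll]
      · have h1 : (c.st i).numBroadcasts i = 1 := by
          unfold LState.numBroadcasts
          rw [if_pos (show (c.st i).Active i from .inl hpc), hwl.2]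
          simp
        rw [h1, hresl]
        exact one_lt_numBroadcasts hst
    · left
      rw [hother i hi hil]

/-- The end of a slot. -/
theorem Inv.tick_slotEnd (hn : 3 * t < n) (hB : B.card ≤ t) (hΔ : 0 < Δ) {l : Fin n}
    (h : Inv t Δ B c (l.val + 1)) (htime : c.time = slotEnd Δ l)
    (hsync : ∀ e ∈ c.pending, e.src ∉ B → e.dst ∉ B → c.time < e.sentAt + Δ) :
    Inv t Δ B (c.ticked Δ B) (l.val + 2) := by
  have hlt : leaderStart Δ l < slotEnd Δ l := by unfold leaderStart slotEnd; linarith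
  have hdue : ∀ i, i ∉ B → (c.st i).wake = some c.time ∧ (c.st i).pc ≠ .query i := by
    intro i hi
    have hp := (h.shape i hi).pos
    cases hw : (c.st i).wake with
    | none =>
      generalize c.st i = s at hp hw
      generalize hq : l.val + 1 = q at hp
      cases hp with
      | finished => have := l.isLt; omega
      | _ => simp_all
    | some w =>
      rcases position_wake hp hw with ⟨h1, -⟩ | ⟨l', h1, ⟨h2, h3⟩ | ⟨h2, h3, -⟩⟩
      · omega
      · obtain rfl : l = l' := Fin.ext (by omega)
        exact ⟨by rw [h2, htime], h3⟩
      · obtain rfl : l = l' := Fin.ext (by omega)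
        have := h.clock i hi w hw
        linarith
  have hres : ∀ i, i ∉ B → c.tickResult Δ B i = timeout Δ i (slotEnd Δ l) (c.st i) := by
    intro i hi
    rw [tickResult_of_due ⟨hi, (hdue i hi).1⟩, htime]
  have hT : ∀ i, i ∉ B → Ticked i (c.st i) (c.tickResult Δ B i).1 (c.tickResult Δ B i).2 := by
    intro i hi
    rw [hres i hi]
    exact ticked_slotEnd (h.shape i hi) (hdue i hi).2 fun k hk => (h.safe.key i hi k hk).1
  have hact := fun i hi => active_slotEnd (now := slotEnd Δ l) (h.shape i hi) (hdue i hi).2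
  have hshape : ∀ i, i ∉ B → Shape Δ i (l.val + 2) ((c.ticked Δ B).st i) := by
    intro i hi
    simp only [Config.ticked, hres i hi]
    exact shape_slotEnd (h.shape i hi) (hdue i hi).2
  have hlock : ∀ i, i ∉ B → ∀ x, ((c.ticked Δ B).st i).LOCK = some x →
      ∃ q, q ∉ B ∧ ((c.ticked Δ B).st q).KeyGe x := by
    intro i hi x hx
    simp only [Config.ticked, hres i hi] at hx
    rcases lock_slotEnd (h.shape i hi) (hdue i hi).2 hx with h1 | ⟨rfl, h1⟩
    · obtain ⟨q, hq, hk⟩ := h.safe.lock i hi x h1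
      exact ⟨q, hq, (hT q hq).le.keyGe x hk⟩
    -- A fresh lock comes from a lockProof. An honest contributor to its signature holds a keyProof
    -- of the same view, and turns it into its KEY in this same tick.
    · obtain ⟨cc, hcc⟩ := Option.ne_none_iff_exists'.1 h1
      obtain ⟨h2, h3⟩ := h.safe.proofs i hi _ _ cc hcc
      rw [h2] at h3
      obtain ⟨q, hq, h4, -, h5, -⟩ := h3
      refine ⟨q, hq, ?_⟩
      simp only [Config.ticked, hres q hq]
      exact keyGe_slotEnd (h.shape q hq) h4 (h5 rfl)
  have hinactive : ∀ i, i ∉ B → i.val = l.val + 1 → ¬ (c.st i).Active i := by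
    intro i hi hil
    rintro (ha | ha)
    · exact (hdue i hi).2 ha
    · have := ((h.shape i hi).core.started _ _ ha).2
      omega
  have hdecided : ∀ l', l' ∉ B → l'.val + 1 < l.val + 2 → ((c.ticked Δ B).st l').Active l' →
      ∀ i, i ∉ B → ((c.ticked Δ B).st i).Decided := by
    intro l' hl' hp ha i hi
    have ha' : (c.st l').Active l' := by
      rcases hact l' hl' with ⟨-, -, h1⟩ | ⟨-, h1, -⟩
      · simp only [Config.ticked, hres l' hl'] at ha; exact h1 ha
      · omega
    rcases Nat.lt_succ_iff_lt_or_eq.1 hp with h1 | h1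
    · exact (hT i hi).le.decided (h.decided l' hl' h1 ha' i hi)
    · obtain rfl : l' = l := Fin.ext (by omega)
      -- The leader of the closing slot is active and no longer querying, so it has proposed, and
      -- all commit messages are in.
      obtain ⟨v, hv⟩ := (h.shape l' hl').core.proposes _ (ha'.resolve_left (hdue l' hl').2)
      simp only [Config.ticked, hres i hi]
      exact decided_slotEnd (h.shape i hi)
        (h.started_active hl' rfl (by simp [hv]) hi).1
        ((h.view l' hl' rfl).all_committed hl' hΔ hB h.safe
          (fun e he h1 h2 => by rw [← htime]; exact hsync e he h1 h2) hv hi)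
  refine ⟨hshape, h.tick_safe hn hT hlock, h.tick_pend, ?_, ?_, ?_, hdecided, ?_,
    h.tick_cost hT ?_⟩
  · intro i hi w hw
    change c.time ≤ w
    rw [htime]
    rcases position_wake (hshape i hi).pos hw with ⟨h1, -⟩ | ⟨l', h1, h2⟩
    · omega
    · have h3 : (l'.val : ℝ) = l.val + 1 := by
        have : l'.val = l.val + 1 := by omega
        rw [this]; push_cast; rfl
      rcases h2 with ⟨rfl, -⟩ | ⟨rfl, -⟩ <;> unfold slotEnd <;>
        first
        | (unfold leaderStart; rw [h3]; linarith)
        | (rw [h3]; linarith)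
  · intro l' hl' hp hq i hi x hx
    obtain ⟨q, hqB, hk⟩ := hlock i hi x hx
    have hout : (c.tickResult Δ B l').2 = toAll .keyRequest := by
      rw [hres l' hl']
      simp only [Config.ticked, hres l' hl'] at hq
      rcases hact l' hl' with ⟨-, h1, -⟩ | ⟨h1, -⟩
      · exact absurd hq h1
      · exact h1
    -- The new leader's request is on its way to the honest holder of a matching key. That holder
    -- has not answered it before, since answering an honest party presupposes that it was active.
    refine .inl ⟨⟨l', q, .keyRequest, c.time⟩, mem_tick_pending (by rw [hout]; exact mem_toAll _ _),
      rfl, hqB, ?_, rfl, hk, ?_⟩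
    · have h3 : (l'.val : ℝ) = l.val + 1 := by
        have : l'.val = l.val + 1 := by omega
        rw [this]; push_cast; rfl
      rw [htime]
      unfold slotEnd leaderStart
      rw [h3]; linarith
    · intro hrep
      simp only [Config.ticked, (hT q hqB).replied] at hrep
      exact hinactive l' hl' (by omega) (h.safe.replied q hqB l' hrep hl')
  · intro l' hl' hp v hv
    exfalso
    obtain ⟨b, hb⟩ := own_lbv_slotEnd (now := slotEnd Δ l) (h.shape l' hl') (hdue l' hl').2
      (l'.val + 1)
    simp only [Config.ticked, hres l' hl'] at hv
    rw [hb] at hv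
    have := ((h.shape l' hl').core.started _ _ ((h.shape l' hl').core.started_of_proposal hv)).2
    omega
  · intro l₁ l₂ h1 h2 ha1 ha2
    have ha1' := ha1
    have ha2' := ha2
    simp only [Config.ticked, hres l₁ h1] at ha1'
    simp only [Config.ticked, hres l₂ h2] at ha2'
    have hlt : ∀ i, i ∉ B → (c.st i).Active i → i.val + 1 < l.val + 2 := by
      intro i hi ha
      rcases ha with ha | ha
      · exact absurd ha (hdue i hi).2
      · have := ((h.shape i hi).core.started _ _ ha).2
        omega
    -- Whoever was active before has now made everybody decide, whereas whoever becomes active now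
    -- is undecided; two who become active now lead the same slot.
    rcases hact l₁ h1 with ⟨-, -, h3⟩ | ⟨-, h3, h3', -⟩ <;>
      rcases hact l₂ h2 with ⟨-, -, h4⟩ | ⟨-, h4, h4', -⟩
    · exact h.unique l₁ l₂ h1 h2 (h3 ha1') (h4 ha2')
    · have := hdecided l₁ h1 (hlt l₁ h1 (h3 ha1')) ha1 l₂ h2
      simp only [Config.ticked, hres l₂ h2] at this
      exact absurd this h4'
    · have := hdecided l₂ h2 (hlt l₂ h2 (h4 ha2')) ha2 l₁ h1
      simp only [Config.ticked, hres l₁ h1] at this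
      exact absurd this h3'
    · exact Fin.ext (by omega)
  · intro i hi
    rw [hres i hi]
    rcases hact i hi with ⟨h1, -⟩ | ⟨h1, h2, -, h3⟩
    · exact .inl h1
    · right
      rw [h1, length_toAll, numBroadcasts_of_not_active (hinactive i hi h2)]
      exact ⟨rfl, numBroadcasts_pos h3⟩

end tick

/-- A step of a synchronous run remains in the current phase or ends it on time. -/
theorem Inv.step {t p : ℕ} {Δ : ℝ} {B : Finset (Fin n)} {c c' : Config n V} {ev : Event n V}
    (hn : 3 * t < n) (hB : B.card ≤ t) (hΔ : 0 < Δ) (h : Inv t Δ B c p)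
    (hstep : Step t Δ B c ev c')
    (hsync : ∀ e ∈ c.pending, e.src ∉ B → e.dst ∉ B →
      c.time ≤ e.sentAt + Δ ∧ (ev = .tick → c.time < e.sentAt + Δ)) :
    Inv t Δ B c' p ∨ (Inv t Δ B c' (p + 1) ∧ c'.time = phaseEnd Δ p) := by
  cases hstep with
  | deliver e rest s' out h1 h2 h3 =>
    exact .inl (h.deliver hn hB hΔ h1 h2 h3 fun e he hs hd => (hsync e he hs hd).1)
  | deliverByz e rest h1 h2 => exact .inl (h.deliverByz h1 h2)
  | byzSend e h1 h2 h3 => exact .inl (h.byzSend hn hB h1 h3)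
  | advance τ h1 h2 => exact .inl (h.advance h2)
  | tick hdue =>
    obtain ⟨i, hi, hw⟩ := hdue
    have hsync' := fun e he hs hd => (hsync e he hs hd).2 rfl
    rcases position_wake (h.shape i hi).pos hw with ⟨rfl, h2⟩ | ⟨l, rfl, ⟨h2, -⟩ | ⟨h2, h3, rfl, -⟩⟩
    · exact .inr ⟨h.tick_start hn hΔ h2, h2⟩
    · exact .inr ⟨h.tick_slotEnd hn hB hΔ h2 hsync', h2⟩
    · exact .inl (h.tick_query hn hΔ hi h3 h2 hsync')

/-! ### Progress of a run -/

theorem started_startView {i : Fin n} {sq : ℕ} {l : Fin n} {s : LState n V} {x : ℕ × Fin n}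
    (h : (s.lbv x).started = true) : ((startView i sq l s).1.lbv x).started = true := by
  rw [startView_lbv]; split_ifs <;> simp [h]

theorem started_enterView {Δ : ℝ} {i : Fin n} {j : ℕ} {now : ℝ} {s : LState n V} {x : ℕ × Fin n}
    (h : (s.lbv x).started = true) : ((enterView Δ i j now s).1.lbv x).started = true := by
  rw [enterView_lbv]; split_ifs <;> simp [h]

theorem started_wedgeAndUpdate {sq : ℕ} {l : Fin n} {s : LState n V} {x : ℕ × Fin n}
    (h : (s.lbv x).started = true) : ((wedgeAndUpdate sq l s).lbv x).started = true := by
  rw [wedgeAndUpdate_lbv]; split_ifs <;> simp [h]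

theorem active_timeout {Δ : ℝ} {i : Fin n} {now : ℝ} {s : LState n V} (h : s.Active i) :
    (timeout Δ i now s).1.Active i := by
  right
  unfold LState.Active at h
  unfold timeout
  split <;> rename_i hpc <;> simp only [hpc, reduceCtorEq, false_or, PC.query.injEq] at h
  · exact started_startView h
  · exact started_enterView (started_wedgeAndUpdate h)
  · rcases h with rfl | h
    · simp [startView_lbv]
    · exact started_startView h
  · exact started_enterView h
  · exact h

theorem active_step {t : ℕ} {Δ : ℝ} {B : Finset (Fin n)} {c c' : Config n V} {ev : Event n V}
    (h : Step t Δ B c ev c') {i : Fin n} (hi : i ∉ B) (ha : (c.st i).Active i) :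
    (c'.st i).Active i := by
  cases h with
  | deliver e rest s' out h1 h2 h3 =>
    exact (le_update (B := B) (recv_of_receive h3).le i hi).active ha
  | deliverByz | byzSend | advance => exact ha
  | tick =>
    dsimp only [Config.tickResult]
    split_ifs
    · exact active_timeout ha
    · exact ha

/-- Every wait ends no later than the current slot, and the clock does not pass a wait, so the time
determines a lower bound for the phase. -/
theorem Inv.phase_of_time {t p : ℕ} {Δ : ℝ} {B : Finset (Fin n)} {c : Config n V} (hΔ : 0 < Δ)
    (h : Inv t Δ B c p) {i : Fin n} (hi : i ∉ B) {l : Fin n} (ht : slotEnd Δ l < c.time) :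
    l.val + 1 < p := by
  have hpos := (h.shape i hi).pos
  cases hw : (c.st i).wake with
  | none =>
    generalize c.st i = s at hpos hw
    cases hpos with
    | finished => have := l.isLt; omega
    | _ => simp_all
  | some w =>
    have hle := h.clock i hi w hw
    rcases position_wake hpos hw with ⟨-, rfl⟩ | ⟨l', rfl, h2⟩
    · have : 0 ≤ slotEnd Δ l := by unfold slotEnd; positivity
      linarith
    · have hw' : w ≤ slotEnd Δ l' := by
        rcases h2 with ⟨rfl, -⟩ | ⟨rfl, -⟩
        · exact le_rfl
        · unfold leaderStart slotEnd; linarith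
      have h3 : slotEnd Δ l < slotEnd Δ l' := by linarith
      unfold slotEnd at h3
      have h4 : (l.val : ℝ) < l'.val := by
        by_contra hc
        nlinarith
      have : l.val < l'.val := by exact_mod_cast h4
      omega

section run

variable {t : ℕ} {Δ : ℝ} {B : Finset (Fin n)} {input : Fin n → V} {ρ : Run n t Δ B input}

/-- Party `l` has decided already when its slot begins. -/
def Run.DecidedBefore (ρ : Run n t Δ B input) (l : Fin n) : Prop :=
  0 < l.val ∧ ∃ k, (ρ.cfg k).time = phaseEnd Δ l ∧ ((ρ.cfg k).st l).Decided

/-- `Inv` speaks of one configuration, while progress concerns moments in the past. The two extra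
clauses record what was true when each slot began and when it ended. -/
theorem Run.exists_inv (hn : 3 * t < n) (hΔ : 0 < Δ) (hB : B.card ≤ t) (hρ : ρ.Synchronous)
    (k : ℕ) : ∃ p, Inv t Δ B (ρ.cfg k) p ∧
      (∀ l, l ∉ B → l.val < p → ((ρ.cfg k).st l).Active l ∨ ρ.DecidedBefore l) ∧
      (∀ l, l ∉ B → l.val + 1 < p → ρ.DecidedBefore l ∨
        ∃ k', (ρ.cfg k').time = slotEnd Δ l ∧ ∀ i, i ∉ B → ((ρ.cfg k').st i).Decided) := by
  induction k with
  | zero =>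
    refine ⟨0, ?_, by simp, by simp⟩
    rw [ρ.start]; exact .initial t Δ B input
  | succ k ih =>
    obtain ⟨p, h1, h2, h3⟩ := ih
    have h2' : ∀ l, l ∉ B → l.val < p → ((ρ.cfg (k + 1)).st l).Active l ∨ ρ.DecidedBefore l :=
      fun l hl hp => (h2 l hl hp).imp_left (active_step (ρ.step k) hl)
    rcases h1.step hn hB hΔ (ρ.step k) (hρ k) with h4 | ⟨h4, h5⟩
    · exact ⟨p, h4, h2', h3⟩
    · refine ⟨p + 1, h4, fun l hl hp => ?_, fun l hl hp => ?_⟩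
      · rcases Nat.lt_succ_iff_lt_or_eq.1 hp with hp | hp
        · exact h2' l hl hp
        · refine ((h4.shape l hl).part (by omega)).imp_right fun hd => ⟨hd.1, k + 1, ?_, hd.2⟩
          rw [h5, hp]
      · rcases Nat.lt_succ_iff_lt_or_eq.1 hp with hp' | hp'
        · exact h3 l hl hp'
        · rcases h2' l hl (by omega) with ha | hd
          · refine .inr ⟨k + 1, ?_, h4.decided l hl hp ha⟩
            rw [h5, ← hp']; rfl
          · exact .inl hd

/-- Time diverges, so the slot of `l` is over eventually. If `l` had decided when its slot began,
this was at `leaderStart Δ l - 2Δ`, contrary to the hypothesis; so everybody decided at the end of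
the slot. -/
theorem Run.conditionalProgress (hn : 3 * t < n) (hΔ : 0 < Δ) (hB : B.card ≤ t)
    (hρ : ρ.Synchronous) : ρ.ConditionalProgress := by
  intro l hl hnd
  obtain ⟨k, hk⟩ := ρ.diverges (slotEnd Δ l + 1)
  obtain ⟨p, h1, -, h3⟩ := ρ.exists_inv hn hΔ hB hρ k
  rcases h3 l hl (h1.phase_of_time hΔ hl (by linarith)) with ⟨h0, k', h4, h5⟩ | ⟨k', h4, h5⟩
  · refine absurd h5 (hnd k' ?_)
    rw [h4]
    obtain ⟨j, hj⟩ := Nat.exists_eq_succ_of_ne_zero h0.ne'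
    unfold leaderStart
    rw [hj]
    simp only [phaseEnd, slotEnd, Nat.succ_eq_add_one]
    push_cast
    linarith
  · exact ⟨k', h4.le, h5⟩

theorem Run.terminates_of_conditionalProgress (h : ρ.ConditionalProgress) : ρ.Terminates := by
  intro i hi
  by_cases hd : ∀ k, (ρ.cfg k).time < leaderStart Δ i → ¬ ((ρ.cfg k).st i).Decided
  · obtain ⟨k, -, hk⟩ := h i hi hd
    exact ⟨k, hk i hi⟩
  · push Not at hd
    obtain ⟨k, -, hk⟩ := hd
    exact ⟨k, hk⟩

end run

/-! ### Communication cost -/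

/-- A header, at most one value and at most one signature. -/
theorem words_le_three (m : Msg n V) : m.words ≤ 3 := by
  cases m with
  | preKeyStep _ _ _ k => cases k <;> simp [Msg.words, Msg.values, Msg.sigs]
  | keyReply k => cases k <;> simp [Msg.words, Msg.values, Msg.sigs]
  | _ => simp [Msg.words, Msg.values, Msg.sigs]

theorem totalWords_le (es : List (Env n V)) : totalWords es ≤ 3 * es.length := by
  induction es with
  | nil => simp [totalWords]
  | cons e es ih =>
    have := words_le_three e.msg
    simp only [totalWords, List.map_cons, List.sum_cons, List.length_cons] at *
    omega

/-- By `unique`, the set `A` of active honest parties has at most one element, and honest parties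
reply to and sign for members of `B ∪ A` only. So each of them sends at most `f + 1` replies and
`3(f + 1)` shares, and all broadcasts come from `A`. -/
theorem Inv.sum_cost_le {t p : ℕ} {Δ : ℝ} {B : Finset (Fin n)} {c : Config n V}
    (h : Inv t Δ B c p) : ∑ i ∈ Bᶜ, (c.st i).cost i ≤ 9 * n * (B.card + 1) := by
  classical
  set A : Finset (Fin n) := Bᶜ.filter fun l => (c.st l).Active l with hA
  have hmem : ∀ l, l ∈ A ↔ l ∉ B ∧ (c.st l).Active l := by simp [hA]
  have hA1 : A.card ≤ 1 := Finset.card_le_one.2 fun l hl l' hl' =>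
    h.unique l l' ((hmem l).1 hl).1 ((hmem l').1 hl').1 ((hmem l).1 hl).2 ((hmem l').1 hl').2
  have hBA : (B ∪ A).card ≤ B.card + 1 := (Finset.card_union_le _ _).trans (by omega)
  have hrep : ∀ i, i ∉ B → (c.st i).replied.card ≤ B.card + 1 := by
    intro i hi
    refine (Finset.card_le_card fun q hq => ?_).trans hBA
    rw [Finset.mem_union, hmem]
    by_cases hqB : q ∈ B
    · exact .inl hqB
    · exact .inr ⟨hqB, h.safe.replied i hi q hq hqB⟩
  have hsig : ∀ i, i ∉ B →
      ∑ l : Fin n, ((c.st i).lbv (l.val + 1, l)).numSigned ≤ 3 * (B.card + 1) := by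
    intro i hi
    rw [← Finset.sum_subset (Finset.subset_univ (B ∪ A))]
    · refine (Finset.sum_le_card_nsmul _ _ 3 fun l _ => numSigned_le_three _).trans ?_
      rw [smul_eq_mul]; omega
    · intro l _ hl
      rw [Finset.mem_union, hmem, not_or] at hl
      have : ∀ r, ((c.st i).lbv (l.val + 1, l)).signed r = false := by
        intro r
        by_contra hr
        obtain ⟨v, hv, -⟩ := h.safe.signed i hi (l.val + 1, l) r (by simpa using hr) hl.1
        exact hl.2 ⟨hl.1, .inr ((h.shape l hl.1).core.started_of_proposal hv)⟩
      simp [LBV.numSigned, this]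
  have hbr : ∑ i ∈ Bᶜ, (c.st i).numBroadcasts i ≤ 5 := by
    rw [← Finset.sum_subset (show A ⊆ Bᶜ from Finset.filter_subset _ _)]
    · refine (Finset.sum_le_card_nsmul _ _ 5 fun i _ => numBroadcasts_le_five i _).trans ?_
      rw [smul_eq_mul]; omega
    · intro i hi hn
      refine numBroadcasts_of_not_active fun ha => hn ?_
      exact (hmem i).2 ⟨by simpa using hi, ha⟩
  have hBc : (Bᶜ).card ≤ n := (Finset.card_le_univ _).trans (by simp)
  calc ∑ i ∈ Bᶜ, (c.st i).cost i
      ≤ ∑ i ∈ Bᶜ, (4 * (B.card + 1) + n * (c.st i).numBroadcasts i) := by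
        refine Finset.sum_le_sum fun i hi => ?_
        rw [Finset.mem_compl] at hi
        have h1 := hrep i hi
        have h2 := hsig i hi
        unfold LState.cost
        omega
    _ = (Bᶜ).card * (4 * (B.card + 1)) + n * ∑ i ∈ Bᶜ, (c.st i).numBroadcasts i := by
        rw [Finset.sum_add_distrib, Finset.sum_const, smul_eq_mul, Finset.mul_sum]
    _ ≤ n * (4 * (B.card + 1)) + n * 5 :=
        Nat.add_le_add (Nat.mul_le_mul_right _ hBc) (Nat.mul_le_mul_left _ hbr)
    _ ≤ 9 * n * (B.card + 1) := by nlinarith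

theorem Run.honestCost_le {t : ℕ} {Δ : ℝ} {B : Finset (Fin n)} {input : Fin n → V}
    {ρ : Run n t Δ B input} (hn : 3 * t < n) (hΔ : 0 < Δ) (hB : B.card ≤ t)
    (hρ : ρ.Synchronous) : ρ.honestCost ≤ ((27 * n * (B.card + 1) : ℕ) : ℕ∞) := by
  refine iSup_le fun k => ?_
  obtain ⟨p, h, -⟩ := ρ.exists_inv hn hΔ hB hρ k
  have h1 := h.cost.trans h.sum_cost_le
  rw [Nat.cast_le]
  refine (totalWords_le _).trans ?_
  calc _ ≤ 3 * (9 * n * (B.card + 1)) := Nat.mul_le_mul_left 3 (by convert h1)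
    _ = 27 * n * (B.card + 1) := by ring

theorem totalWords_mono {es es' : List (Env n V)} (h : es.Sublist es') :
    totalWords es ≤ totalWords es' :=
  (h.map _).sum_le_sum fun _ _ => Nat.zero_le _

theorem Run.commCost_le_honestCost {t : ℕ} {Δ : ℝ} {B : Finset (Fin n)} {input : Fin n → V}
    (ρ : Run n t Δ B input) : ρ.commCost ≤ ρ.honestCost := by
  refine iSup_mono fun k => ?_
  rw [Nat.cast_le]
  refine totalWords_mono ?_
  exact List.monotone_filter_right _ fun e he => by
    simp only [decide_eq_true_eq] at he ⊢
    exact he.1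

end AdaptiveBA

/-! ### The main theorem -/

theorem mainTheorem3 :
    (∀ (V : Type*) (n t : ℕ) (Δ : ℝ) (B : Finset (Fin n)) (input : Fin n → V)
      (ρ : AdaptiveBA.Run n t Δ B input),
      3 * t < n → 0 < Δ → B.card ≤ t → ρ.Synchronous →
        ρ.ConditionalProgress ∧ ρ.Terminates) ∧
    (∀ K : ℕ, ∃ C : ℕ, ∀ (V : Type*) (n t f : ℕ) (Δ : ℝ) (B : Finset (Fin n)) (input : Fin n → V)
      (ρ : AdaptiveBA.Run n t Δ B input),
      3 * t < n → n ≤ K * t → 0 < Δ → B.card = f → f ≤ t → ρ.Synchronous →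
        ρ.commCost ≤ ((C * (f * t + t) : ℕ) : ℕ∞) ∧
        ρ.honestCost ≤ ((C * (f * t + t) : ℕ) : ℕ∞)) := by
  -- The constant `27 * K` comes from three words for each of at most `9n(f + 1)` messages, with `n
  -- ≤ K * t`.
  refine ⟨fun V n t Δ B input ρ hn hΔ hB hρ => ?_, fun K => ⟨27 * K, ?_⟩⟩
  · have h := ρ.conditionalProgress hn hΔ hB hρ
    exact ⟨h, ρ.terminates_of_conditionalProgress h⟩
  · rintro V n t f Δ B input ρ hn hK hΔ rfl hB hρ
    have h : ρ.honestCost ≤ ((27 * K * (B.card * t + t) : ℕ) : ℕ∞) := by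
      refine (ρ.honestCost_le hn hΔ hB hρ).trans ?_
      rw [Nat.cast_le]
      calc 27 * n * (B.card + 1) ≤ 27 * (K * t) * (B.card + 1) := by gcongr
        _ = 27 * K * (B.card * t + t) := by ring
    exact ⟨ρ.commCost_le_honestCost.trans h, h⟩
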